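/- Let $(X_i,D_i,Y_i)_{i\ge1}$ be i.i.d. copies of $(X,D,Y)\in\mathbb R^d\times\{0,1\}\times\mathbb R$, let $\mathcal X$ and $\mathcal Y$ be the supports of $X$ and $Y$, let $e(x)=\mathrm P(D=1\mid X=x)$, and assume that $c<e(X)<1-c$ almost surely for some constant $c>0$. Let $m\ge1$, let $\mathcal X_\phi\subset\mathbb R^m$, and let $\phi_0,\phi_1:\mathcal X\to\mathcal X_\phi$ be measurable. For $\omega\in\{0,1\}$ let $\hat\phi_\omega$ be an estimator of $\phi_\omega$, that is, a map $\mathcal X\to\mathbb R^m$ which depends on the sample $\{(X_i,D_i,Y_i)\}_{i=1}^n$ and not on the labelling of its units. Let $M=M_n$ be a sequence of natural numbers. For $i\le n$ let $\mathcal J_\phi(i)$ be the index set of the $M_n$ nearest neighbors of $\hat\phi_{1-D_i}(X_i)$ among $\{\hat\phi_{1-D_i}(X_j):D_j=1-D_i\}$ in Euclidean distance, with ties broken in an arbitrary (measurable) way (if there are fewer than $M_n$ such $j$, all of them are taken), and let $K_\phi(i)=\sum_{j\le n,\,D_j=1-D_i}\mathbf 1\big(i\in\mathcal J_\phi(j)\big)$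 be the number of matched times of unit $i$. Assume: (i) $\mathcal X_\phi$ has finite diameter and finite surface area ($(m-1)$-dimensional Hausdorff measure of its boundary); (ii) for $\omega=0,1$, $\phi_\omega(X)$ has a Lebesgue density that is continuous over the support of $\phi_\omega(X)$; (iii) for $\omega=0,1$, $\mathrm P(D=1\mid\phi_\omega(X)=\phi_\omega(x))=\mathrm P(D=1\mid X=x)$ for almost all $x\in\mathcal X$; (iv) $M_n\log n/n\to0$ and $M_n\to\infty$ as $n\to\infty$. Write $\|g\|_\infty=\sup_{x\in\mathcal X}\|g(x)\|$, and let $\hat\phi_\omega(\cdot;x_1,x_2)$ be the estimator computed from the $n$ points obtained by inserting two new points with covariates $x_1,x_2\in\mathcal X$ (and, if the estimator uses outcomes, with outcomes in $\mathcal Y$) into the group $D=1-\omega$ of a sample of $n-2$ i.i.d. observations; $\sup_{x_1,x_2}$ is the supremum over all such pairs of inserted points. Assume that one of the following two conditions holds (with outer expectations and outer probabilities where measurability fails). (A) (moment rate) For $\omega=0,1$, $$\lim_{n\to\infty}\mathrm E\Big[\Big(\frac n{M_n}\Big)^2\sup_{x_1,x_2}\big\|\hat\phi_\omega(\cdot;x_1,x_2)-\phi_\omega\big\|_\infty^{2m}\Big]=0.$$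 (B) (modulus) For $\omega=0,1$ and every $\epsilon>0$ there are functions $T_\epsilon=T_{\epsilon,n}:(0,\infty)\to[0,\infty]$ such that for all $u>0$ $$\mathrm P\Big(\sup_{\delta\ge u}\delta^{-1}\sup_{s,t\in\mathcal X,\ \|\phi_\omega(s)-\phi_\omega(t)\|\le\delta}\ \sup_{x_1,x_2}\big\|(\hat\phi_\omega(\cdot;x_1,x_2)-\phi_\omega)(s)-(\hat\phi_\omega(\cdot;x_1,x_2)-\phi_\omega)(t)\big\|>\epsilon\Big)\le T_\epsilon(u),$$ $$\lim_{n\to\infty}\Big(\frac n{M_n}\Big)^k\int_0^\infty u^{k-1}T_\epsilon(u^{1/m})\,\mathrm du=0\quad(k=1,2),\qquad \lim_{n\to\infty}\Big(\frac n{M_n}\Big)^2\mathrm P\big(\|\hat\phi_\omega-\phi_\omega\|_\infty>\epsilon\big)=0,$$ where in the last limit $\hat\phi_\omega$ is computed from $n$ i.i.d. observations. Then $$\lim_{n\to\infty}\mathrm E\Big[\frac{K_\phi(1)}{M_n}-\Big(D_1\frac{1-e(X_1)}{e(X_1)}+(1-D_1)\frac{e(X_1)}{1-e(X_1)}\Big)\Big]^2=0.$$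 -/

import Mathlib

open MeasureTheory ProbabilityTheory Filter Topology
open scoped ENNReal

noncomputable section

namespace Matching

/-- One observation `(X, D, Y)`: covariates in `ℝ^d`, treatment indicator (`true` is `D = 1`) and
outcome. -/
abbrev Obs (d : ℕ) : Type := EuclideanSpace ℝ (Fin d) × Bool × ℝ

/-- The covariate vector of an observation. -/
def Obs.X {d : ℕ} (o : Obs d) : EuclideanSpace ℝ (Fin d) := o.1

/-- The treatment of an observation. -/
def Obs.D {d : ℕ} (o : Obs d) : Bool := o.2.1

/-- The outcome of an observation. -/
def Obs.Y {d : ℕ} (o : Obs d) : ℝ := o.2.2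

/-- A pair of estimators `(φ̂₀, φ̂₁)` of maps `ℝ^d → ℝ^m`, defined for samples of every size.
The sample enters as a multiset: the estimator does not depend on the labelling of the units. -/
abbrev Estimator (d m : ℕ) : Type :=
  Bool → Multiset (Obs d) → EuclideanSpace ℝ (Fin d) → EuclideanSpace ℝ (Fin m)

/-- The multiset of the observations of a sample of size `n`. -/
def sampleOf {d n : ℕ} (s : Fin n → Obs d) : Multiset (Obs d) := Finset.univ.val.map s

/-- The support of `X`: the topological support of its law. -/
def covSupport {d : ℕ} (Q : Measure (Obs d)) : Set (EuclideanSpace ℝ (Fin d)) :=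
  (Q.map Obs.X).support

/-- The support of `Y`. -/
def outSupport {d : ℕ} (Q : Measure (Obs d)) : Set ℝ := (Q.map Obs.Y).support

/-- The regular conditional probability `P(D = 1 | g(X) = u)` when `(X, D, Y)` has law `Q`. -/
def condTreat {d : ℕ} {F : Type*} [MeasurableSpace F] (Q : Measure (Obs d)) [IsFiniteMeasure Q]
    (g : EuclideanSpace ℝ (Fin d) → F) (u : F) : ℝ :=
  (condDistrib (Obs.D (d := d)) (fun o : Obs d => g o.X) Q u).real {true}

/-- The propensity score `e(x) = P(D = 1 | X = x)`. -/
def propensity {d : ℕ} (Q : Measure (Obs d)) [IsFiniteMeasure Q]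
    (x : EuclideanSpace ℝ (Fin d)) : ℝ :=
  condTreat Q id x

/-- Overlap: `c < e(X) < 1 - c` almost surely, for some constant `c > 0`. -/
def Overlap {d : ℕ} (Q : Measure (Obs d)) [IsFiniteMeasure Q] : Prop :=
  ∃ c : ℝ, 0 < c ∧ ∀ᵐ x ∂(Q.map Obs.X), c < propensity Q x ∧ propensity Q x < 1 - c

/-- `A` is an index set of `M` nearest neighbours of unit `i` in the opposite treatment group, for
the Euclidean distance between the values of `ψ (1 - D_i)`. Ties may be broken in any way. If the
opposite group has fewer than `M` units, all of them are taken. -/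
def IsMatchSet {d m n : ℕ} (M : ℕ) (s : Fin n → Obs d)
    (ψ : Bool → EuclideanSpace ℝ (Fin d) → EuclideanSpace ℝ (Fin m))
    (i : Fin n) (A : Finset (Fin n)) : Prop :=
  (∀ j ∈ A, (s j).D = !(s i).D) ∧
  A.card = min M (Finset.univ.filter fun j => (s j).D = !(s i).D).card ∧
  ∀ j ∈ A, ∀ k, k ∉ A → (s k).D = (!(s i).D) →
    dist (ψ (!(s i).D) (s j).X) (ψ (!(s i).D) (s i).X) ≤
      dist (ψ (!(s i).D) (s k).X) (ψ (!(s i).D) (s i).X)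

/-- The number of matched times of unit `i`, for matched sets `J j`. -/
def matchedTimes {d n : ℕ} (s : Fin n → Obs d) (J : Fin n → Finset (Fin n)) (i : Fin n) : ℕ :=
  (Finset.univ.filter fun j => (s j).D = (!(s i).D) ∧ i ∈ J j).card

/-- `D (1 - e(X)) / e(X) + (1 - D) e(X) / (1 - e(X))`. -/
def oddsTarget {d : ℕ} (Q : Measure (Obs d)) [IsFiniteMeasure Q] (o : Obs d) : ℝ :=
  if o.D then (1 - propensity Q o.X) / propensity Q o.X
  else propensity Q o.X / (1 - propensity Q o.X)

/-- Regularity of the transformed covariates. The set `Xφ ⊆ ℝ^m` is the common codomain of the maps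
`φ ω`. Surface area is the `(m - 1)`-dimensional Hausdorff measure of the boundary. -/
structure Regular {d m : ℕ} (Q : Measure (Obs d)) [IsFiniteMeasure Q]
    (φ : Bool → EuclideanSpace ℝ (Fin d) → EuclideanSpace ℝ (Fin m))
    (Xφ : Set (EuclideanSpace ℝ (Fin m))) : Prop where
  mapsTo : ∀ ω, Set.MapsTo (φ ω) (covSupport Q) Xφ
  diam_bounded : Bornology.IsBounded Xφ
  surface_finite : Measure.hausdorffMeasure ((m : ℝ) - 1) (frontier Xφ) < ∞
  density : ∀ ω, ∃ f : EuclideanSpace ℝ (Fin m) → ℝ, Measurable f ∧ (∀ u, 0 ≤ f u) ∧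
    Q.map (fun o => φ ω o.X) = volume.withDensity (fun u => ENNReal.ofReal (f u)) ∧
    ContinuousOn f (Q.map (fun o => φ ω o.X)).support
  preserved : ∀ ω, ∀ᵐ x ∂(Q.map Obs.X), condTreat Q (φ ω) (φ ω x) = propensity Q x

/-- Outer expectation; it equals `∫⁻ a, f a ∂μ` for measurable `f`. Suprema over uncountable sets
need not be measurable. -/
def outerExp {α : Type*} [MeasurableSpace α] (μ : Measure α) (f : α → ℝ≥0∞) : ℝ≥0∞ :=
  ⨅ (g : α → ℝ≥0∞) (_ : Measurable g) (_ : ∀ a, f a ≤ g a), ∫⁻ a, g a ∂μ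

/-- The estimator `φ̂_ω(·; x₁, x₂)`: two more observations, with covariates `x₁, x₂` (and outcomes
`y₁, y₂`), are inserted into the group `D = 1 - ω` of the sample `s`. -/
def inserted {d m n : ℕ} (φhat : Estimator d m) (ω : Bool) (s : Fin n → Obs d)
    (p₁ p₂ : EuclideanSpace ℝ (Fin d) × ℝ) :
    EuclideanSpace ℝ (Fin d) → EuclideanSpace ℝ (Fin m) :=
  φhat ω ((p₁.1, !ω, p₁.2) ::ₘ (p₂.1, !ω, p₂.2) ::ₘ sampleOf s)

/-- The supremum norm over the support of `X`. -/
def supNorm {d m : ℕ} (Q : Measure (Obs d))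
    (g : EuclideanSpace ℝ (Fin d) → EuclideanSpace ℝ (Fin m)) : ℝ≥0∞ :=
  ⨆ x ∈ covSupport Q, ‖g x‖ₑ

/-- `sup_{x₁, x₂} ‖φ̂_ω(·; x₁, x₂) - φ_ω‖_∞`. -/
def insertedError {d m n : ℕ} (Q : Measure (Obs d))
    (φ : Bool → EuclideanSpace ℝ (Fin d) → EuclideanSpace ℝ (Fin m))
    (φhat : Estimator d m) (ω : Bool) (s : Fin n → Obs d) : ℝ≥0∞ :=
  ⨆ p₁ ∈ covSupport Q ×ˢ outSupport Q, ⨆ p₂ ∈ covSupport Q ×ˢ outSupport Q,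
    supNorm Q (fun x => inserted φhat ω s p₁ p₂ x - φ ω x)

/-- `sup_{δ ≥ u} δ⁻¹ sup_{‖φ_ω(s) - φ_ω(t)‖ ≤ δ} sup_{x₁, x₂}
‖(φ̂_ω(·; x₁, x₂) - φ_ω)(s) - (φ̂_ω(·; x₁, x₂) - φ_ω)(t)‖`. -/
def insertedModulus {d m n : ℕ} (Q : Measure (Obs d))
    (φ : Bool → EuclideanSpace ℝ (Fin d) → EuclideanSpace ℝ (Fin m))
    (φhat : Estimator d m) (ω : Bool) (u : ℝ) (s : Fin n → Obs d) : ℝ≥0∞ :=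
  ⨆ (δ : ℝ) (_ : u ≤ δ), (ENNReal.ofReal δ)⁻¹ *
    ⨆ a ∈ covSupport Q, ⨆ b ∈ covSupport Q, ⨆ (_ : ‖φ ω a - φ ω b‖ ≤ δ),
      ⨆ p₁ ∈ covSupport Q ×ˢ outSupport Q, ⨆ p₂ ∈ covSupport Q ×ˢ outSupport Q,
        ‖(inserted φhat ω s p₁ p₂ a - φ ω a) - (inserted φhat ω s p₁ p₂ b - φ ω b)‖ₑ

/-- The law of `n` i.i.d. observations. -/
def sampleLaw {d : ℕ} (Q : Measure (Obs d)) (n : ℕ) : Measure (Fin n → Obs d) :=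
  Measure.pi fun _ => Q

/-- Moment-rate condition. The estimator with two points inserted into `n` observations is computed
from `n + 2` points, so that the sample size `n + 2` and its number of matches `M (n + 2)` enter. -/
def MomentRate {d m : ℕ} (Q : Measure (Obs d))
    (φ : Bool → EuclideanSpace ℝ (Fin d) → EuclideanSpace ℝ (Fin m))
    (φhat : Estimator d m) (M : ℕ → ℕ) : Prop :=
  ∀ ω, Tendsto (fun n : ℕ => outerExp (sampleLaw Q n) fun s =>
      (((n + 2 : ℕ) : ℝ≥0∞) / (M (n + 2) : ℝ≥0∞)) ^ 2 * insertedError Q φ φhat ω s ^ (2 * m))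
    atTop (𝓝 0)

/-- Modulus condition. The bound `T` may depend on the sample size. Probabilities of sets that are
not measurable are outer probabilities. -/
def ModulusRate {d m : ℕ} (Q : Measure (Obs d))
    (φ : Bool → EuclideanSpace ℝ (Fin d) → EuclideanSpace ℝ (Fin m))
    (φhat : Estimator d m) (M : ℕ → ℕ) : Prop :=
  ∀ ω, ∀ ε : ℝ, 0 < ε →
    (∃ T : ℕ → ℝ → ℝ≥0∞,
      (∀ n : ℕ, ∀ u : ℝ, 0 < u →
        sampleLaw Q n {s | ENNReal.ofReal ε < insertedModulus Q φ φhat ω u s} ≤ T n u) ∧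
      ∀ k ∈ Finset.Icc 1 2, Tendsto (fun n : ℕ =>
          (((n + 2 : ℕ) : ℝ≥0∞) / (M (n + 2) : ℝ≥0∞)) ^ k *
            ∫⁻ u in Set.Ioi (0 : ℝ), ENNReal.ofReal (u ^ (k - 1)) * T n (u ^ (1 / (m : ℝ))))
        atTop (𝓝 0)) ∧
    Tendsto (fun n : ℕ => ((n : ℝ≥0∞) / (M n : ℝ≥0∞)) ^ 2 *
        sampleLaw Q n
          {s | ENNReal.ofReal ε < supNorm Q (fun x => φhat ω (sampleOf s) x - φ ω x)})
      atTop (𝓝 0)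

end Matching

end

/-!
Fix a group `ω`. Its units are the possible matches (the donors), the units of the other group are
the queries, and everything is seen through `U = φ_ω(X)`. By overlap and the preservation of the
propensity score, the law `ν₁` of `U` on the donors and the law `ν₀` on the queries have bounded
densities `f₁`, `f₀` on a bounded set with `f₀ ≤ c f₁`, and the target equals the ratio
`T = f₀ / f₁` at a donor (`exists_isDominatedPair`). Write `K` for the number of matched times of
the first unit, `E` for the integral over the event that it is a donor, and `S = ∫ T² dν₁`. Since
`(K/M - T)² + 2 (K/M) T = (K/M)² + T²`, it suffices that `E (K/M)² ≤ S + o(1)` and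
`E (K/M) T ≥ S - o(1)`.

**The estimator.** Either rate condition gives a random scale `ζ`, of mean `o((M/n)²)`, such that
with any two inserted queries the error of the estimator changes by at most the fraction `ε` of the
`φ`-distance of two points, whenever the `2m`-th power of that distance is at least `ζ`
(`HasStableScale`). Hence if a query is matched to a donor at distance `r`, either `r` is below
the stable scale or fewer than `M` other donors are within `(1 - 2ε) r` of the query
(`closerCount_lt_of_mem`); there is a converse for unmatched donors (`le_card_of_notMem`).

**Upper bound.** Expanding `K²` into pairs of queries and inserting exactly these two queries, the
rest of the sample is independent of them, so that a pair contributes the mean of the square of a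
`ν₀`-mass (`measure_both_matched_le`). Distances below the stable scale contribute at most a
constant times the mean of `ζ`. For the rest a Chernoff bound replaces the event of few closer
donors by `ν₁(ball v (ρ |u - v|)) ≤ τ` with `τ` about `M/n`. For almost every `u` the `ν₀`-mass of
these `v` is asymptotically at most `τ T(u) / ρ^m` by Lebesgue differentiation; the integral
converges along with it because the third moment of that mass is `O(τ³)`
(`exists_lintegral_measure_cube_le`), which follows from Stone's covering lemma
(`exists_measure_ball_dist_le`) by a packing argument.

**Lower bound.** Around a donor `u` at which `f₁` is not small there is a ball of `ν₁`-mass a little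
below `M/n`, and queries in it whose own slightly larger ball also has mass below `M/n` are *near*.
Their expected number, weighted with `T`, is `M S` to first order by Fatou's lemma
(`eventually_le_lintegral_nearPairs`). A near query is not matched to the donor only if the ball
is below the stable scale or holds `M` other donors; the first is excluded by Markov's inequality
for `ζ` and the second by a Chernoff bound. A second query has to be inserted along with the near
one; as a positive fraction of the units are queries, a union bound over it costs only a constant
factor (`sum_measure_le_of_inter_le`).
-/

set_option linter.unusedSectionVars false

noncomputable section

namespace Matching

/-! ### Third moment of the mass of the far points -/

section Quantile

open Metric Set

/-- Stone's lemma: the points `v` for which the ball about `v` that reaches to `y` has small mass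
have small mass together. -/
theorem exists_measure_ball_dist_le (E : Type*) [NormedAddCommGroup E] [NormedSpace ℝ E]
    [FiniteDimensional ℝ E] [MeasurableSpace E] [BorelSpace E] :
    ∃ N : ℕ, ∀ (ν : Measure E) (y : E) (τ : ℝ≥0∞) (D : ℝ),
      ν {v | v ≠ y ∧ dist v y ≤ D ∧ ν (ball v (dist v y)) ≤ τ} ≤ N * τ := by
  obtain ⟨N, τ', hτ', hN⟩ := HasBesicovitchCovering.no_satelliteConfig (α := E)
  refine ⟨N, fun ν y τ D => ?_⟩
  set S : Set E := {v | v ≠ y ∧ dist v y ≤ D ∧ ν (ball v (dist v y)) ≤ τ} with hS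
  let q : Besicovitch.BallPackage S E :=
    { c := fun v => v
      r := fun v => dist (v : E) y
      rpos := fun v => dist_pos.2 v.2.1
      r_bound := D
      r_le := fun v => v.2.2.1 }
  obtain ⟨s, hdisj, hcov⟩ := Besicovitch.exist_disjoint_covering_families hτ' hN q
  have hsub : S ⊆ ⋃ i : Fin N, ⋃ j ∈ s i, ball (q.c j) (q.r j) := by
    intro v hv
    exact hcov ⟨⟨v, hv⟩, rfl⟩
  -- All the balls contain `y`, so that a disjoint family among them has at most one member.
  have hone : ∀ i, ν (⋃ j ∈ s i, ball (q.c j) (q.r j)) ≤ τ := by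
    intro i
    have hss : (s i).Subsingleton := by
      intro a ha b hb
      by_contra hab
      have := hdisj i ha hb hab
      have hy : ∀ c : S, y ∈ closedBall (q.c c) (q.r c) := fun c =>
        (dist_comm _ _).le
      exact Set.disjoint_left.1 this (hy a) (hy b)
    rcases hss.eq_empty_or_singleton with h | ⟨a, h⟩
    · simp [h]
    · rw [h]
      simpa [q] using a.2.2.2
  calc ν S ≤ ν (⋃ i : Fin N, ⋃ j ∈ s i, ball (q.c j) (q.r j)) := measure_mono hsub
    _ ≤ ∑ i : Fin N, ν (⋃ j ∈ s i, ball (q.c j) (q.r j)) := measure_iUnion_fintype_le _ _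
    _ ≤ ∑ _i : Fin N, τ := Finset.sum_le_sum fun i _ => hone i
    _ = N * τ := by simp

section

variable {E : Type*} [PseudoMetricSpace E] [MeasurableSpace E]

/-- The largest radius, at most `D`, of an open ball about `v` of `ν`-mass at most `τ`. -/
def quantileRadius (ν : Measure E) (τ : ℝ≥0∞) (D : ℝ) (v : E) : ℝ :=
  sSup {r | 0 ≤ r ∧ r ≤ D ∧ ν (ball v r) ≤ τ}

theorem bddAbove_quantileRadius (ν : Measure E) (τ : ℝ≥0∞) (D : ℝ) (v : E) :
    BddAbove {r | 0 ≤ r ∧ r ≤ D ∧ ν (ball v r) ≤ τ} := ⟨D, fun _ hr => hr.2.1⟩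

theorem le_quantileRadius {ν : Measure E} {τ : ℝ≥0∞} {D r : ℝ} {v : E} (h0 : 0 ≤ r) (hD : r ≤ D)
    (h : ν (ball v r) ≤ τ) : r ≤ quantileRadius ν τ D v :=
  le_csSup (bddAbove_quantileRadius ν τ D v) ⟨h0, hD, h⟩

theorem quantileRadius_nonneg {ν : Measure E} {τ : ℝ≥0∞} {D : ℝ} (hD : 0 ≤ D) (v : E) :
    0 ≤ quantileRadius ν τ D v := le_quantileRadius le_rfl hD (by simp)

theorem quantileRadius_le {ν : Measure E} {τ : ℝ≥0∞} {D : ℝ} (hD : 0 ≤ D) (v : E) :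
    quantileRadius ν τ D v ≤ D :=
  csSup_le ⟨0, le_rfl, hD, by simp⟩ fun _ hr => hr.2.1

theorem measure_ball_le_of_lt_quantileRadius {ν : Measure E} {τ : ℝ≥0∞} {D r : ℝ} (hD : 0 ≤ D)
    {v : E} (h : r < quantileRadius ν τ D v) : ν (ball v r) ≤ τ := by
  obtain ⟨r', hr', hlt⟩ := exists_lt_of_lt_csSup (⟨0, le_rfl, hD, by simp⟩ :
    {r | 0 ≤ r ∧ r ≤ D ∧ ν (ball v r) ≤ τ}.Nonempty) h
  exact (measure_mono (ball_subset_ball hlt.le)).trans hr'.2.2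

theorem measurable_quantileRadius [BorelSpace E] (ν : Measure E) (τ : ℝ≥0∞) {D : ℝ} (hD : 0 ≤ D) :
    Measurable (quantileRadius ν τ D) := by
  have key : ∀ v w, quantileRadius ν τ D v ≤ quantileRadius ν τ D w + dist v w := by
    intro v w
    refine csSup_le ⟨0, le_rfl, hD, by simp⟩ fun r hr => ?_
    by_cases h : r ≤ dist v w
    · linarith [quantileRadius_nonneg (ν := ν) (τ := τ) hD w]
    · have : r - dist v w ≤ quantileRadius ν τ D w := by
        refine le_quantileRadius (by linarith) (by linarith [hr.2.1, dist_nonneg (x := v) (y := w)])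
          ((measure_mono (ball_subset_ball' ?_)).trans hr.2.2)
        rw [dist_comm w v]; linarith
      linarith
  exact (LipschitzWith.of_le_add key).continuous.measurable

theorem measurable_measure_quantileRadius [SecondCountableTopology E] [BorelSpace E] {ν : Measure E} [IsFiniteMeasure ν] {τ : ℝ≥0∞} {D ρ : ℝ}
    (hD : 0 ≤ D) :
    Measurable fun p : E × ℝ =>
      ν {w | quantileRadius ν τ D w ≤ p.2 ∧ dist w p.1 ≤ quantileRadius ν τ D w / ρ} := by
  have hRm := measurable_quantileRadius ν τ hD
  refine measurable_measure_prodMk_left (ν := ν)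
    (s := {q : (E × ℝ) × E | quantileRadius ν τ D q.2 ≤ q.1.2 ∧
      dist q.2 q.1.1 ≤ quantileRadius ν τ D q.2 / ρ}) ?_
  rw [ofPred_and]
  apply MeasurableSet.inter <;> apply measurableSet_le <;> fun_prop

end

variable {E : Type*} [NormedAddCommGroup E] [NormedSpace ℝ E] [FiniteDimensional ℝ E]
  [MeasurableSpace E] [BorelSpace E] [Nontrivial E]

/-- The total volume of the balls of mass at most `τ` about the points near `z` is at most a
multiple of `τ` times the volume that these balls fill, since by Stone's lemma they overlap little. -/
theorem exists_lintegral_quantileRadius_le (μ : Measure E) [μ.IsAddHaarMeasure] {A : ℝ}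
    (hA : 0 ≤ A) :
    ∃ C : ℝ≥0∞, C ≠ ∞ ∧ ∀ (ν : Measure E) [IsFiniteMeasure ν] [NullSingletonClass ν] (τ : ℝ≥0∞) (D : ℝ)
      (_ : 0 ≤ D) (z : E) (r : ℝ) (_ : 0 ≤ r),
      ∫⁻ w in {w | quantileRadius ν τ D w ≤ r ∧ dist w z ≤ A * r},
        ENNReal.ofReal (quantileRadius ν τ D w ^ Module.finrank ℝ E) ∂ν ≤
          C * τ * ENNReal.ofReal (r ^ Module.finrank ℝ E) := by
  obtain ⟨N, hN⟩ := exists_measure_ball_dist_le E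
  set d := Module.finrank ℝ E with hd
  refine ⟨N * ENNReal.ofReal ((A + 1) ^ d), by finiteness, fun ν _ _ τ D hD z r hr => ?_⟩
  set R := quantileRadius ν τ D with hR
  have hRm : Measurable R := measurable_quantileRadius ν τ hD
  set V := μ (ball (0 : E) 1) with hV
  have hV0 : V ≠ 0 := (measure_ball_pos μ _ one_pos).ne'
  have hVt : V ≠ ∞ := measure_ball_lt_top.ne
  set S : Set E := {w | R w ≤ r ∧ dist w z ≤ A * r} with hS
  have hSm : MeasurableSet S :=
    (measurableSet_le hRm measurable_const).inter
      (measurableSet_le (measurable_id.dist measurable_const) measurable_const)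
  have hTm : MeasurableSet {p : E × E | dist p.1 p.2 < R p.1} :=
    measurableSet_lt (measurable_fst.dist measurable_snd) (hRm.comp measurable_fst)
  have h1 : (∫⁻ w in S, ENNReal.ofReal (R w ^ d) ∂ν) * V
      = ∫⁻ w in S, ∫⁻ y, {p : E × E | dist p.1 p.2 < R p.1}.indicator 1 (w, y) ∂μ ∂ν := by
    rw [← lintegral_mul_const' _ _ hVt]
    refine lintegral_congr fun w => ?_
    rw [hV, hd, ← Measure.addHaar_ball μ w (quantileRadius_nonneg hD w)]
    rw [← lintegral_indicator_one measurableSet_ball]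
    refine lintegral_congr fun y => ?_
    simp only [Set.indicator, mem_ball, mem_ofPred_eq, dist_comm y w, ← hR]
    rfl
  have h2 : (∫⁻ w in S, ENNReal.ofReal (R w ^ d) ∂ν) * V
      ≤ N * τ * μ (closedBall z ((A + 1) * r)) := by
    rw [h1, lintegral_lintegral_swap (by
      exact (measurable_one.indicator hTm).aemeasurable)]
    calc ∫⁻ y, ∫⁻ w in S, {p : E × E | dist p.1 p.2 < R p.1}.indicator 1 (w, y) ∂ν ∂μ
        ≤ ∫⁻ y, (closedBall z ((A + 1) * r)).indicator (fun _ => N * τ) y ∂μ := by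
          refine lintegral_mono fun y => ?_
          by_cases hy : y ∈ closedBall z ((A + 1) * r)
          · rw [Set.indicator_of_mem hy]
            calc ∫⁻ w in S, {p : E × E | dist p.1 p.2 < R p.1}.indicator 1 (w, y) ∂ν
                ≤ ∫⁻ w, {w | dist w y < R w}.indicator 1 w ∂ν :=
                  (setLIntegral_le_lintegral _ _)
              _ = ν {w | dist w y < R w} := by
                  rw [lintegral_indicator_one]
                  exact measurableSet_lt (measurable_id.dist measurable_const) hRm
              _ ≤ ν ({y} ∪ {v | v ≠ y ∧ dist v y ≤ D ∧ ν (ball v (dist v y)) ≤ τ}) := by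
                  refine measure_mono fun w hw => ?_
                  by_cases hwy : w = y
                  · exact Or.inl hwy
                  · exact Or.inr ⟨hwy, (le_of_lt hw).trans (quantileRadius_le hD w),
                      measure_ball_le_of_lt_quantileRadius hD hw⟩
              _ ≤ N * τ := by
                  refine (measure_union_le _ _).trans ?_
                  rw [measure_singleton, zero_add]
                  exact hN ν y τ D
          · rw [Set.indicator_of_notMem hy, nonpos_iff_eq_zero]
            rw [setLIntegral_eq_zero_iff hSm]
            · refine Filter.Eventually.of_forall fun w hw => ?_
              refine Set.indicator_of_notMem (fun hmem => hy ?_) _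
              have h3 : dist w y < R w := hmem
              have := dist_triangle y w z
              rw [dist_comm y w] at this
              rw [mem_closedBall]
              nlinarith [hw.1, hw.2]
            · exact (measurable_one.indicator hTm).comp measurable_prodMk_right
      _ = N * τ * μ (closedBall z ((A + 1) * r)) := by
          rw [lintegral_indicator_const measurableSet_closedBall]
  rw [Measure.addHaar_closedBall μ z (by positivity), ← hd, mul_pow,
    ENNReal.ofReal_mul (by positivity), ← hV, ← mul_assoc] at h2
  have h3 := (ENNReal.mul_le_mul_iff_left hV0 hVt).1 h2
  refine h3.trans (le_of_eq ?_)
  ring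

theorem ENNReal_two_mul_le_add_sq (a b : ℝ≥0∞) : 2 * a * b ≤ a ^ 2 + b ^ 2 := by
  wlog h : a ≤ b generalizing a b
  · have := this b a (le_of_not_ge h)
    rw [add_comm]
    calc 2 * a * b = 2 * b * a := by ring
      _ ≤ _ := this
  obtain ⟨c, rfl⟩ := exists_add_of_le h
  calc 2 * a * (a + c) ≤ 2 * a * (a + c) + c ^ 2 := le_self_add
    _ = _ := by ring

/-- Ordering a product of measures: in a product of `p + 1` copies of a finite measure one factor
may be taken to have the largest value of `R`. -/
theorem measure_univ_pow_le_lintegral {α : Type*} [MeasurableSpace α] (ν : Measure α)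
    [IsFiniteMeasure ν] {R : α → ℝ} (hR : Measurable R) {p : ℕ} (hp : p ≤ 2) :
    ν univ ^ (p + 1) ≤ 4 * ∫⁻ w, ν {x | R x ≤ R w} ^ p ∂ν := by
  have hmeas : Measurable fun w => ν {x | R x ≤ R w} :=
    measurable_measure_prodMk_left (ν := ν) (s := {p : α × α | R p.2 ≤ R p.1})
      (measurableSet_le (hR.comp measurable_snd) (hR.comp measurable_fst))
  have h2 : ν univ ^ 2 ≤ 2 * ∫⁻ w, ν {x | R x ≤ R w} ∂ν := by
    have e1 : (ν.prod ν) {p : α × α | R p.2 ≤ R p.1} = ∫⁻ w, ν {x | R x ≤ R w} ∂ν :=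
      Measure.prod_apply (measurableSet_le (hR.comp measurable_snd) (hR.comp measurable_fst))
    have e2 : (ν.prod ν) {p : α × α | R p.1 ≤ R p.2} = ∫⁻ w, ν {x | R x ≤ R w} ∂ν :=
      Measure.prod_apply_symm
        (measurableSet_le (hR.comp measurable_fst) (hR.comp measurable_snd))
    calc ν univ ^ 2 = (ν.prod ν) univ := by rw [← univ_prod_univ, Measure.prod_prod, sq]
      _ ≤ (ν.prod ν) ({p : α × α | R p.2 ≤ R p.1} ∪ {p : α × α | R p.1 ≤ R p.2}) :=
          measure_mono fun p _ => (le_total (R p.2) (R p.1))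
      _ ≤ _ := (measure_union_le _ _).trans (by rw [e1, e2, two_mul])
  interval_cases p
  · simp only [zero_add, pow_one, pow_zero, lintegral_one]
    exact le_mul_of_one_le_left (zero_le) (by norm_num)
  · simp only [pow_one]
    exact h2.trans (by gcongr; norm_num)
  · set I := ν univ with hI
    have hIt : I ≠ ∞ := measure_ne_top _ _
    -- Jensen's inequality for the square, from the tangent line at `I / 2`.
    have key : I * I ^ 2 ≤ 2 * ∫⁻ w, ν {x | R x ≤ R w} ^ 2 ∂ν + I ^ 3 / 2 := by
      calc I * I ^ 2 ≤ I * (2 * ∫⁻ w, ν {x | R x ≤ R w} ∂ν) := by gcongr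
        _ = 2 * ∫⁻ w, 2 * (I / 2) * ν {x | R x ≤ R w} ∂ν := by
            rw [lintegral_const_mul _ hmeas, ENNReal.mul_div_cancel (by norm_num) (by norm_num)]
            ring
        _ ≤ 2 * ∫⁻ w, (ν {x | R x ≤ R w} ^ 2 + (I / 2) ^ 2) ∂ν := by
            gcongr with w
            rw [add_comm]
            exact ENNReal_two_mul_le_add_sq _ _
        _ = 2 * ∫⁻ w, ν {x | R x ≤ R w} ^ 2 ∂ν + I ^ 3 / 2 := by
            rw [lintegral_add_right _ measurable_const, lintegral_const, mul_add]
            congr 1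
            rw [← hI, ENNReal.div_eq_inv_mul, ENNReal.div_eq_inv_mul]
            have : (2 : ℝ≥0∞) * 2⁻¹ = 1 := ENNReal.mul_inv_cancel (by norm_num) (by norm_num)
            calc 2 * ((2⁻¹ * I) ^ 2 * I) = (2 * 2⁻¹) * (2⁻¹ * I ^ 3) := by ring
              _ = _ := by rw [this, one_mul]
    have h3 : I * I ^ 2 = I ^ 3 / 2 + I ^ 3 / 2 := by
      rw [ENNReal.add_halves]; ring
    rw [h3] at key
    have h4 : I ^ 3 / 2 ≤ 2 * ∫⁻ w, ν {x | R x ≤ R w} ^ 2 ∂ν :=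
      (ENNReal.add_le_add_iff_right (by finiteness)).1 key
    calc I ^ 3 = 2 * (I ^ 3 / 2) := by
          rw [ENNReal.mul_div_cancel (by norm_num) (by norm_num)]
      _ ≤ 2 * (2 * ∫⁻ w, ν {x | R x ≤ R w} ^ 2 ∂ν) := by gcongr
      _ = _ := by rw [← mul_assoc]; norm_num

/-- Local moments of the mass of the points `w` whose quantile ball, enlarged by the factor
`1 / ρ`, contains a given point. -/
theorem exists_lintegral_measure_pow_le (μ : Measure E) [μ.IsAddHaarMeasure] {ρ : ℝ} (hρ : 0 < ρ)
    (hρ1 : ρ ≤ 1) {p : ℕ} (hp : p ≤ 3) :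
    ∃ C : ℝ≥0∞, C ≠ ∞ ∧ ∀ (ν : Measure E) [IsFiniteMeasure ν] [NullSingletonClass ν] (τ : ℝ≥0∞) (D : ℝ)
      (_ : 0 ≤ D) (z : E) (r : ℝ) (_ : 0 ≤ r),
      ∫⁻ u in closedBall z r,
        ν {w | quantileRadius ν τ D w ≤ r ∧ dist w u ≤ quantileRadius ν τ D w / ρ} ^ p ∂μ ≤
          C * τ ^ p * ENNReal.ofReal (r ^ Module.finrank ℝ E) := by
  set d := Module.finrank ℝ E with hd
  induction p with
  | zero =>
    refine ⟨μ (ball 0 1), measure_ball_lt_top.ne, fun ν _ _ τ D hD z r hr => ?_⟩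
    simp only [pow_zero, lintegral_one, mul_one, Measure.restrict_apply_univ]
    rw [Measure.addHaar_closedBall μ z hr, mul_comm]
  | succ p ih =>
    obtain ⟨C, hC, ih⟩ := ih (by omega)
    obtain ⟨C', hC', hpack⟩ := exists_lintegral_quantileRadius_le μ (A := 1 + 1 / ρ) (by positivity)
    refine ⟨4 * (C * ENNReal.ofReal ((1 / ρ) ^ d)) * C', by finiteness,
      fun ν _ _ τ D hD z r hr => ?_⟩
    set R := quantileRadius ν τ D with hR
    have hRm : Measurable R := measurable_quantileRadius ν τ hD
    have hR0 : ∀ w, 0 ≤ R w := fun w => quantileRadius_nonneg hD w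
    set F : E × ℝ → ℝ≥0∞ := fun q => ν {w | R w ≤ q.2 ∧ dist w q.1 ≤ R w / ρ} with hF
    have hFm : Measurable F := measurable_measure_quantileRadius hD
    set T : Set (E × E) := {q | R q.2 ≤ r ∧ dist q.2 q.1 ≤ R q.2 / ρ} with hT
    have hTm : MeasurableSet T := by
      rw [hT, ofPred_and]
      apply MeasurableSet.inter <;> apply measurableSet_le <;> fun_prop
    have hord : ∀ u, F (u, r) ^ (p + 1)
        ≤ 4 * ∫⁻ w, T.indicator (fun q => F (q.1, R q.2) ^ p) (u, w) ∂ν := by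
      intro u
      have hA : MeasurableSet {w | R w ≤ r ∧ dist w u ≤ R w / ρ} := by
        rw [ofPred_and]
        apply MeasurableSet.inter <;> apply measurableSet_le <;> fun_prop
      have := measure_univ_pow_le_lintegral (ν.restrict {w | R w ≤ r ∧ dist w u ≤ R w / ρ}) hRm
        (p := p) (by omega)
      rw [Measure.restrict_apply_univ] at this
      refine this.trans ?_
      gcongr 4 * ?_
      rw [← lintegral_indicator hA]
      refine lintegral_mono fun w => ?_
      by_cases hw : w ∈ {w | R w ≤ r ∧ dist w u ≤ R w / ρ}
      · rw [Set.indicator_of_mem hw, Set.indicator_of_mem (show (u, w) ∈ T from hw)]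
        refine pow_le_pow_left' ?_ p
        rw [Measure.restrict_apply (measurableSet_le hRm measurable_const)]
        exact measure_mono fun x hx => ⟨hx.1, hx.2.2⟩
      · rw [Set.indicator_of_notMem hw]
        exact zero_le
    have hIm : Measurable fun q : E × E => T.indicator (fun q => F (q.1, R q.2) ^ p) q :=
      Measurable.indicator (by fun_prop) hTm
    calc ∫⁻ u in closedBall z r, F (u, r) ^ (p + 1) ∂μ
        ≤ ∫⁻ u in closedBall z r,
            4 * ∫⁻ w, T.indicator (fun q => F (q.1, R q.2) ^ p) (u, w) ∂ν ∂μ :=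
          lintegral_mono fun u => hord u
      _ = 4 * ∫⁻ w, ∫⁻ u in closedBall z r,
            T.indicator (fun q => F (q.1, R q.2) ^ p) (u, w) ∂μ ∂ν := by
          rw [lintegral_const_mul' _ _ (by norm_num), lintegral_lintegral_swap]
          exact hIm.aemeasurable
      _ ≤ 4 * ∫⁻ w in {w | R w ≤ r ∧ dist w z ≤ (1 + 1 / ρ) * r},
            C * τ ^ p * ENNReal.ofReal ((1 / ρ) ^ d) * ENNReal.ofReal (R w ^ d) ∂ν := by
          have hA : MeasurableSet {w | R w ≤ r ∧ dist w z ≤ (1 + 1 / ρ) * r} := by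
            rw [ofPred_and]
            apply MeasurableSet.inter <;> apply measurableSet_le <;> fun_prop
          gcongr 4 * ?_
          rw [← lintegral_indicator hA]
          refine lintegral_mono fun w => ?_
          by_cases hw : w ∈ {w | R w ≤ r ∧ dist w z ≤ (1 + 1 / ρ) * r}
          · rw [Set.indicator_of_mem hw]
            calc ∫⁻ u in closedBall z r, T.indicator (fun q => F (q.1, R q.2) ^ p) (u, w) ∂μ
                ≤ ∫⁻ u, (closedBall w (R w / ρ)).indicator
                    (fun u => F (u, R w / ρ) ^ p) u ∂μ := by
                  refine (setLIntegral_le_lintegral _ _).trans (lintegral_mono fun u => ?_)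
                  by_cases hu : (u, w) ∈ T
                  · rw [Set.indicator_of_mem hu, Set.indicator_of_mem
                      (show u ∈ closedBall w (R w / ρ) by
                        rw [mem_closedBall, dist_comm]; exact hu.2)]
                    refine pow_le_pow_left' (measure_mono ?_) p
                    intro x hx
                    exact ⟨hx.1.trans (le_div_self (hR0 w) hρ hρ1), hx.2⟩
                  · rw [Set.indicator_of_notMem hu]
                    exact zero_le
              _ = ∫⁻ u in closedBall w (R w / ρ), F (u, R w / ρ) ^ p ∂μ :=
                  lintegral_indicator measurableSet_closedBall _
              _ ≤ C * τ ^ p * ENNReal.ofReal ((R w / ρ) ^ d) :=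
                  ih ν τ D hD w (R w / ρ) (div_nonneg (hR0 w) hρ.le)
              _ = _ := by
                  rw [mul_assoc (C * τ ^ p), ← ENNReal.ofReal_mul (by positivity), ← mul_pow]
                  congr 3; ring
          · rw [Set.indicator_of_notMem hw, nonpos_iff_eq_zero]
            refine (setLIntegral_eq_zero_iff measurableSet_closedBall
                (hIm.comp measurable_prodMk_right)).2 ?_
            refine Filter.Eventually.of_forall fun u hu => ?_
            have hnot : (u, w) ∉ T → T.indicator (fun q => F (q.1, R q.2) ^ p) (u, w) = 0 :=
              fun h => Set.indicator_of_notMem h _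
            refine hnot fun hmem => hw ⟨hmem.1, ?_⟩
            have h1 : dist w u ≤ R w / ρ := hmem.2
            have h2 : R w / ρ ≤ r / ρ := by gcongr; exact hmem.1
            have h3 := dist_triangle w u z
            rw [mem_closedBall] at hu
            have : (1 + 1 / ρ) * r = r + r / ρ := by ring
            linarith
      _ = 4 * (C * τ ^ p * ENNReal.ofReal ((1 / ρ) ^ d) *
            ∫⁻ w in {w | R w ≤ r ∧ dist w z ≤ (1 + 1 / ρ) * r}, ENNReal.ofReal (R w ^ d) ∂ν) := by
          rw [lintegral_const_mul _ (by fun_prop)]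
      _ ≤ 4 * (C * τ ^ p * ENNReal.ofReal ((1 / ρ) ^ d) *
            (C' * τ * ENNReal.ofReal (r ^ d))) := by
          gcongr
          exact hpack ν τ D hD z r hr
      _ = _ := by ring

/-- The mass of the points `v` for which a ball about `v` that reaches almost to `u` has mass at
most `τ` is of order `τ`, in the sense of third moments over `u`. -/
theorem exists_lintegral_measure_cube_le (μ : Measure E) [μ.IsAddHaarMeasure] {ρ : ℝ}
    (hρ : 0 < ρ) (hρ1 : ρ ≤ 1) (ν : Measure E) [IsFiniteMeasure ν] {c : ℝ≥0∞} (hc : c ≠ ∞)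
    (hν : ν ≤ c • μ) [NullSingletonClass ν] {B : Set E} (hB : Bornology.IsBounded B) (hνB : ν Bᶜ = 0) :
    ∃ C : ℝ≥0∞, C ≠ ∞ ∧ ∀ τ : ℝ≥0∞,
      ∫⁻ u, ν {v | ν (ball v (ρ * dist v u)) ≤ τ} ^ 3 ∂ν ≤ C * τ ^ 3 := by
  obtain ⟨C, hC, h⟩ := exists_lintegral_measure_pow_le μ hρ hρ1 (p := 3) le_rfl
  obtain ⟨r, hr⟩ := hB.subset_closedBall (0 : E)
  set r' := max r 0
  have hB' : B ⊆ closedBall 0 r' := hr.trans (closedBall_subset_closedBall (le_max_left _ _))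
  have hr0 : 0 ≤ r' := le_max_right _ _
  set D := 2 * r' with hD
  have hae : ∀ᵐ u ∂ν, u ∈ closedBall (0 : E) r' := by
    rw [ae_iff]
    exact measure_mono_null (fun u hu => fun hu' => hu (hB' hu')) hνB
  refine ⟨c * (C * ENNReal.ofReal (D ^ Module.finrank ℝ E)), by finiteness, fun τ => ?_⟩
  have hFm := (measurable_measure_quantileRadius (ν := ν) (τ := τ) (D := D) (ρ := ρ)
    (by positivity)).comp (measurable_prodMk_right (y := D))
  calc ∫⁻ u, ν {v | ν (ball v (ρ * dist v u)) ≤ τ} ^ 3 ∂ν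
      ≤ ∫⁻ u, (closedBall (0 : E) D).indicator (fun u => ν {w | quantileRadius ν τ D w ≤ D ∧
          dist w u ≤ quantileRadius ν τ D w / ρ} ^ 3) u ∂ν := by
        refine lintegral_mono_ae ?_
        filter_upwards [hae] with u hu
        rw [Set.indicator_of_mem (closedBall_subset_closedBall (by linarith) hu)]
        refine pow_le_pow_left' (measure_mono_ae ?_) 3
        filter_upwards [hae] with v hv hvτ
        have hd : dist v u ≤ D := by
          have := dist_triangle_right v u 0
          rw [mem_closedBall] at hu hv
          linarith
        refine ⟨quantileRadius_le (by positivity) v, ?_⟩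
        rw [le_div_iff₀ hρ, mul_comm]
        refine le_quantileRadius (by positivity) ?_ hvτ
        exact (mul_le_of_le_one_left dist_nonneg hρ1).trans hd
    _ ≤ ∫⁻ u, (closedBall (0 : E) D).indicator (fun u => ν {w | quantileRadius ν τ D w ≤ D ∧
          dist w u ≤ quantileRadius ν τ D w / ρ} ^ 3) u ∂(c • μ) := lintegral_mono' hν le_rfl
    _ = c * ∫⁻ u in closedBall (0 : E) D, ν {w | quantileRadius ν τ D w ≤ D ∧
          dist w u ≤ quantileRadius ν τ D w / ρ} ^ 3 ∂μ := by
        rw [lintegral_smul_measure, lintegral_indicator measurableSet_closedBall, smul_eq_mul]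
    _ ≤ c * (C * τ ^ 3 * ENNReal.ofReal (D ^ Module.finrank ℝ E)) := by
        gcongr
        exact h ν τ D (by positivity) 0 D (by positivity)
    _ = _ := by ring

end Quantile

/-! ### Second moment of the mass of the far points -/

section Differentiation

open Metric Set

variable {E : Type*} [NormedAddCommGroup E] [NormedSpace ℝ E] [FiniteDimensional ℝ E]
  [MeasurableSpace E] [BorelSpace E]

/-- Lebesgue's differentiation theorem for balls whose centres may move with the radius. -/
theorem ae_eventually_withDensity_closedBall (μ : Measure E) [μ.IsAddHaarMeasure] {f : E → ℝ}
    (hf : Measurable f) (h0 : ∀ u, 0 ≤ f u) {c : ℝ} (hc : ∀ u, f u ≤ c) (K : ℝ) :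
    ∀ᵐ u ∂μ, ∀ a b : ℝ, a < f u → f u < b → ∀ᶠ r in 𝓝[>] (0 : ℝ), ∀ v, dist v u ≤ K * r →
      ENNReal.ofReal a * μ (closedBall v r) ≤
          μ.withDensity (fun u => ENNReal.ofReal (f u)) (closedBall v r) ∧
        μ.withDensity (fun u => ENNReal.ofReal (f u)) (closedBall v r) ≤
          ENNReal.ofReal b * μ (closedBall v r) := by
  have hint : ∀ s : Set E, μ s ≠ ∞ → IntegrableOn f s μ := by
    intro s hs
    refine Measure.integrableOn_of_bounded (M := c) hs hf.aestronglyMeasurable ?_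
    filter_upwards with u
    rw [Real.norm_of_nonneg (h0 u)]
    exact hc u
  have hloc : LocallyIntegrable f μ := by
    intro x
    exact ⟨closedBall x 1, closedBall_mem_nhds _ one_pos, hint _ measure_closedBall_lt_top.ne⟩
  filter_upwards [IsUnifLocDoublingMeasure.ae_tendsto_average (μ := μ) hloc K] with u hu a b ha hb
  set l : Filter (E × ℝ) := comap Prod.snd (𝓝[>] (0 : ℝ)) ⊓ 𝓟 {p | dist p.1 u ≤ K * p.2} with hl
  have hsnd : Tendsto Prod.snd l (𝓝[>] (0 : ℝ)) := tendsto_comap.mono_left inf_le_left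
  have hmem : ∀ᶠ p in l, u ∈ closedBall p.1 (K * p.2) := by
    have : ∀ᶠ p in l, p ∈ {p : E × ℝ | dist p.1 u ≤ K * p.2} :=
      (mem_inf_of_right (mem_principal_self _))
    filter_upwards [this] with p hp
    rw [mem_closedBall, dist_comm]; exact hp
  have hlim := hu Prod.fst Prod.snd hsnd hmem
  have hev : ∀ᶠ p in l, ENNReal.ofReal a * μ (closedBall p.1 p.2) ≤
          μ.withDensity (fun u => ENNReal.ofReal (f u)) (closedBall p.1 p.2) ∧
        μ.withDensity (fun u => ENNReal.ofReal (f u)) (closedBall p.1 p.2) ≤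
          ENNReal.ofReal b * μ (closedBall p.1 p.2) := by
    filter_upwards [hlim.eventually (lt_mem_nhds ha), hlim.eventually (gt_mem_nhds hb),
      hsnd.eventually self_mem_nhdsWithin] with p hpa hpb hp0
    have hfin : μ (closedBall p.1 p.2) ≠ ∞ := measure_closedBall_lt_top.ne
    have hpos : 0 < μ.real (closedBall p.1 p.2) :=
      ENNReal.toReal_pos (measure_closedBall_pos μ _ hp0).ne' hfin
    rw [setAverage_eq, smul_eq_mul] at hpa hpb
    rw [lt_inv_mul_iff₀ hpos] at hpa
    rw [inv_mul_lt_iff₀ hpos] at hpb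
    rw [withDensity_apply _ measurableSet_closedBall,
      ← ofReal_integral_eq_lintegral_ofReal (hint _ hfin) (Eventually.of_forall h0),
      ← ENNReal.ofReal_toReal hfin, ← ENNReal.ofReal_mul' ENNReal.toReal_nonneg,
      ← ENNReal.ofReal_mul' ENNReal.toReal_nonneg]
    refine ⟨ENNReal.ofReal_le_ofReal ?_, ENNReal.ofReal_le_ofReal ?_⟩
    · rw [mul_comm]; exact hpa.le
    · rw [mul_comm]; exact hpb.le
  rw [hl, eventually_inf_principal, eventually_comap] at hev
  filter_upwards [hev] with r hr v hv using hr (v, r) rfl hv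

/-- Points at a distance from `u` do not contribute once `τ` is small: a finite cover by small balls
has a smallest positive mass. -/
theorem eventually_measure_far_eq_zero {ν₀ ν₁ : Measure E} (hac : ν₀ ≪ ν₁) {B : Set E}
    (hB : Bornology.IsBounded B) (hνB : ν₁ Bᶜ = 0) {ρ r : ℝ} (hρ : 0 < ρ) (hr : 0 < r) (u : E) :
    ∀ᶠ τ in 𝓝[>] (0 : ℝ),
      ν₀ {v | r ≤ dist v u ∧ ν₁ (ball v (ρ * dist v u)) ≤ ENNReal.ofReal τ} = 0 := by
  obtain ⟨t, ht, hcov⟩ := Metric.totallyBounded_iff.1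
    (hB.isCompact_closure.totallyBounded.subset subset_closure) (ρ * r / 2) (by positivity)
  have hsmall : ∀ᶠ τ in 𝓝[>] (0 : ℝ), ∀ x ∈ t, ν₁ (ball x (ρ * r / 2)) ≠ 0 →
      ENNReal.ofReal τ < ν₁ (ball x (ρ * r / 2)) := by
    rw [eventually_all_finite ht]
    intro x _
    by_cases hx : ν₁ (ball x (ρ * r / 2)) = 0
    · simp [hx]
    · have : Tendsto ENNReal.ofReal (𝓝[>] (0 : ℝ)) (𝓝 0) := by
        have := (ENNReal.continuous_ofReal.tendsto 0).mono_left
          (nhdsWithin_le_nhds (s := Ioi (0 : ℝ)))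
        simpa using this
      filter_upwards [this.eventually (gt_mem_nhds (pos_iff_ne_zero.2 hx))] with τ hτ _ using hτ
  filter_upwards [hsmall] with τ hτ
  have hnull : ν₁ (Bᶜ ∪ ⋃ x ∈ {x ∈ t | ν₁ (ball x (ρ * r / 2)) = 0}, ball x (ρ * r / 2)) = 0 := by
    refine measure_union_null hνB ?_
    rw [measure_biUnion_null_iff (ht.subset (sep_subset _ _)).countable]
    exact fun x hx => hx.2
  refine measure_mono_null ?_ (hac hnull)
  rintro v ⟨hv, hvτ⟩
  by_cases hvB : v ∈ B
  · right
    obtain ⟨x, hx, hvx⟩ := mem_iUnion₂.1 (hcov hvB)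
    refine mem_iUnion₂.2 ⟨x, ⟨hx, ?_⟩, hvx⟩
    by_contra hne
    refine absurd (hτ x hx hne) (not_lt.2 ((measure_mono ?_).trans hvτ))
    intro y hy
    rw [mem_ball] at hvx hy ⊢
    have := dist_triangle_right y v x
    nlinarith
  · exact Or.inl hvB

variable [Nontrivial E]

theorem withDensity_ball_eq_closedBall (μ : Measure E) [μ.IsAddHaarMeasure] (f : E → ℝ≥0∞) (v : E)
    (r : ℝ) : μ.withDensity f (ball v r) = μ.withDensity f (closedBall v r) := by
  refine le_antisymm (measure_mono ball_subset_closedBall) ?_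
  rw [← ball_union_sphere]
  refine (measure_union_le _ _).trans ?_
  rw [withDensity_absolutelyContinuous μ f (Measure.addHaar_sphere μ v r), add_zero]

/-- Pointwise bound for the mass of the points `v` whose ball that reaches almost to `u` has mass at
most `τ`: to first order these `v` fill a ball about `u`. -/
theorem ae_eventually_measure_le (μ : Measure E) [μ.IsAddHaarMeasure] {f₀ f₁ : E → ℝ}
    (hf₀ : Measurable f₀) (hf₁ : Measurable f₁) (h0 : ∀ u, 0 ≤ f₀ u) (h1 : ∀ u, 0 ≤ f₁ u) {c : ℝ}
    (hc₀ : ∀ u, f₀ u ≤ c) (hc₁ : ∀ u, f₁ u ≤ c) {ν₀ ν₁ : Measure E}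
    (hν₀ : ν₀ = μ.withDensity fun u => ENNReal.ofReal (f₀ u))
    (hν₁ : ν₁ = μ.withDensity fun u => ENNReal.ofReal (f₁ u))
    (hac : ν₀ ≪ ν₁) {B : Set E} (hB : Bornology.IsBounded B) (hνB : ν₁ Bᶜ = 0) {ρ : ℝ}
    (hρ : 0 < ρ) :
    ∀ᵐ u ∂ν₁, 0 < f₁ u ∧ ∀ L : ℝ, f₀ u / (f₁ u * ρ ^ Module.finrank ℝ E) < L →
      ∀ᶠ τ in 𝓝[>] (0 : ℝ),
        ν₀ {v | ν₁ (ball v (ρ * dist v u)) ≤ ENNReal.ofReal τ} ≤ ENNReal.ofReal (L * τ) := by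
  set d := Module.finrank ℝ E with hd
  have hd0 : d ≠ 0 := Module.finrank_pos.ne'
  have hpos : ∀ᵐ u ∂ν₁, 0 < f₁ u := by
    rw [hν₁, ae_withDensity_iff (by fun_prop)]
    filter_upwards with u hu
    exact ENNReal.ofReal_pos.1 (pos_iff_ne_zero.2 hu)
  have hν₁μ : ν₁ ≪ μ := hν₁ ▸ withDensity_absolutelyContinuous _ _
  filter_upwards [hpos, hν₁μ.ae_le (ae_eventually_withDensity_closedBall μ hf₁ h1 hc₁ (1 / ρ)),
    hν₁μ.ae_le (ae_eventually_withDensity_closedBall μ hf₀ h0 hc₀ 1)] with u hu hu1 hu0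
  refine ⟨hu, fun L hL => ?_⟩
  have hL0 : 0 < L := (div_nonneg (h0 u) (by positivity)).trans_lt hL
  rw [div_lt_iff₀ (by positivity)] at hL
  -- `b` is slightly above `f₀ u` and `a` slightly below `f₁ u`, with `b / (a ρ ^ d) = L`.
  obtain ⟨b, hb, hb'⟩ := exists_between hL
  have hb0 : 0 < b := (h0 u).trans_lt hb
  set a := b / (L * ρ ^ d) with ha
  have ha0 : 0 < a := by positivity
  have ha1 : a < f₁ u := by
    rw [ha, div_lt_iff₀ (by positivity)]; linarith
  have hb_eq : b = L * (a * ρ ^ d) := by rw [ha]; field_simp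
  obtain ⟨r₁, hr₁, H1⟩ := mem_nhdsGT_iff_exists_Ioo_subset.1
    (hu1 a (f₁ u + 1) ha1 (by linarith))
  obtain ⟨r₂, hr₂, H2⟩ := mem_nhdsGT_iff_exists_Ioo_subset.1
    (hu0 (f₀ u - 1) b (by linarith) hb)
  rw [mem_Ioi] at hr₁ hr₂
  set V := μ.real (ball (0 : E) 1) with hV
  have hVt : μ (ball (0 : E) 1) ≠ ∞ := measure_ball_lt_top.ne
  have hV0 : 0 < V := ENNReal.toReal_pos (measure_ball_pos μ _ one_pos).ne' hVt
  have hVe : μ (ball (0 : E) 1) = ENNReal.ofReal V := (ENNReal.ofReal_toReal hVt).symm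
  set s : ℝ → ℝ := fun τ => (τ / (a * ρ ^ d * V)) ^ (1 / (d : ℝ)) with hs
  have hs_lim : Tendsto s (𝓝[>] 0) (𝓝 0) := by
    have : Tendsto s (𝓝 0) (𝓝 (s 0)) := by
      refine Continuous.tendsto ?_ 0
      refine Continuous.rpow_const (by fun_prop) fun _ => Or.inr (by positivity)
    have h00 : s 0 = 0 := by
      simp only [hs, zero_div]
      exact Real.zero_rpow (by positivity)
    rw [h00] at this
    exact this.mono_left nhdsWithin_le_nhds
  filter_upwards [eventually_measure_far_eq_zero hac hB hνB hρ (div_pos hr₁ hρ) u,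
    self_mem_nhdsWithin, hs_lim.eventually (gt_mem_nhds hr₂)] with τ hfar hτ hsτ
  rw [mem_Ioi] at hτ
  have hspos : 0 < s τ := by positivity
  have hspow : s τ ^ d = τ / (a * ρ ^ d * V) := by
    simp only [hs]
    rw [one_div, Real.rpow_inv_natCast_pow (by positivity) hd0]
  have hsub : {v | ν₁ (ball v (ρ * dist v u)) ≤ ENNReal.ofReal τ} ⊆
      {v | r₁ / ρ ≤ dist v u ∧ ν₁ (ball v (ρ * dist v u)) ≤ ENNReal.ofReal τ} ∪
        closedBall u (s τ) := by
    intro v hv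
    by_cases hfv : r₁ / ρ ≤ dist v u
    · exact Or.inl ⟨hfv, hv⟩
    · right
      rw [mem_closedBall]
      rcases (dist_nonneg (x := v) (y := u)).eq_or_lt with hzero | hvpos
      · rw [← hzero]; exact hspos.le
      · have hlt : ρ * dist v u < r₁ := by
          rw [not_le, lt_div_iff₀ hρ] at hfv; linarith
        have h3 := (H1 ⟨by positivity, hlt⟩ v (by field_simp; exact le_rfl)).1
        have h4 : ν₁ (ball v (ρ * dist v u)) ≤ ENNReal.ofReal τ := hv
        rw [← hν₁, Measure.addHaar_closedBall μ v (by positivity), hVe, ← hd,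
          ← ENNReal.ofReal_mul (by positivity), ← ENNReal.ofReal_mul (by positivity)] at h3
        rw [hν₁, withDensity_ball_eq_closedBall, ← hν₁] at h4
        have h5 := (ENNReal.ofReal_le_ofReal_iff hτ.le).1 (h3.trans h4)
        refine le_of_pow_le_pow_left₀ hd0 hspos.le ?_
        rw [hspow, le_div_iff₀ (by positivity)]
        calc dist v u ^ d * (a * ρ ^ d * V) = a * ((ρ * dist v u) ^ d * V) := by
              rw [mul_pow]; ring
          _ ≤ τ := h5
  calc ν₀ {v | ν₁ (ball v (ρ * dist v u)) ≤ ENNReal.ofReal τ}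
      ≤ 0 + ν₀ (closedBall u (s τ)) := by
        rw [← hfar]
        exact (measure_mono hsub).trans (measure_union_le _ _)
    _ ≤ ENNReal.ofReal b * μ (closedBall u (s τ)) := by
        rw [zero_add, hν₀]
        exact (H2 ⟨hspos, hsτ⟩ u (by simpa using hspos.le)).2
    _ = ENNReal.ofReal (L * τ) := by
        rw [Measure.addHaar_closedBall μ u hspos.le, hVe, ← hd, hspow,
          ← ENNReal.ofReal_mul (by positivity), ← ENNReal.ofReal_mul (by positivity), hb_eq]
        congr 1
        field_simp

end Differentiation

section SecondMoment

open Metric Set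

theorem measurable_measure_ball_dist {E : Type*} [PseudoMetricSpace E] [MeasurableSpace E]
    [BorelSpace E] [SecondCountableTopology E] (ν : Measure E) [IsFiniteMeasure ν] (ρ : ℝ) :
    Measurable fun p : E × E => ν (ball p.2 (ρ * dist p.2 p.1)) :=
  measurable_measure_prodMk_left (ν := ν)
    (s := {q : (E × E) × E | dist q.2 q.1.2 < ρ * dist q.1.2 q.1.1})
    (measurableSet_lt (by fun_prop) (by fun_prop))

theorem measurable_measure_setOf_measure_ball_le {E : Type*} [PseudoMetricSpace E]
    [MeasurableSpace E] [BorelSpace E] [SecondCountableTopology E] (ν₀ ν₁ : Measure E)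
    [IsFiniteMeasure ν₀] [IsFiniteMeasure ν₁] (ρ : ℝ) (τ : ℝ≥0∞) :
    Measurable fun u => ν₀ {v | ν₁ (ball v (ρ * dist v u)) ≤ τ} :=
  measurable_measure_prodMk_left (ν := ν₀)
    (s := {p : E × E | ν₁ (ball p.2 (ρ * dist p.2 p.1)) ≤ τ})
    (measurableSet_le (measurable_measure_ball_dist ν₁ ρ) measurable_const)

variable {E : Type*} [NormedAddCommGroup E] [NormedSpace ℝ E] [FiniteDimensional ℝ E]
  [MeasurableSpace E] [BorelSpace E]

/-- The measure with a real density. -/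
abbrev densityMeasure (μ : Measure E) (f : E → ℝ) : Measure E :=
  μ.withDensity fun u => ENNReal.ofReal (f u)

/-- Bounded densities `f₀` and `f₁`, supported in a bounded set, with `f₀ ≤ c f₁`. -/
structure IsDominatedPair (f₀ f₁ : E → ℝ) (c : ℝ) (B : Set E) : Prop where
  meas₀ : Measurable f₀
  meas₁ : Measurable f₁
  nonneg₀ : ∀ u, 0 ≤ f₀ u
  nonneg₁ : ∀ u, 0 ≤ f₁ u
  le₀ : ∀ u, f₀ u ≤ c
  le₁ : ∀ u, f₁ u ≤ c
  le_mul : ∀ u, f₀ u ≤ c * f₁ u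
  bounded : Bornology.IsBounded B
  eq_zero : ∀ u ∉ B, f₁ u = 0

namespace IsDominatedPair

variable {f₀ f₁ : E → ℝ} {c : ℝ} {B : Set E} (h : IsDominatedPair f₀ f₁ c B) (μ : Measure E)
  [μ.IsAddHaarMeasure]

include h

theorem const_nonneg : 0 ≤ c := (h.nonneg₀ 0).trans (h.le₀ 0)

theorem measure₁_le : densityMeasure μ f₁ ≤ ENNReal.ofReal c • μ := by
  rw [← withDensity_const]
  exact withDensity_mono (ae_of_all _ fun u => ENNReal.ofReal_le_ofReal (h.le₁ u))

theorem measure₀_le : densityMeasure μ f₀ ≤ ENNReal.ofReal c • μ := by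
  rw [← withDensity_const]
  exact withDensity_mono (ae_of_all _ fun u => ENNReal.ofReal_le_ofReal (h.le₀ u))

theorem measure₀_le_measure₁ :
    densityMeasure μ f₀ ≤ ENNReal.ofReal c • densityMeasure μ f₁ := by
  rw [← withDensity_smul _ (by have := h.meas₁; fun_prop)]
  refine withDensity_mono (ae_of_all _ fun u => ?_)
  simp only [Pi.smul_apply, smul_eq_mul]
  rw [← ENNReal.ofReal_mul h.const_nonneg]
  exact ENNReal.ofReal_le_ofReal (h.le_mul u)

theorem measure₁_compl : densityMeasure μ f₁ Bᶜ = 0 := by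
  refine (withDensity_apply_eq_zero' (by have := h.meas₁; fun_prop)).2 ?_
  convert measure_empty (μ := μ)
  ext u
  simp only [mem_inter_iff, mem_ofPred_eq, mem_compl_iff, mem_empty_iff_false, iff_false, not_and,
    not_not]
  intro hu
  by_contra hB
  exact hu (by rw [h.eq_zero u hB, ENNReal.ofReal_zero])

theorem isFiniteMeasure₁ : IsFiniteMeasure (densityMeasure μ f₁) := by
  refine ⟨?_⟩
  rw [← union_compl_self B]
  refine (measure_union_le _ _).trans_lt ?_
  rw [h.measure₁_compl μ, add_zero]
  refine (h.measure₁_le μ B).trans_lt ?_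
  rw [Measure.smul_apply, smul_eq_mul]
  exact ENNReal.mul_lt_top ENNReal.ofReal_lt_top h.bounded.measure_lt_top

theorem isFiniteMeasure₀ : IsFiniteMeasure (densityMeasure μ f₀) := by
  have := h.isFiniteMeasure₁ μ
  refine ⟨(h.measure₀_le_measure₁ μ univ).trans_lt ?_⟩
  rw [Measure.smul_apply, smul_eq_mul]
  exact ENNReal.mul_lt_top ENNReal.ofReal_lt_top (measure_lt_top _ _)

theorem absolutelyContinuous : densityMeasure μ f₀ ≪ densityMeasure μ f₁ :=
  (Measure.absolutelyContinuous_of_le (h.measure₀_le_measure₁ μ)).trans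
    Measure.smul_absolutelyContinuous

variable [Nontrivial E]

theorem nullSingleton₁ : NullSingletonClass (densityMeasure μ f₁) :=
  ⟨fun x => withDensity_absolutelyContinuous μ _ (measure_singleton x)⟩

theorem exists_lintegral_cube_le {ρ : ℝ} (hρ : 0 < ρ) (hρ1 : ρ ≤ 1) :
    ∃ C : ℝ≥0∞, C ≠ ∞ ∧ ∀ τ : ℝ≥0∞, ∫⁻ u,
      densityMeasure μ f₀ {v | densityMeasure μ f₁ (ball v (ρ * dist v u)) ≤ τ} ^ 3
        ∂(densityMeasure μ f₁) ≤ C * τ ^ 3 := by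
  have := h.isFiniteMeasure₁ μ
  have := h.nullSingleton₁ μ
  obtain ⟨C, hC, H⟩ := exists_lintegral_measure_cube_le μ hρ hρ1 (densityMeasure μ f₁)
    ENNReal.ofReal_ne_top (h.measure₁_le μ) h.bounded (h.measure₁_compl μ)
  refine ⟨ENNReal.ofReal c ^ 3 * C, by finiteness, fun τ => ?_⟩
  calc _ ≤ ∫⁻ u, ENNReal.ofReal c ^ 3 *
        densityMeasure μ f₁ {v | densityMeasure μ f₁ (ball v (ρ * dist v u)) ≤ τ} ^ 3
          ∂(densityMeasure μ f₁) := by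
        refine lintegral_mono fun u => ?_
        rw [← mul_pow]
        exact pow_le_pow_left' (h.measure₀_le_measure₁ μ _) 3
    _ = ENNReal.ofReal c ^ 3 * ∫⁻ u,
        densityMeasure μ f₁ {v | densityMeasure μ f₁ (ball v (ρ * dist v u)) ≤ τ} ^ 3
          ∂(densityMeasure μ f₁) := lintegral_const_mul' _ _ (by finiteness)
    _ ≤ ENNReal.ofReal c ^ 3 * (C * τ ^ 3) := by gcongr; exact H τ
    _ = _ := by ring

theorem lintegral_ratio_sq_ne_top {ρ : ℝ} (hρ : 0 < ρ) :
    ∫⁻ u, ENNReal.ofReal (f₀ u / (f₁ u * ρ ^ Module.finrank ℝ E)) ^ 2 ∂(densityMeasure μ f₁)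
      ≠ ∞ := by
  have := h.isFiniteMeasure₁ μ
  set d := Module.finrank ℝ E
  refine ne_top_of_le_ne_top (b := ∫⁻ _, ENNReal.ofReal (c / ρ ^ d) ^ 2 ∂(densityMeasure μ f₁))
    ?_ (lintegral_mono fun u => ?_)
  · rw [lintegral_const]
    finiteness
  · refine pow_le_pow_left' (ENNReal.ofReal_le_ofReal ?_) 2
    rw [← div_div]
    gcongr
    exact div_le_of_le_mul₀ (h.nonneg₁ u) h.const_nonneg (h.le_mul u)

/-- Second moments over `u` of the mass of the points `v` whose ball that reaches almost to `u` has
mass at most `τ`. The third moments make the squares uniformly integrable. -/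
theorem eventually_lintegral_sq_le {ρ : ℝ} (hρ : 0 < ρ) (hρ1 : ρ ≤ 1) {τ : ℕ → ℝ}
    (hτ : ∀ᶠ n in atTop, 0 < τ n) (hτ0 : Tendsto τ atTop (𝓝 0)) {ε : ℝ≥0∞} (hε : ε ≠ 0) :
    ∀ᶠ n in atTop, ∫⁻ u, densityMeasure μ f₀
        {v | densityMeasure μ f₁ (ball v (ρ * dist v u)) ≤ ENNReal.ofReal (τ n)} ^ 2
          ∂(densityMeasure μ f₁) ≤
      ENNReal.ofReal (τ n) ^ 2 *
        (∫⁻ u, ENNReal.ofReal (f₀ u / (f₁ u * ρ ^ Module.finrank ℝ E)) ^ 2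
          ∂(densityMeasure μ f₁) + ε) := by
  have i1 := h.isFiniteMeasure₁ μ
  have i0 := h.isFiniteMeasure₀ μ
  obtain ⟨C, hC, H⟩ := h.exists_lintegral_cube_le μ hρ hρ1
  set ν₁ := densityMeasure μ f₁ with hν₁
  set ν₀ := densityMeasure μ f₀ with hν₀
  set d := Module.finrank ℝ E with hd
  set S := ∫⁻ u, ENNReal.ofReal (f₀ u / (f₁ u * ρ ^ d)) ^ 2 ∂ν₁ with hS
  have hSt : S ≠ ∞ := h.lintegral_ratio_sq_ne_top μ hρ
  set F : ℕ → E → ℝ≥0∞ := fun n u => (ENNReal.ofReal (τ n))⁻¹ *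
    ν₀ {v | ν₁ (ball v (ρ * dist v u)) ≤ ENNReal.ofReal (τ n)} with hF
  have hFm : ∀ n, Measurable (F n) := fun n =>
    (measurable_measure_setOf_measure_ball_le ν₀ ν₁ ρ _).const_mul _
  have hε2 : ε / 2 ≠ 0 := by simpa using hε
  obtain ⟨K, hK⟩ := ENNReal.exists_nat_mul_gt hε2 hC
  have hK0 : (K : ℝ≥0∞) ≠ 0 := by
    rintro h0
    simp [h0] at hK
  have hptw : ∀ᵐ u ∂ν₁, limsup (fun n => min (F n u) K ^ 2) atTop
      ≤ ENNReal.ofReal (f₀ u / (f₁ u * ρ ^ d)) ^ 2 := by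
    filter_upwards [ae_eventually_measure_le μ h.meas₀ h.meas₁ h.nonneg₀ h.nonneg₁ h.le₀ h.le₁
      hν₀ hν₁ (h.absolutelyContinuous μ) h.bounded (h.measure₁_compl μ) hρ] with u hu
    set x := f₀ u / (f₁ u * ρ ^ d)
    have hcont : Tendsto (fun L : ℝ => ENNReal.ofReal L ^ 2) (𝓝[>] x)
        (𝓝 (ENNReal.ofReal x ^ 2)) :=
      (((ENNReal.continuous_pow 2).comp ENNReal.continuous_ofReal).tendsto x).mono_left
        nhdsWithin_le_nhds
    refine ge_of_tendsto hcont ?_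
    filter_upwards [self_mem_nhdsWithin] with L hL
    have hτ' : Tendsto τ atTop (𝓝[>] 0) := tendsto_nhdsWithin_iff.2 ⟨hτ0, hτ⟩
    refine limsup_le_of_le (by isBoundedDefault) ?_
    filter_upwards [hτ'.eventually (hu.2 L hL), hτ] with n hn hn0
    refine pow_le_pow_left' ((min_le_left _ _).trans ?_) 2
    have hx0 : 0 ≤ x := div_nonneg (h.nonneg₀ u) (mul_nonneg (h.nonneg₁ u) (by positivity))
    calc F n u ≤ (ENNReal.ofReal (τ n))⁻¹ * ENNReal.ofReal (L * τ n) := by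
          simp only [hF]; gcongr
      _ = ENNReal.ofReal L := by
          rw [ENNReal.ofReal_mul (hx0.trans (le_of_lt hL)), mul_comm, mul_assoc,
            ENNReal.mul_inv_cancel (by simpa using hn0) ENNReal.ofReal_ne_top, mul_one]
  have hlim : limsup (fun n => ∫⁻ u, min (F n u) K ^ 2 ∂ν₁) atTop < S + ε / 2 := by
    refine (limsup_lintegral_le (fun _ => (K : ℝ≥0∞) ^ 2) (fun n => ?_) (fun n => ?_) ?_).trans_lt
      ((lintegral_mono_ae hptw).trans_lt (ENNReal.lt_add_right hSt hε2))
    · have := hFm n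
      fun_prop
    · exact ae_of_all _ fun u => pow_le_pow_left' (min_le_right _ _) 2
    · rw [lintegral_const]
      finiteness
  filter_upwards [eventually_lt_of_limsup_lt hlim, hτ] with n hn hn0
  have hτn0 : ENNReal.ofReal (τ n) ≠ 0 := by simpa using hn0
  have hF3 : ∫⁻ u, F n u ^ 3 ∂ν₁ ≤ C := by
    simp only [hF, mul_pow]
    rw [lintegral_const_mul' _ _ (by finiteness)]
    calc (ENNReal.ofReal (τ n))⁻¹ ^ 3 * ∫⁻ u, ν₀ {v | ν₁ (ball v (ρ * dist v u)) ≤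
          ENNReal.ofReal (τ n)} ^ 3 ∂ν₁
        ≤ (ENNReal.ofReal (τ n))⁻¹ ^ 3 * (C * ENNReal.ofReal (τ n) ^ 3) := by gcongr; exact H _
      _ = C * ((ENNReal.ofReal (τ n))⁻¹ * ENNReal.ofReal (τ n)) ^ 3 := by ring
      _ = C := by rw [ENNReal.inv_mul_cancel hτn0 ENNReal.ofReal_ne_top, one_pow, mul_one]
  have hsplit : ∀ u, F n u ^ 2 ≤ min (F n u) K ^ 2 + (K : ℝ≥0∞)⁻¹ * F n u ^ 3 := by
    intro u
    rcases le_total (F n u) K with hle | hle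
    · rw [min_eq_left hle]; exact le_self_add
    · refine le_add_left ?_
      calc F n u ^ 2 = (K : ℝ≥0∞)⁻¹ * (K * F n u ^ 2) := by
            rw [← mul_assoc, ENNReal.inv_mul_cancel hK0 (by finiteness), one_mul]
        _ ≤ (K : ℝ≥0∞)⁻¹ * (F n u * F n u ^ 2) := by gcongr
        _ = _ := by ring
  have hF2 : ∫⁻ u, F n u ^ 2 ∂ν₁ ≤ S + ε := by
    calc ∫⁻ u, F n u ^ 2 ∂ν₁ ≤ ∫⁻ u, (min (F n u) K ^ 2 + (K : ℝ≥0∞)⁻¹ * F n u ^ 3) ∂ν₁ :=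
          lintegral_mono hsplit
      _ = ∫⁻ u, min (F n u) K ^ 2 ∂ν₁ + (K : ℝ≥0∞)⁻¹ * ∫⁻ u, F n u ^ 3 ∂ν₁ := by
          rw [lintegral_add_right _ (by have := hFm n; fun_prop), lintegral_const_mul' _ _
            (by finiteness)]
      _ ≤ (S + ε / 2) + (K : ℝ≥0∞)⁻¹ * C := by gcongr
      _ ≤ (S + ε / 2) + ε / 2 := by
          gcongr
          rw [mul_comm, ← div_eq_mul_inv]
          refine ENNReal.div_le_of_le_mul ?_
          rw [mul_comm]; exact hK.le
      _ = S + ε := by rw [add_assoc, ENNReal.add_halves]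
  calc ∫⁻ u, ν₀ {v | ν₁ (ball v (ρ * dist v u)) ≤ ENNReal.ofReal (τ n)} ^ 2 ∂ν₁
      = ∫⁻ u, ENNReal.ofReal (τ n) ^ 2 * F n u ^ 2 ∂ν₁ := by
        refine lintegral_congr fun u => ?_
        rw [← mul_pow, hF]
        simp only
        rw [← mul_assoc, ENNReal.mul_inv_cancel hτn0 ENNReal.ofReal_ne_top, one_mul]
    _ = ENNReal.ofReal (τ n) ^ 2 * ∫⁻ u, F n u ^ 2 ∂ν₁ :=
        lintegral_const_mul' _ _ (by finiteness)
    _ ≤ _ := by gcongr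

theorem exists_lintegral_sq_le {ρ : ℝ} (hρ : 0 < ρ) (hρ1 : ρ ≤ 1) :
    ∃ C : ℝ≥0∞, C ≠ ∞ ∧ ∀ τ : ℝ≥0∞, τ ≠ 0 → τ ≠ ∞ → ∫⁻ u,
      densityMeasure μ f₀ {v | densityMeasure μ f₁ (ball v (ρ * dist v u)) ≤ τ} ^ 2
        ∂(densityMeasure μ f₁) ≤ C * τ ^ 2 := by
  obtain ⟨C, hC, H⟩ := h.exists_lintegral_cube_le μ hρ hρ1
  have i1 := h.isFiniteMeasure₁ μ
  set ν₁ := densityMeasure μ f₁ with hν₁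
  set ν₀ := densityMeasure μ f₀ with hν₀
  refine ⟨ν₁ univ + C, by finiteness, fun τ hτ hτ' => ?_⟩
  have key : ∀ x : ℝ≥0∞, x ^ 2 ≤ τ ^ 2 + τ⁻¹ * x ^ 3 := by
    intro x
    rcases le_total x τ with hx | hx
    · exact (pow_le_pow_left' hx 2).trans le_self_add
    · refine le_add_left ?_
      calc x ^ 2 = τ⁻¹ * (τ * x ^ 2) := by
            rw [← mul_assoc, ENNReal.inv_mul_cancel hτ hτ', one_mul]
        _ ≤ τ⁻¹ * (x * x ^ 2) := by gcongr
        _ = _ := by ring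
  calc _ ≤ ∫⁻ u, (τ ^ 2 + τ⁻¹ * ν₀ {v | ν₁ (ball v (ρ * dist v u)) ≤ τ} ^ 3) ∂ν₁ :=
        lintegral_mono fun u => key _
    _ = τ ^ 2 * ν₁ univ + τ⁻¹ * ∫⁻ u, ν₀ {v | ν₁ (ball v (ρ * dist v u)) ≤ τ} ^ 3 ∂ν₁ := by
        rw [lintegral_add_left measurable_const, lintegral_const, lintegral_const_mul' _ _
          (by finiteness)]
    _ ≤ τ ^ 2 * ν₁ univ + τ⁻¹ * (C * τ ^ 3) := by gcongr; exact H τ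
    _ = τ ^ 2 * ν₁ univ + (τ⁻¹ * τ) * (C * τ ^ 2) := by ring
    _ = _ := by rw [ENNReal.inv_mul_cancel hτ hτ']; ring

end IsDominatedPair

end SecondMoment

/-! ### Chernoff bounds and sample points closer to a query -/

section Tails

open Set

variable {α : Type*} [MeasurableSpace α] (Q : Measure α) [IsProbabilityMeasure Q]

theorem lintegral_pow_card_filter_mem {A : Set α} [DecidablePred (· ∈ A)] (hA : MeasurableSet A)
    (k : ℕ) {z : ℝ} (hz : 0 ≤ z) :
    ∫⁻ s, ENNReal.ofReal z ^ (Finset.univ.filter fun i => s i ∈ A).card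
        ∂(Measure.pi fun _ : Fin k => Q) =
      ENNReal.ofReal (1 + Q.real A * (z - 1)) ^ k := by
  have hm : Measurable fun x => if x ∈ A then ENNReal.ofReal z else 1 :=
    Measurable.ite hA measurable_const measurable_const
  have h1 : ∀ s : Fin k → α, ENNReal.ofReal z ^ (Finset.univ.filter fun i => s i ∈ A).card
      = ∏ i, (if s i ∈ A then ENNReal.ofReal z else 1) := by
    intro s
    rw [Finset.prod_ite, Finset.prod_const, Finset.prod_const_one, mul_one]
  simp_rw [h1]
  rw [lintegral_prod_eq_prod_lintegral_of_indepFun Finset.univ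
    (fun i (s : Fin k → α) => if s i ∈ A then ENNReal.ofReal z else 1)
    (iIndepFun_pi (μ := fun _ => Q) fun _ => hm.aemeasurable)
    (fun i => hm.comp (measurable_pi_apply i))]
  have h2 : ∀ i : Fin k, ∫⁻ s, (if s i ∈ A then ENNReal.ofReal z else 1)
      ∂(Measure.pi fun _ : Fin k => Q) = ENNReal.ofReal (1 + Q.real A * (z - 1)) := by
    intro i
    rw [(measurePreserving_eval (fun _ : Fin k => Q) i).lintegral_comp hm]
    have h3 : ∀ x, (if x ∈ A then ENNReal.ofReal z else 1)
        = A.indicator (fun _ => ENNReal.ofReal z) x + Aᶜ.indicator (fun _ => 1) x := by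
      intro x
      by_cases hx : x ∈ A <;> simp [hx]
    simp_rw [h3]
    rw [lintegral_add_left (measurable_const.indicator hA), lintegral_indicator_const hA,
      lintegral_indicator_const hA.compl, one_mul, ← ofReal_measureReal, ← ofReal_measureReal,
      probReal_compl_eq_one_sub hA, ← ENNReal.ofReal_mul hz, ← ENNReal.ofReal_add]
    · congr 1; ring
    · positivity
    · linarith [measureReal_le_one (μ := Q) (s := A)]
  rw [Finset.prod_congr rfl fun i _ => h2 i]
  simp

/-- Chernoff's bound, for either tail of a binomial count. -/
theorem measure_pi_le_exp_div_pow {A : Set α} [DecidablePred (· ∈ A)] (hA : MeasurableSet A)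
    (k M : ℕ) {z : ℝ} (hz : 0 < z) {S : Set (Fin k → α)}
    (hS : ∀ s ∈ S, z ^ M ≤ z ^ (Finset.univ.filter fun i => s i ∈ A).card) :
    Measure.pi (fun _ : Fin k => Q) S
      ≤ ENNReal.ofReal (Real.exp (k * Q.real A * (z - 1)) / z ^ M) := by
  have hmeas : Measurable fun s : Fin k → α =>
      ENNReal.ofReal z ^ (Finset.univ.filter fun i => s i ∈ A).card := by
    have h1 : ∀ s : Fin k → α, ENNReal.ofReal z ^ (Finset.univ.filter fun i => s i ∈ A).card
        = ∏ i, (if s i ∈ A then ENNReal.ofReal z else 1) := by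
      intro s
      rw [Finset.prod_ite, Finset.prod_const, Finset.prod_const_one, mul_one]
    simp_rw [h1]
    refine Finset.measurable_prod _ fun i _ => ?_
    exact Measurable.ite ((measurable_pi_apply i) hA) measurable_const measurable_const
  have hmark := mul_meas_ge_le_lintegral (μ := Measure.pi (fun _ : Fin k => Q)) hmeas
    (ENNReal.ofReal z ^ M)
  rw [lintegral_pow_card_filter_mem Q hA k hz.le] at hmark
  have hsub : S ⊆ {s | ENNReal.ofReal z ^ M ≤
      ENNReal.ofReal z ^ (Finset.univ.filter fun i => s i ∈ A).card} := by
    intro s hs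
    have := ENNReal.ofReal_le_ofReal (hS s hs)
    rwa [ENNReal.ofReal_pow hz.le, ENNReal.ofReal_pow hz.le] at this
  rw [ENNReal.ofReal_div_of_pos (by positivity), ENNReal.ofReal_pow hz.le]
  rw [ENNReal.le_div_iff_mul_le (Or.inl (by simp [hz]))
    (Or.inl (ENNReal.pow_ne_top ENNReal.ofReal_ne_top)), mul_comm]
  refine (mul_le_mul_right (measure_mono hsub) _).trans (hmark.trans ?_)
  have hle : 1 + Q.real A * (z - 1) ≤ Real.exp (Q.real A * (z - 1)) := by
    rw [add_comm]; exact Real.add_one_le_exp _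
  calc ENNReal.ofReal (1 + Q.real A * (z - 1)) ^ k
      ≤ ENNReal.ofReal (Real.exp (Q.real A * (z - 1))) ^ k :=
        pow_le_pow_left' (ENNReal.ofReal_le_ofReal hle) k
    _ = _ := by
        rw [← ENNReal.ofReal_pow (Real.exp_nonneg _), ← Real.exp_nat_mul, mul_assoc]

/-- The probability of at least `M` hits is exponentially small if at most `(1 - δ) M` are
expected. -/
theorem measure_pi_le_card_le {δ : ℝ} (hδ : 0 < δ) (hδ1 : δ < 1) :
    ∃ a : ℝ, 0 < a ∧ ∀ (A : Set α) [DecidablePred (· ∈ A)] (_ : MeasurableSet A) (k M : ℕ),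
      k * Q.real A ≤ (1 - δ) * M →
      Measure.pi (fun _ : Fin k => Q) {s | M ≤ (Finset.univ.filter fun i => s i ∈ A).card}
        ≤ ENNReal.ofReal (Real.exp (-(a * M))) := by
  have hd : 0 < 1 - δ := by linarith
  refine ⟨-(δ + Real.log (1 - δ)), ?_, fun A _ hA k M hk => ?_⟩
  · have := Real.log_lt_sub_one_of_pos hd (by linarith)
    linarith
  have hz : 1 ≤ (1 - δ)⁻¹ := (one_le_inv₀ hd).2 (by linarith)
  refine (measure_pi_le_exp_div_pow Q hA k M (z := (1 - δ)⁻¹) (by positivity)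
    fun s hs => pow_le_pow_right₀ hz hs).trans (ENNReal.ofReal_le_ofReal ?_)
  rw [inv_pow, div_inv_eq_mul, ← Real.exp_log hd, ← Real.exp_nat_mul, ← Real.exp_add,
    Real.exp_le_exp, Real.exp_log hd]
  have h1 : (1 - δ) * ((1 - δ)⁻¹ - 1) = δ := by field_simp; ring
  have h2 : k * Q.real A * ((1 - δ)⁻¹ - 1) ≤ (1 - δ) * M * ((1 - δ)⁻¹ - 1) := by
    gcongr
  have h3 : (1 - δ) * M * ((1 - δ)⁻¹ - 1) = M * δ := by
    calc _ = M * ((1 - δ) * ((1 - δ)⁻¹ - 1)) := by ring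
      _ = M * δ := by rw [h1]
  linarith

/-- The probability of fewer than `M` hits if more than `(1 + δ) M` are expected, as the square of a
quantity that decays exponentially in the expectation. -/
theorem measure_pi_card_lt_le {δ : ℝ} (hδ : 0 < δ) :
    ∃ b : ℝ, 0 < b ∧ ∀ (A : Set α) [DecidablePred (· ∈ A)] (_ : MeasurableSet A) (k M : ℕ),
      1 ≤ M → (1 + δ) * M < k * Q.real A →
      Measure.pi (fun _ : Fin k => Q) {s | (Finset.univ.filter fun i => s i ∈ A).card < M}
        ≤ ENNReal.ofReal (Real.exp (δ / 2 - b * M) *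
            Real.exp (-(δ / (1 + δ) / 2 * (k * Q.real A / M)))) ^ 2 := by
  have hd : 0 < 1 + δ := by linarith
  refine ⟨(δ - Real.log (1 + δ)) / 2, ?_, fun A _ hA k M hM hk => ?_⟩
  · have := Real.log_lt_sub_one_of_pos hd (by linarith)
    linarith
  have hz : (1 + δ)⁻¹ ≤ 1 := inv_le_one_of_one_le₀ (by linarith)
  refine (measure_pi_le_exp_div_pow Q hA k M (z := (1 + δ)⁻¹) (by positivity)
    fun s hs => pow_le_pow_of_le_one (by positivity) hz (le_of_lt hs)).trans ?_
  rw [← ENNReal.ofReal_pow (by positivity)]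
  refine ENNReal.ofReal_le_ofReal ?_
  rw [inv_pow, div_inv_eq_mul, ← Real.exp_log hd, ← Real.exp_nat_mul, ← Real.exp_add,
    ← Real.exp_add, ← Real.exp_nat_mul, Real.exp_le_exp, Real.exp_log hd]
  have hM1 : (1 : ℝ) ≤ M := by exact_mod_cast hM
  set p := Q.real A
  set t := k * p / M with ht
  have htM : k * p = t * M := by rw [ht]; field_simp
  have ht1 : 1 + δ < t := by rw [ht, lt_div_iff₀ (by linarith)]; exact hk
  set θ := δ / (1 + δ) with hθ
  have hθ0 : 0 < θ := by positivity
  have h1 : (1 + δ)⁻¹ - 1 = -θ := by rw [hθ]; field_simp; ring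
  have h2 : (1 + δ) * θ = δ := by rw [hθ]; field_simp
  rw [htM, h1]
  push_cast
  have h3 : (t - (1 + δ)) * θ * 1 ≤ (t - (1 + δ)) * θ * M := by
    have : 0 < t - (1 + δ) := by linarith
    gcongr
  nlinarith

end Tails

section FewCloser

open Metric Set

theorem tsum_mul_sq_le (q a : ℕ → ℝ≥0∞) :
    (∑' i, q i * a i) ^ 2 ≤ 2 * ((∑' i, q i) * ∑' i, q i * a i ^ 2) := by
  have h1 : (∑' i, q i * a i) ^ 2 = ∑' i, ∑' j, q i * q j * (a i * a j) := by
    rw [sq, ← ENNReal.tsum_mul_right]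
    refine tsum_congr fun i => ?_
    rw [← ENNReal.tsum_mul_left]
    exact tsum_congr fun j => by ring
  have h2 : ∀ x y : ℝ≥0∞, x * y ≤ x ^ 2 + y ^ 2 := by
    intro x y
    rcases le_total x y with h | h
    · calc x * y ≤ y * y := by gcongr
        _ = y ^ 2 := (sq y).symm
        _ ≤ _ := le_add_self
    · calc x * y ≤ x * x := by gcongr
        _ = x ^ 2 := (sq x).symm
        _ ≤ _ := le_self_add
  calc (∑' i, q i * a i) ^ 2 = ∑' i, ∑' j, q i * q j * (a i * a j) := h1
    _ ≤ ∑' i, ∑' j, (q i * a i ^ 2 * q j + q i * (q j * a j ^ 2)) := by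
        refine ENNReal.tsum_le_tsum fun i => ENNReal.tsum_le_tsum fun j => ?_
        calc q i * q j * (a i * a j) ≤ q i * q j * (a i ^ 2 + a j ^ 2) := by
              gcongr; exact h2 _ _
          _ = _ := by ring
    _ = _ := by
        simp_rw [ENNReal.tsum_add, ENNReal.tsum_mul_left, ENNReal.tsum_mul_right]
        rw [two_mul]; congr 1; rw [mul_comm]

theorem exp_neg_mul_le_tsum {θ t : ℝ} (hθ : 0 ≤ θ) (ht : 0 ≤ t) :
    ENNReal.ofReal (Real.exp (-(θ * t))) ≤
      ∑' i : ℕ, ENNReal.ofReal (Real.exp (-θ)) ^ i * {x : ℝ | x ≤ i + 1}.indicator 1 t := by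
  refine le_trans ?_ (ENNReal.le_tsum ⌊t⌋₊)
  rw [Set.indicator_of_mem (show t ∈ {x : ℝ | x ≤ ⌊t⌋₊ + 1} from (Nat.lt_floor_add_one t).le)]
  rw [Pi.one_apply, mul_one, ← ENNReal.ofReal_pow (Real.exp_nonneg _), ← Real.exp_nat_mul]
  refine ENNReal.ofReal_le_ofReal (Real.exp_le_exp.2 ?_)
  have := Nat.floor_le ht
  nlinarith

variable {E : Type*} [NormedAddCommGroup E] [NormedSpace ℝ E] [FiniteDimensional ℝ E]
  [MeasurableSpace E] [BorelSpace E]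
  {α : Type*} [MeasurableSpace α] (Q : Measure α) [IsProbabilityMeasure Q]

open Classical in
/-- The number of sample points in the group `G` whose image under `U` is closer to `v` than the
fraction `ρ` of the distance from `v` to `u`. -/
def closerCount (G : Set α) (U : α → E) (ρ : ℝ) {k : ℕ} (r : Fin k → α) (u v : E) : ℕ :=
  (Finset.univ.filter fun i => r i ∈ G ∩ U ⁻¹' ball v (ρ * dist v u)).card

theorem measurable_closerCount {G : Set α} (hG : MeasurableSet G) {U : α → E} (hU : Measurable U)
    (ρ : ℝ) (k : ℕ) :
    Measurable fun p : (Fin k → α) × E × E => closerCount G U ρ p.1 p.2.1 p.2.2 := by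
  classical
  unfold closerCount
  simp_rw [Finset.card_filter]
  refine Finset.measurable_sum _ fun i _ => Measurable.ite ?_ measurable_const measurable_const
  have h1 : Measurable fun p : (Fin k → α) × E × E => p.1 i := by fun_prop
  have h2 : Measurable fun p : (Fin k → α) × E × E => U (p.1 i) := hU.comp h1
  have h3 : MeasurableSet {p : (Fin k → α) × E × E |
      dist (U (p.1 i)) p.2.2 < ρ * dist p.2.2 p.2.1} := by
    apply measurableSet_lt <;> fun_prop
  exact (h1 hG).inter h3

theorem closerCount_eq (G : Set α) (U : α → E) (ρ : ℝ) {k : ℕ} (r : Fin k → α) (u v : E)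
    [DecidablePred (· ∈ G ∩ U ⁻¹' ball v (ρ * dist v u))] :
    closerCount G U ρ r u v =
      (Finset.univ.filter fun i => r i ∈ G ∩ U ⁻¹' ball v (ρ * dist v u)).card := by
  unfold closerCount
  congr

attribute [irreducible] closerCount

/-- Two points with fewer than `M` closer sample points each: by independence of the two points and
the sample, the square of the mean of a bound for the square root of the tail probability. -/
theorem lintegral_measure_closerCount_lt_sq_le {G : Set α} (hG : MeasurableSet G) {U : α → E}
    (hU : Measurable U) {ν₁ : Measure E} [IsFiniteMeasure ν₁]
    (hν₁ : (Q.restrict G).map U = ν₁) (ν₀ : Measure E) [IsFiniteMeasure ν₀] {δ : ℝ} (hδ : 0 < δ) :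
    ∃ b : ℝ, 0 < b ∧ ∀ (ρ : ℝ) (k M : ℕ) (_ : 1 ≤ M) (_ : 1 ≤ k) (u : E),
      ∫⁻ r, ν₀ {v | closerCount G U ρ r u v < M} ^ 2 ∂(Measure.pi fun _ : Fin k => Q) ≤
        (ν₀ {v | ν₁ (ball v (ρ * dist v u)) ≤ ENNReal.ofReal ((1 + δ) * (M / k))} +
          ENNReal.ofReal (Real.exp (δ / 2 - b * M)) *
            ∑' i : ℕ, ENNReal.ofReal (Real.exp (-(δ / (1 + δ) / 2))) ^ i *
              ν₀ {v | ν₁ (ball v (ρ * dist v u)) ≤ ENNReal.ofReal ((i + 1) * (M / k))}) ^ 2 := by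
  classical
  obtain ⟨b, hb, H⟩ := measure_pi_card_lt_le Q hδ
  refine ⟨b, hb, fun ρ k M hM hk u => ?_⟩
  set π := Measure.pi fun _ : Fin k => Q with hπ
  have hM0 : (0 : ℝ) < M := by exact_mod_cast hM
  have hk0 : (0 : ℝ) < k := by exact_mod_cast hk
  set p : E → ℝ := fun v => ν₁.real (ball v (ρ * dist v u)) with hp
  have hpm : Measurable p :=
    ((measurable_measure_ball_dist ν₁ ρ).comp (measurable_prodMk_left (x := u))).ennreal_toReal
  have hQp : ∀ v, Q.real (G ∩ U ⁻¹' ball v (ρ * dist v u)) = p v := by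
    intro v
    rw [hp, ← hν₁]
    simp only [measureReal_def]
    rw [Measure.map_apply hU measurableSet_ball, Measure.restrict_apply (hU measurableSet_ball),
      inter_comm]
  set θ := δ / (1 + δ) / 2 with hθ
  have hθ0 : 0 ≤ θ := by positivity
  set e := ENNReal.ofReal (Real.exp (δ / 2 - b * M)) with he
  -- The square root of the tail probability is bounded by `β`.
  set β : E → ℝ≥0∞ := fun v => {v | p v ≤ (1 + δ) * (M / k)}.indicator 1 v +
    e * ENNReal.ofReal (Real.exp (-(θ * (k * p v / M)))) with hβ
  have hβm : Measurable β := by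
    refine (measurable_one.indicator (measurableSet_le hpm measurable_const)).add ?_
    fun_prop
  have hcm := (measurable_closerCount hG hU ρ k)
  have hcm' : Measurable fun q : (Fin k → α) × E => closerCount G U ρ q.1 u q.2 :=
    hcm.comp (by fun_prop : Measurable fun q : (Fin k → α) × E => (q.1, u, q.2))
  have htail : ∀ v, π {r | closerCount G U ρ r u v < M} ≤ β v ^ 2 := by
    intro v
    by_cases hv : p v ≤ (1 + δ) * (M / k)
    · refine prob_le_one.trans (one_le_pow₀ ?_)
      rw [hβ]
      simp only
      rw [Set.indicator_of_mem (show v ∈ {v | p v ≤ (1 + δ) * (M / k)} from hv)]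
      exact le_self_add
    · have hlt : (1 + δ) * M < k * Q.real (G ∩ U ⁻¹' ball v (ρ * dist v u)) := by
        rw [hQp]
        rw [not_le, ← mul_div_assoc, div_lt_iff₀ hk0] at hv
        linarith
      simp_rw [closerCount_eq]
      refine (H _ (hG.inter (hU measurableSet_ball)) k M hM hlt).trans (pow_le_pow_left' ?_ 2)
      rw [hQp, ENNReal.ofReal_mul (Real.exp_nonneg _)]
      exact le_add_self
  have hset : MeasurableSet {q : (Fin k → α) × E × E |
      closerCount G U ρ q.1 u q.2.1 < M ∧ closerCount G U ρ q.1 u q.2.2 < M} :=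
    (measurableSet_lt (hcm'.comp (by fun_prop :
      Measurable fun q : (Fin k → α) × E × E => (q.1, q.2.1))) measurable_const).inter
    (measurableSet_lt (hcm'.comp (by fun_prop :
      Measurable fun q : (Fin k → α) × E × E => (q.1, q.2.2))) measurable_const)
  calc ∫⁻ r, ν₀ {v | closerCount G U ρ r u v < M} ^ 2 ∂π
      = ∫⁻ r, (ν₀.prod ν₀) (Prod.mk r ⁻¹' {q : (Fin k → α) × E × E |
          closerCount G U ρ q.1 u q.2.1 < M ∧ closerCount G U ρ q.1 u q.2.2 < M}) ∂π := by
        refine lintegral_congr fun r => ?_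
        rw [sq, ← Measure.prod_prod]
        exact congrArg _ (Set.ext fun q => Iff.rfl)
    _ = ∫⁻ q, π ((fun r => (r, q)) ⁻¹' {q : (Fin k → α) × E × E |
          closerCount G U ρ q.1 u q.2.1 < M ∧ closerCount G U ρ q.1 u q.2.2 < M})
          ∂(ν₀.prod ν₀) := by
        rw [← Measure.prod_apply hset, Measure.prod_apply_symm hset]
    _ ≤ ∫⁻ q : E × E, β q.1 * β q.2 ∂(ν₀.prod ν₀) := by
        refine lintegral_mono fun q => ?_
        rcases le_total (β q.1) (β q.2) with hle | hle
        · calc _ ≤ π {r | closerCount G U ρ r u q.1 < M} := measure_mono fun r hr => hr.1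
            _ ≤ β q.1 ^ 2 := htail _
            _ ≤ β q.1 * β q.2 := by rw [sq]; gcongr
        · calc _ ≤ π {r | closerCount G U ρ r u q.2 < M} := measure_mono fun r hr => hr.2
            _ ≤ β q.2 ^ 2 := htail _
            _ ≤ β q.1 * β q.2 := by rw [sq]; gcongr
    _ = (∫⁻ v, β v ∂ν₀) ^ 2 := by
        rw [lintegral_prod_mul hβm.aemeasurable hβm.aemeasurable, sq]
    _ ≤ _ := by
        refine pow_le_pow_left' ?_ 2
        have hle : ∀ (v : E) (x : ℝ), p v ≤ x → ν₁ (ball v (ρ * dist v u)) ≤ ENNReal.ofReal x := by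
          intro v x hx
          exact (ENNReal.le_ofReal_iff_toReal_le (measure_ne_top _ _)
            (measureReal_nonneg.trans hx)).2 hx
        rw [hβ]
        rw [lintegral_add_left
          (measurable_one.indicator (measurableSet_le hpm measurable_const)),
          lintegral_indicator_one (measurableSet_le hpm measurable_const),
          lintegral_const_mul' _ _ ENNReal.ofReal_ne_top]
        refine add_le_add (measure_mono fun v hv => hle _ _ hv) ?_
        gcongr
        · calc ∫⁻ v, ENNReal.ofReal (Real.exp (-(θ * (k * p v / M)))) ∂ν₀
              ≤ ∫⁻ v, ∑' i : ℕ, ENNReal.ofReal (Real.exp (-θ)) ^ i *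
                  {v | k * p v / M ≤ i + 1}.indicator 1 v ∂ν₀ :=
                lintegral_mono fun v => exp_neg_mul_le_tsum hθ0 (by positivity)
            _ = ∑' i : ℕ, ENNReal.ofReal (Real.exp (-θ)) ^ i *
                  ν₀ {v | k * p v / M ≤ i + 1} := by
                have hmi : ∀ i : ℕ, MeasurableSet {v | k * p v / M ≤ (i : ℝ) + 1} := fun i =>
                  measurableSet_le (by fun_prop) measurable_const
                rw [lintegral_tsum fun i =>
                  ((measurable_one.indicator (hmi i)).const_mul _).aemeasurable]
                refine tsum_congr fun i => ?_
                rw [lintegral_const_mul' _ _ (by finiteness), lintegral_indicator_one (hmi i)]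
            _ ≤ _ := by
                refine ENNReal.tsum_le_tsum fun i => ?_
                gcongr with v
                intro hv
                refine hle _ _ ?_
                rw [div_le_iff₀ hM0] at hv
                rw [← mul_div_assoc, le_div_iff₀ hk0]
                linarith

variable [Nontrivial E]

theorem ENNReal_add_sq_le (a b : ℝ≥0∞) {δ : ℝ} (hδ : 0 < δ) :
    (a + b) ^ 2 ≤ ENNReal.ofReal (1 + δ) * a ^ 2 + ENNReal.ofReal (1 + 1 / δ) * b ^ 2 := by
  have h1 : ENNReal.ofReal (1 + δ) = 1 + ENNReal.ofReal δ := by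
    rw [ENNReal.ofReal_add zero_le_one hδ.le, ENNReal.ofReal_one]
  have h2 : ENNReal.ofReal (1 + 1 / δ) = 1 + ENNReal.ofReal (1 / δ) := by
    rw [ENNReal.ofReal_add zero_le_one (by positivity), ENNReal.ofReal_one]
  have h3 : 2 * a * b ≤ ENNReal.ofReal δ * a ^ 2 + ENNReal.ofReal (1 / δ) * b ^ 2 := by
    set s := ENNReal.ofReal (√δ)
    set t := ENNReal.ofReal (√(1 / δ))
    have hst : s * t = 1 := by
      rw [← ENNReal.ofReal_mul (by positivity), ← Real.sqrt_mul hδ.le, mul_one_div_cancel hδ.ne',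
        Real.sqrt_one, ENNReal.ofReal_one]
    have hs : s ^ 2 = ENNReal.ofReal δ := by
      rw [← ENNReal.ofReal_pow (by positivity), Real.sq_sqrt hδ.le]
    have ht : t ^ 2 = ENNReal.ofReal (1 / δ) := by
      rw [← ENNReal.ofReal_pow (by positivity), Real.sq_sqrt (by positivity)]
    calc 2 * a * b = 2 * a * b * (s * t) := by rw [hst, mul_one]
      _ = 2 * (s * a) * (t * b) := by ring
      _ ≤ (s * a) ^ 2 + (t * b) ^ 2 := ENNReal_two_mul_le_add_sq _ _
      _ = _ := by rw [mul_pow, mul_pow, hs, ht]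
  calc (a + b) ^ 2 = a ^ 2 + b ^ 2 + 2 * a * b := by ring
    _ ≤ a ^ 2 + b ^ 2 + (ENNReal.ofReal δ * a ^ 2 + ENNReal.ofReal (1 / δ) * b ^ 2) := by gcongr
    _ = _ := by rw [h1, h2]; ring

theorem IsDominatedPair.eventually_lintegral_closerCount_sq_le {f₀ f₁ : E → ℝ} {c : ℝ} {B : Set E}
    (h : IsDominatedPair f₀ f₁ c B) (μ : Measure E) [μ.IsAddHaarMeasure]
    {G : Set α} (hG : MeasurableSet G) {U : α → E}
    (hU : Measurable U) (hν₁ : (Q.restrict G).map U = densityMeasure μ f₁)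
    {ρ : ℝ} (hρ : 0 < ρ) (hρ1 : ρ ≤ 1) {δ : ℝ} (hδ : 0 < δ) {M k : ℕ → ℕ}
    (hM : Tendsto M atTop atTop) (hk : Tendsto k atTop atTop)
    (hMk : Tendsto (fun n => (M n : ℝ) / k n) atTop (𝓝 0)) {ε : ℝ≥0∞} (hε : ε ≠ 0) :
    ∀ᶠ n in atTop, ∫⁻ u, ∫⁻ r, densityMeasure μ f₀ {v | closerCount G U ρ r u v < M n} ^ 2
        ∂(Measure.pi fun _ : Fin (k n) => Q) ∂(densityMeasure μ f₁) ≤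
      ENNReal.ofReal (M n / k n) ^ 2 * (ENNReal.ofReal (1 + δ) ^ 3 *
        (∫⁻ u, ENNReal.ofReal (f₀ u / (f₁ u * ρ ^ Module.finrank ℝ E)) ^ 2
          ∂(densityMeasure μ f₁) + ε) + ε) := by
  have i1 := h.isFiniteMeasure₁ μ
  have i0 := h.isFiniteMeasure₀ μ
  obtain ⟨b, hb, H⟩ := lintegral_measure_closerCount_lt_sq_le Q hG hU hν₁ (densityMeasure μ f₀) hδ
  obtain ⟨C, hC, hsq⟩ := h.exists_lintegral_sq_le μ hρ hρ1
  have hM1 : ∀ᶠ n in atTop, 1 ≤ M n := hM.eventually_ge_atTop 1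
  have hk1 : ∀ᶠ n in atTop, 1 ≤ k n := hk.eventually_ge_atTop 1
  have hmain := h.eventually_lintegral_sq_le μ hρ hρ1 (τ := fun n => (1 + δ) * (M n / k n))
    (by
      filter_upwards [hM1, hk1] with n hn hn'
      have : (0 : ℝ) < M n := by exact_mod_cast hn
      have : (0 : ℝ) < k n := by exact_mod_cast hn'
      positivity)
    (by simpa using hMk.const_mul (1 + δ)) hε
  set ν₁ := densityMeasure μ f₁
  set ν₀ := densityMeasure μ f₀
  set q := ENNReal.ofReal (Real.exp (-(δ / (1 + δ) / 2))) with hq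
  have hq1 : q < 1 := by
    rw [hq, ENNReal.ofReal_lt_one, Real.exp_lt_one_iff]
    have : 0 < δ / (1 + δ) / 2 := by positivity
    linarith
  set A := ∑' i : ℕ, q ^ i with hA
  have hAt : A ≠ ∞ := by
    rw [hA, ENNReal.tsum_geometric]
    exact ENNReal.inv_ne_top.2 (tsub_pos_of_lt hq1).ne'
  set A' := ∑' i : ℕ, q ^ i * ENNReal.ofReal ((i : ℝ) + 1) ^ 2 with hA'
  have hA't : A' ≠ ∞ := by
    have hs : Summable fun i : ℕ => (Real.exp (-(δ / (1 + δ) / 2))) ^ i * ((i : ℝ) + 1) ^ 2 := by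
      have hr : ‖Real.exp (-(δ / (1 + δ) / 2))‖ < 1 := by
        rw [Real.norm_of_nonneg (Real.exp_nonneg _), Real.exp_lt_one_iff]
        have : 0 < δ / (1 + δ) / 2 := by positivity
        linarith
      have s2 := summable_pow_mul_geometric_of_norm_lt_one 2 hr
      have s1 := summable_pow_mul_geometric_of_norm_lt_one 1 hr
      have s0 := summable_pow_mul_geometric_of_norm_lt_one 0 hr
      refine ((s2.add (s1.mul_left 2)).add s0).congr fun i => ?_
      ring
    have h4 : A' = ∑' i : ℕ, ENNReal.ofReal
        ((Real.exp (-(δ / (1 + δ) / 2))) ^ i * ((i : ℝ) + 1) ^ 2) := by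
      refine tsum_congr fun i => ?_
      rw [ENNReal.ofReal_mul (by positivity), ENNReal.ofReal_pow (Real.exp_nonneg _),
        ENNReal.ofReal_pow (by positivity)]
    rw [h4]
    exact hs.tsum_ofReal_ne_top
  set K := ENNReal.ofReal (1 + 1 / δ) * (2 * (A * (C * A'))) with hK
  have hKt : K ≠ ∞ := by finiteness
  have hexp : Tendsto (fun n => K * ENNReal.ofReal (Real.exp (δ / 2 - b * M n)) ^ 2) atTop
      (𝓝 0) := by
    have h5 : Tendsto (fun n => δ / 2 - b * (M n : ℝ)) atTop atBot := by
      refine tendsto_atBot_add_const_left _ _ ?_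
      simpa using (tendsto_natCast_atTop_atTop.comp hM).const_mul_atTop hb
    have h6 := ENNReal.tendsto_ofReal (Real.tendsto_exp_atBot.comp h5)
    rw [ENNReal.ofReal_zero] at h6
    have h7 := ENNReal.Tendsto.const_mul (a := K)
      (((ENNReal.continuous_pow 2).tendsto 0).comp h6) (Or.inr hKt)
    simpa using h7
  filter_upwards [hmain, hM1, hk1, hexp.eventually (ge_mem_nhds (pos_iff_ne_zero.2 hε))]
    with n hn hMn hkn hen
  have hMp : (0 : ℝ) < M n := by exact_mod_cast hMn
  have hkp : (0 : ℝ) < k n := by exact_mod_cast hkn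
  set x := ENNReal.ofReal (M n / k n) with hx
  set e := ENNReal.ofReal (Real.exp (δ / 2 - b * M n)) with he
  have hmeas : ∀ τ, Measurable fun u => ν₀ {v | ν₁ (ball v (ρ * dist v u)) ≤ τ} := fun τ =>
    measurable_measure_setOf_measure_ball_le ν₀ ν₁ ρ τ
  calc _ ≤ ∫⁻ u, (ENNReal.ofReal (1 + δ) *
          ν₀ {v | ν₁ (ball v (ρ * dist v u)) ≤ ENNReal.ofReal ((1 + δ) * (M n / k n))} ^ 2 +
        ENNReal.ofReal (1 + 1 / δ) * (e ^ 2 * (2 * (A * ∑' i : ℕ, q ^ i *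
          ν₀ {v | ν₁ (ball v (ρ * dist v u)) ≤ ENNReal.ofReal ((i + 1) * (M n / k n))} ^ 2))))
          ∂ν₁ := by
        refine lintegral_mono fun u => (H ρ (k n) (M n) hMn hkn u).trans ?_
        refine (ENNReal_add_sq_le _ _ hδ).trans ?_
        rw [mul_pow]
        gcongr
        exact tsum_mul_sq_le _ _
    _ = ENNReal.ofReal (1 + δ) * ∫⁻ u,
          ν₀ {v | ν₁ (ball v (ρ * dist v u)) ≤ ENNReal.ofReal ((1 + δ) * (M n / k n))} ^ 2 ∂ν₁ +
        ENNReal.ofReal (1 + 1 / δ) * (e ^ 2 * (2 * (A * ∑' i : ℕ, q ^ i * ∫⁻ u,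
          ν₀ {v | ν₁ (ball v (ρ * dist v u)) ≤ ENNReal.ofReal ((i + 1) * (M n / k n))} ^ 2
            ∂ν₁))) := by
        rw [lintegral_add_left (((hmeas _).pow_const 2).const_mul _),
          lintegral_const_mul' _ _ (by finiteness), lintegral_const_mul' _ _ (by finiteness),
          lintegral_const_mul' _ _ (by finiteness), lintegral_const_mul' _ _ (by finiteness),
          lintegral_const_mul' _ _ hAt,
          lintegral_tsum fun i => (((hmeas _).pow_const 2).const_mul _).aemeasurable]
        congr 6
        ext i
        rw [lintegral_const_mul' _ _ (by finiteness)]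
    _ ≤ ENNReal.ofReal (1 + δ) * (ENNReal.ofReal ((1 + δ) * (M n / k n)) ^ 2 *
          (∫⁻ u, ENNReal.ofReal (f₀ u / (f₁ u * ρ ^ Module.finrank ℝ E)) ^ 2 ∂ν₁ + ε)) +
        ENNReal.ofReal (1 + 1 / δ) * (e ^ 2 * (2 * (A * ∑' i : ℕ, q ^ i *
          (C * ENNReal.ofReal ((i + 1) * (M n / k n)) ^ 2)))) := by
        gcongr with i
        exact hsq _ (by simp; positivity) ENNReal.ofReal_ne_top
    _ = x ^ 2 * (ENNReal.ofReal (1 + δ) ^ 3 *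
          (∫⁻ u, ENNReal.ofReal (f₀ u / (f₁ u * ρ ^ Module.finrank ℝ E)) ^ 2 ∂ν₁ + ε) +
            K * e ^ 2) := by
        have h8 : ∑' i : ℕ, q ^ i * (C * ENNReal.ofReal ((i + 1) * (M n / k n)) ^ 2)
            = C * x ^ 2 * A' := by
          rw [hA', ← ENNReal.tsum_mul_left]
          refine tsum_congr fun i => ?_
          rw [ENNReal.ofReal_mul (by positivity)]
          ring
        rw [h8, ENNReal.ofReal_mul (by positivity), hK]
        ring
    _ ≤ _ := by gcongr
end FewCloser

/-! ### Points close enough to be matched -/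

section NearPoints

open Metric Set

variable {E : Type*} [NormedAddCommGroup E] [NormedSpace ℝ E] [FiniteDimensional ℝ E]
  [MeasurableSpace E] [BorelSpace E]

/-- The radius of a ball of mass `x` about `u` for the constant density `f u`. -/
def massRadius (μ : Measure E) (f : E → ℝ) (x : ℝ) (u : E) : ℝ :=
  (x / (f u * μ.real (ball (0 : E) 1))) ^ (1 / (Module.finrank ℝ E : ℝ))

/-- The pairs `(u, v)` with `v` so close to `u` that a sample point at `u` should be matched to `v`:
the ball about `v` with the mass radius of `u`, enlarged by `1 / ρ`, has mass at most `y`. The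
density at `u` is bounded below by `l`. -/
def nearPairs (μ : Measure E) (f : E → ℝ) (l ρ x y : ℝ) : Set (E × E) :=
  {p | l ≤ f p.1 ∧ dist p.2 p.1 ≤ massRadius μ f x p.1 ∧
    densityMeasure μ f (closedBall p.2 (massRadius μ f x p.1 / ρ)) ≤ ENNReal.ofReal y}

theorem measurable_massRadius (μ : Measure E) {f : E → ℝ} (hf : Measurable f) (x : ℝ) :
    Measurable (massRadius μ f x) := by
  unfold massRadius
  fun_prop

theorem measurableSet_nearPairs (μ : Measure E) {f : E → ℝ} (hf : Measurable f)
    [IsFiniteMeasure (densityMeasure μ f)] (l ρ x y : ℝ) :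
    MeasurableSet (nearPairs μ f l ρ x y) := by
  have hr := measurable_massRadius μ hf x
  have h1 : MeasurableSet {p : E × E | l ≤ f p.1} :=
    measurableSet_le measurable_const (hf.comp measurable_fst)
  have h2 : MeasurableSet {p : E × E | dist p.2 p.1 ≤ massRadius μ f x p.1} :=
    measurableSet_le (measurable_snd.dist measurable_fst) (hr.comp measurable_fst)
  have h3 : Measurable fun p : E × E =>
      densityMeasure μ f (closedBall p.2 (massRadius μ f x p.1 / ρ)) := by
    refine measurable_measure_prodMk_left (ν := densityMeasure μ f)
      (s := {q : (E × E) × E | dist q.2 q.1.2 ≤ massRadius μ f x q.1.1 / ρ}) ?_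
    apply measurableSet_le <;> fun_prop
  exact h1.inter (h2.inter (measurableSet_le h3 measurable_const))

variable [Nontrivial E]

theorem massRadius_pow (μ : Measure E) [μ.IsAddHaarMeasure] {f : E → ℝ} {x : ℝ} {u : E}
    (hx : 0 ≤ x) (hf : 0 ≤ f u) :
    massRadius μ f x u ^ Module.finrank ℝ E = x / (f u * μ.real (ball (0 : E) 1)) := by
  unfold massRadius
  rw [one_div, Real.rpow_inv_natCast_pow (by positivity) Module.finrank_pos.ne']

theorem massRadius_nonneg (μ : Measure E) {f : E → ℝ} {x : ℝ} {u : E}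
    (hx : 0 ≤ x) (hf : 0 ≤ f u) : 0 ≤ massRadius μ f x u := by
  unfold massRadius
  positivity

theorem massRadius_pos (μ : Measure E) [μ.IsAddHaarMeasure] {f : E → ℝ} {x : ℝ} {u : E}
    (hx : 0 < x) (hf : 0 < f u) : 0 < massRadius μ f x u := by
  have hV0 : 0 < μ.real (ball (0 : E) 1) :=
    ENNReal.toReal_pos (measure_ball_pos μ _ one_pos).ne' measure_ball_lt_top.ne
  unfold massRadius
  positivity

namespace IsDominatedPair

variable {f₀ f₁ : E → ℝ} {c : ℝ} {B : Set E} (h : IsDominatedPair f₀ f₁ c B) (μ : Measure E)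
  [μ.IsAddHaarMeasure]

include h

theorem measure_nearPairs_le {l : ℝ} (hl : 0 < l) {ρ x y : ℝ} (hx : 0 ≤ x) (u : E) :
    densityMeasure μ f₀ (Prod.mk u ⁻¹' nearPairs μ f₁ l ρ x y) ≤ ENNReal.ofReal (c / l * x) := by
  have hVt : μ (ball (0 : E) 1) ≠ ∞ := measure_ball_lt_top.ne
  have hV0 : 0 < μ.real (ball (0 : E) 1) :=
    ENNReal.toReal_pos (measure_ball_pos μ _ one_pos).ne' hVt
  by_cases hu : l ≤ f₁ u
  · have hfu : 0 < f₁ u := hl.trans_le hu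
    calc densityMeasure μ f₀ (Prod.mk u ⁻¹' nearPairs μ f₁ l ρ x y)
        ≤ densityMeasure μ f₀ (closedBall u (massRadius μ f₁ x u)) :=
          measure_mono fun v hv => hv.2.1
      _ ≤ ENNReal.ofReal c * μ (closedBall u (massRadius μ f₁ x u)) := h.measure₀_le μ _
      _ = ENNReal.ofReal (c * (x / f₁ u)) := by
          rw [Measure.addHaar_closedBall μ u (massRadius_nonneg μ hx hfu.le),
            massRadius_pow μ hx hfu.le, ← ofReal_measureReal,
            ← ENNReal.ofReal_mul (by positivity), ← ENNReal.ofReal_mul h.const_nonneg]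
          congr 1
          field_simp
      _ ≤ ENNReal.ofReal (c / l * x) := by
          refine ENNReal.ofReal_le_ofReal ?_
          have := h.const_nonneg
          calc c * (x / f₁ u) ≤ c * (x / l) := by gcongr
            _ = _ := by ring
  · rw [show Prod.mk u ⁻¹' nearPairs μ f₁ l ρ x y = ∅ from
      Set.eq_empty_of_forall_notMem fun v hv => hu hv.1, measure_empty]
    exact zero_le

/-- To first order, the near points of `u` have the mass `x` times the ratio of the densities. -/
theorem ae_eventually_le_measure_nearPairs {l δ ρ : ℝ} (hl : 0 < l) (hδ : 0 < δ) (hδ1 : δ < 1)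
    (hρ : 0 < ρ) :
    ∀ᵐ u ∂(densityMeasure μ f₁), l ≤ f₁ u → ∀ y : ℝ, y < f₀ u / f₁ u →
      ∀ᶠ κ in 𝓝[>] (0 : ℝ),
        ENNReal.ofReal (y * ((1 - δ) ^ 2 * ρ ^ Module.finrank ℝ E * κ)) ≤
          densityMeasure μ f₀ (Prod.mk u ⁻¹' nearPairs μ f₁ l ρ
            ((1 - δ) ^ 2 * ρ ^ Module.finrank ℝ E * κ) ((1 - δ) * κ)) := by
  set d := Module.finrank ℝ E with hd
  have hac : densityMeasure μ f₁ ≪ μ := withDensity_absolutelyContinuous _ _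
  have hVt : μ (ball (0 : E) 1) ≠ ∞ := measure_ball_lt_top.ne
  have hV0 : 0 < μ.real (ball (0 : E) 1) :=
    ENNReal.toReal_pos (measure_ball_pos μ _ one_pos).ne' hVt
  have hδ' : 0 < 1 - δ := by linarith
  filter_upwards [hac.ae_le (ae_eventually_withDensity_closedBall μ h.meas₁ h.nonneg₁ h.le₁ ρ),
    hac.ae_le (ae_eventually_withDensity_closedBall μ h.meas₀ h.nonneg₀ h.le₀ 1)] with u hu1 hu0
  intro hlu y hy
  have hfu : 0 < f₁ u := hl.trans_le hlu
  rw [lt_div_iff₀ hfu] at hy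
  have hb : f₁ u < f₁ u / (1 - δ) := by
    rw [lt_div_iff₀ hδ']; nlinarith
  have H1 := hu1 (f₁ u - 1) (f₁ u / (1 - δ)) (by linarith) hb
  have H0 := hu0 (y * f₁ u) (f₀ u + 1) hy (by linarith)
  set r : ℝ → ℝ := fun κ => massRadius μ f₁ ((1 - δ) ^ 2 * ρ ^ d * κ) u with hr
  have hrlim : ∀ s : ℝ, 0 < s → Tendsto (fun κ => r κ * s) (𝓝[>] 0) (𝓝[>] 0) := by
    intro s hs
    refine tendsto_nhdsWithin_iff.2 ⟨?_, ?_⟩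
    · have : Tendsto (fun κ => r κ * s) (𝓝 0) (𝓝 (r 0 * s)) := by
        refine Continuous.tendsto (f := fun κ => r κ * s) ?_ 0
        refine Continuous.mul ?_ continuous_const
        simp only [hr, massRadius]
        exact Continuous.rpow_const (by fun_prop) fun _ => Or.inr (by positivity)
      have h00 : r 0 * s = 0 := by
        simp only [hr, massRadius, mul_zero, zero_div]
        rw [Real.zero_rpow, zero_mul]
        have : 0 < Module.finrank ℝ E := Module.finrank_pos
        positivity
      rw [h00] at this
      exact this.mono_left nhdsWithin_le_nhds
    · filter_upwards [self_mem_nhdsWithin] with κ hκ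
      rw [mem_Ioi] at hκ
      exact mul_pos (massRadius_pos μ (by positivity) hfu) hs
  filter_upwards [(hrlim ρ⁻¹ (by positivity)).eventually H1,
    (hrlim 1 one_pos).eventually H0, self_mem_nhdsWithin] with κ h1 h0 hκ
  rw [mem_Ioi] at hκ
  set x := (1 - δ) ^ 2 * ρ ^ d * κ with hx
  have hx0 : 0 < x := by positivity
  have hr0 : 0 < r κ := massRadius_pos μ hx0 hfu
  have hrpow : r κ ^ d = x / (f₁ u * μ.real (ball (0 : E) 1)) := massRadius_pow μ hx0.le hfu.le
  rw [mul_one] at h0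
  have hsub : closedBall u (r κ) ⊆ Prod.mk u ⁻¹' nearPairs μ f₁ l ρ x ((1 - δ) * κ) := by
    intro v hv
    refine ⟨hlu, hv, ?_⟩
    have h2 := (h1 v (by
      rw [mem_closedBall] at hv
      refine hv.trans (le_of_eq ?_)
      field_simp)).2
    rw [← div_eq_mul_inv, Measure.addHaar_closedBall μ v (by positivity),
      show μ (ball (0 : E) 1) = ENNReal.ofReal (μ.real (ball (0 : E) 1)) from
        (ofReal_measureReal hVt).symm,
      ← ENNReal.ofReal_mul (by positivity), ← ENNReal.ofReal_mul (by positivity), ← hd, div_pow,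
      hrpow] at h2
    refine h2.trans (ENNReal.ofReal_le_ofReal (le_of_eq ?_))
    rw [hx]
    field_simp
  refine le_trans ?_ ((h0 u (by rw [dist_self]; positivity)).1.trans (measure_mono hsub))
  rw [Measure.addHaar_closedBall μ u hr0.le, ← ofReal_measureReal, ← hd, hrpow,
    ← ENNReal.ofReal_mul (by positivity), ← ENNReal.ofReal_mul' (by positivity)]
  refine ENNReal.ofReal_le_ofReal (le_of_eq ?_)
  field_simp

theorem eventually_le_lintegral_nearPairs {l δ ρ : ℝ} (hl : 0 < l) (hδ : 0 < δ) (hδ1 : δ < 1)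
    (hρ : 0 < ρ) {κ : ℕ → ℝ} (hκ : ∀ᶠ n in atTop, 0 < κ n)
    (hκ0 : Tendsto κ atTop (𝓝 0)) {ε : ℝ≥0∞} (hε : ε ≠ 0) :
    ∀ᶠ n in atTop, ENNReal.ofReal (κ n) *
        (ENNReal.ofReal ((1 - δ) ^ 2 * ρ ^ Module.finrank ℝ E) *
          ∫⁻ u in {u | l ≤ f₁ u}, ENNReal.ofReal (f₀ u / f₁ u) ^ 2 ∂(densityMeasure μ f₁)) ≤
      ∫⁻ u, ENNReal.ofReal (f₀ u / f₁ u) * densityMeasure μ f₀ (Prod.mk u ⁻¹' nearPairs μ f₁ l ρ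
          ((1 - δ) ^ 2 * ρ ^ Module.finrank ℝ E * κ n) ((1 - δ) * κ n)) ∂(densityMeasure μ f₁) +
        ENNReal.ofReal (κ n) * ε := by
  have i1 := h.isFiniteMeasure₁ μ
  have i0 := h.isFiniteMeasure₀ μ
  have hm0 := h.meas₀
  have hm1 := h.meas₁
  set d := Module.finrank ℝ E with hd
  set ν₁ := densityMeasure μ f₁ with hν₁
  set ν₀ := densityMeasure μ f₀ with hν₀
  set t : E → ℝ≥0∞ := fun u => ENNReal.ofReal (f₀ u / f₁ u) with ht
  have htm : Measurable t := by fun_prop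
  set s := (1 - δ) ^ 2 * ρ ^ d with hs
  have hs0 : 0 < s := by have : 0 < 1 - δ := by linarith
                         positivity
  set W : ℕ → E → ℝ≥0∞ := fun n u => ν₀ (Prod.mk u ⁻¹' nearPairs μ f₁ l ρ (s * κ n) ((1 - δ) * κ n))
    with hW
  have hWm : ∀ n, Measurable (W n) := fun n =>
    measurable_measure_prodMk_left (measurableSet_nearPairs μ hm1 _ _ _ _)
  set F : ℕ → E → ℝ≥0∞ := fun n u => (ENNReal.ofReal (κ n))⁻¹ * (t u * W n u) with hF
  set S := ENNReal.ofReal s * ∫⁻ u in {u | l ≤ f₁ u}, t u ^ 2 ∂ν₁ with hS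
  have hptw : ∀ᵐ u ∂ν₁, {u | l ≤ f₁ u}.indicator (fun u => ENNReal.ofReal s * t u ^ 2) u
      ≤ liminf (fun n => F n u) atTop := by
    filter_upwards [h.ae_eventually_le_measure_nearPairs μ hl hδ hδ1 hρ] with u hu
    by_cases hlu : l ≤ f₁ u
    · rw [Set.indicator_of_mem (show u ∈ {u | l ≤ f₁ u} from hlu)]
      have hcont : Tendsto (fun y : ℝ => t u * (ENNReal.ofReal y * ENNReal.ofReal s))
          (𝓝[<] (f₀ u / f₁ u)) (𝓝 (t u * (t u * ENNReal.ofReal s))) := by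
        refine ENNReal.Tendsto.const_mul ?_ (Or.inr (by finiteness))
        refine ENNReal.Tendsto.mul_const ?_ (Or.inr (by finiteness))
        exact (ENNReal.continuous_ofReal.tendsto _).mono_left nhdsWithin_le_nhds
      rw [show ENNReal.ofReal s * t u ^ 2 = t u * (t u * ENNReal.ofReal s) by ring]
      refine le_of_tendsto hcont ?_
      filter_upwards [self_mem_nhdsWithin] with y hy
      have hκ' : Tendsto κ atTop (𝓝[>] 0) := tendsto_nhdsWithin_iff.2 ⟨hκ0, hκ⟩
      refine le_liminf_of_le (by isBoundedDefault) ?_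
      filter_upwards [hκ'.eventually (hu hlu y hy), hκ] with n hn hn0
      have hκn : ENNReal.ofReal (κ n) ≠ 0 := by simpa using hn0
      calc t u * (ENNReal.ofReal y * ENNReal.ofReal s)
          = (ENNReal.ofReal (κ n))⁻¹ *
              (t u * (ENNReal.ofReal y * ENNReal.ofReal s * ENNReal.ofReal (κ n))) := by
            rw [show ∀ a b c e : ℝ≥0∞, a * (b * (c * e)) = (a * e) * (b * c) by intros; ring,
              ENNReal.inv_mul_cancel hκn ENNReal.ofReal_ne_top, one_mul]
        _ ≤ F n u := by
            simp only [hF]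
            gcongr
            rw [mul_assoc, ← ENNReal.ofReal_mul hs0.le, ← ENNReal.ofReal_mul' (by positivity)]
            exact hn
    · rw [Set.indicator_of_notMem (show u ∉ {u | l ≤ f₁ u} from hlu)]
      exact zero_le
  have hSle : S ≤ liminf (fun n => ∫⁻ u, F n u ∂ν₁) atTop := by
    calc S = ∫⁻ u, {u | l ≤ f₁ u}.indicator (fun u => ENNReal.ofReal s * t u ^ 2) u ∂ν₁ := by
          rw [lintegral_indicator (measurableSet_le measurable_const hm1),
            lintegral_const_mul' _ _ (by finiteness)]
      _ ≤ ∫⁻ u, liminf (fun n => F n u) atTop ∂ν₁ := lintegral_mono_ae hptw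
      _ ≤ _ := lintegral_liminf_le fun n => by have := hWm n; fun_prop
  have hSt : S ≠ ∞ := by
    refine ENNReal.mul_ne_top ENNReal.ofReal_ne_top ?_
    have := h.lintegral_ratio_sq_ne_top μ one_pos
    simp only [one_pow, mul_one] at this
    exact ne_top_of_le_ne_top this (setLIntegral_le_lintegral _ _)
  have hev : ∀ᶠ n in atTop, S ≤ ∫⁻ u, F n u ∂ν₁ + ε := by
    rcases eq_or_ne S 0 with h0 | h0
    · rw [h0]; exact Eventually.of_forall fun n => zero_le
    · have hlt : S - ε < liminf (fun n => ∫⁻ u, F n u ∂ν₁) atTop :=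
        (ENNReal.sub_lt_self hSt h0 hε).trans_le hSle
      filter_upwards [eventually_lt_of_lt_liminf hlt] with n hn
      exact tsub_le_iff_right.1 hn.le
  filter_upwards [hev, hκ] with n hn hn0
  have hκn : ENNReal.ofReal (κ n) ≠ 0 := by simpa using hn0
  calc ENNReal.ofReal (κ n) * S ≤ ENNReal.ofReal (κ n) * (∫⁻ u, F n u ∂ν₁ + ε) := by gcongr
    _ = _ := by
        rw [mul_add, ← lintegral_const_mul' _ _ ENNReal.ofReal_ne_top]
        congr 1
        refine lintegral_congr fun u => ?_
        simp only [hF]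
        rw [← mul_assoc, ENNReal.mul_inv_cancel hκn ENNReal.ofReal_ne_top, one_mul]

theorem exists_le_setLIntegral_add {ε : ℝ≥0∞} (hε : ε ≠ 0) :
    ∃ l : ℝ, 0 < l ∧ ∫⁻ u, ENNReal.ofReal (f₀ u / f₁ u) ^ 2 ∂(densityMeasure μ f₁) ≤
      ∫⁻ u in {u | l ≤ f₁ u}, ENNReal.ofReal (f₀ u / f₁ u) ^ 2 ∂(densityMeasure μ f₁) + ε := by
  have hm0 := h.meas₀
  have hm1 := h.meas₁
  have hfin := h.lintegral_ratio_sq_ne_top μ one_pos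
  simp only [one_pow, mul_one] at hfin
  set ν₁ := densityMeasure μ f₁ with hν₁
  set g : E → ℝ≥0∞ := fun u => ENNReal.ofReal (f₀ u / f₁ u) ^ 2 with hg
  have hlim : Tendsto (fun n : ℕ => ∫⁻ u, {u | 1 / ((n : ℝ) + 1) ≤ f₁ u}.indicator g u ∂ν₁) atTop
      (𝓝 (∫⁻ u, g u ∂ν₁)) := by
    refine tendsto_lintegral_of_dominated_convergence g
      (fun n => Measurable.indicator (by fun_prop) (measurableSet_le measurable_const hm1))
      (fun n => ae_of_all _ fun u => Set.indicator_le_self _ _ u) hfin (ae_of_all _ fun u => ?_)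
    rcases (h.nonneg₁ u).eq_or_lt with h0 | h0
    · have hg0 : g u = 0 := by simp [hg, ← h0]
      have : (fun n : ℕ => {u | 1 / ((n : ℝ) + 1) ≤ f₁ u}.indicator g u) = fun _ => 0 := by
        ext n
        exact Set.indicator_apply_eq_zero.2 fun _ => hg0
      rw [this, hg0]
      exact tendsto_const_nhds
    · refine tendsto_const_nhds.congr' ?_
      filter_upwards [tendsto_one_div_add_atTop_nhds_zero_nat.eventually (gt_mem_nhds h0)]
        with n hn
      rw [Set.indicator_of_mem (show u ∈ {u | 1 / ((n : ℝ) + 1) ≤ f₁ u} from hn.le)]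
  rcases eq_or_ne (∫⁻ u, g u ∂ν₁) 0 with h0 | h0
  · refine ⟨1, one_pos, ?_⟩
    rw [h0]; exact zero_le
  · obtain ⟨n, hn⟩ := (hlim.eventually (lt_mem_nhds (ENNReal.sub_lt_self hfin h0 hε))).exists
    refine ⟨1 / ((n : ℝ) + 1), by positivity, ?_⟩
    rw [lintegral_indicator (measurableSet_le measurable_const hm1)] at hn
    exact tsub_le_iff_right.1 hn.le

end IsDominatedPair

end NearPoints

/-! ### Stable scales of the estimator -/

section Rate

open Set

variable {d m : ℕ}

/-- Stability of an estimator at the scale `δ`: with any two inserted points, its errors at two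
points whose `φ`-distance is at most `δ` differ by at most `ε δ`. -/
def IsStableAt (Q : Measure (Obs d))
    (φ : Bool → EuclideanSpace ℝ (Fin d) → EuclideanSpace ℝ (Fin m))
    (φhat : Estimator d m) (ω : Bool) (ε δ : ℝ) {n : ℕ} (s : Fin n → Obs d) : Prop :=
  ∀ p₁ ∈ covSupport Q ×ˢ outSupport Q, ∀ p₂ ∈ covSupport Q ×ˢ outSupport Q,
    ∀ a ∈ covSupport Q, ∀ b ∈ covSupport Q, ‖φ ω a - φ ω b‖ ≤ δ →
      ‖(inserted φhat ω s p₁ p₂ a - φ ω a) - (inserted φhat ω s p₁ p₂ b - φ ω b)‖ ≤ ε * δ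

theorem isStableAt_of_insertedError_le {Q : Measure (Obs d)}
    {φ : Bool → EuclideanSpace ℝ (Fin d) → EuclideanSpace ℝ (Fin m)}
    {φhat : Estimator d m} {ω : Bool} {ε δ : ℝ} {n : ℕ} {s : Fin n → Obs d} (hε : 0 < ε)
    (hδ : 0 < δ) (h : insertedError Q φ φhat ω s * ENNReal.ofReal (2 / ε) ≤ ENNReal.ofReal δ) :
    IsStableAt Q φ φhat ω ε δ s := by
  intro p₁ hp₁ p₂ hp₂ a ha b hb _
  have key : ∀ x ∈ covSupport Q, ‖inserted φhat ω s p₁ p₂ x - φ ω x‖ ≤ ε * δ / 2 := by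
    intro x hx
    have h1 : ‖inserted φhat ω s p₁ p₂ x - φ ω x‖ₑ ≤ insertedError Q φ φhat ω s := by
      unfold insertedError
      refine le_iSup₂_of_le p₁ hp₁ (le_iSup₂_of_le p₂ hp₂ ?_)
      exact le_iSup₂_of_le (f := fun x _ => ‖inserted φhat ω s p₁ p₂ x - φ ω x‖ₑ) x hx le_rfl
    have h2 : ‖inserted φhat ω s p₁ p₂ x - φ ω x‖ₑ * ENNReal.ofReal (2 / ε) ≤ ENNReal.ofReal δ :=
      (mul_le_mul_left h1 _).trans h
    rw [← ofReal_norm, ← ENNReal.ofReal_mul (norm_nonneg _),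
      ENNReal.ofReal_le_ofReal_iff hδ.le, ← mul_div_assoc, div_le_iff₀ hε] at h2
    linarith
  calc _ ≤ ‖inserted φhat ω s p₁ p₂ a - φ ω a‖ + ‖inserted φhat ω s p₁ p₂ b - φ ω b‖ :=
        norm_sub_le _ _
    _ ≤ ε * δ / 2 + ε * δ / 2 := add_le_add (key a ha) (key b hb)
    _ = ε * δ := by ring

theorem isStableAt_of_insertedModulus_le {Q : Measure (Obs d)}
    {φ : Bool → EuclideanSpace ℝ (Fin d) → EuclideanSpace ℝ (Fin m)}
    {φhat : Estimator d m} {ω : Bool} {ε δ u : ℝ} {n : ℕ} {s : Fin n → Obs d} (hε : 0 < ε)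
    (hδ : 0 < δ) (hu : u ≤ δ) (h : insertedModulus Q φ φhat ω u s ≤ ENNReal.ofReal ε) :
    IsStableAt Q φ φhat ω ε δ s := by
  intro p₁ hp₁ p₂ hp₂ a ha b hb hab
  have h1 : (ENNReal.ofReal δ)⁻¹ *
      ‖(inserted φhat ω s p₁ p₂ a - φ ω a) - (inserted φhat ω s p₁ p₂ b - φ ω b)‖ₑ
        ≤ ENNReal.ofReal ε := by
    refine le_trans ?_ h
    unfold insertedModulus
    refine le_iSup₂_of_le δ hu (mul_le_mul_right ?_ _)
    refine le_iSup₂_of_le a ha (le_iSup₂_of_le b hb (le_iSup_of_le hab ?_))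
    refine le_iSup₂_of_le p₁ hp₁ ?_
    exact le_iSup₂_of_le (f := fun p₂ _ => ‖(inserted φhat ω s p₁ p₂ a - φ ω a) -
      (inserted φhat ω s p₁ p₂ b - φ ω b)‖ₑ) p₂ hp₂ le_rfl
  have hδ0 : ENNReal.ofReal δ ≠ 0 := by simpa using hδ
  rw [ENNReal.inv_mul_le_iff hδ0 ENNReal.ofReal_ne_top, ← ofReal_norm,
    ← ENNReal.ofReal_mul hδ.le, ENNReal.ofReal_le_ofReal_iff (by positivity)] at h1
  linarith

theorem insertedModulus_antitone (Q : Measure (Obs d))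
    (φ : Bool → EuclideanSpace ℝ (Fin d) → EuclideanSpace ℝ (Fin m))
    (φhat : Estimator d m) (ω : Bool) {n : ℕ} (s : Fin n → Obs d) :
    Antitone fun u => insertedModulus Q φ φhat ω u s := by
  intro u v huv
  simp only [insertedModulus]
  exact iSup_mono fun δ => iSup_le fun hδ => le_iSup_of_le (huv.trans hδ) le_rfl

/-- A random scale `ζ` (in the units of a squared volume) such that the estimator is stable at all
larger scales, and whose mean is of smaller order than the square of the fraction of matched
units. -/
def HasStableScale (Q : Measure (Obs d))
    (φ : Bool → EuclideanSpace ℝ (Fin d) → EuclideanSpace ℝ (Fin m))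
    (φhat : Estimator d m) (M : ℕ → ℕ) (ω : Bool) (ε : ℝ) : Prop :=
  ∃ ζ : ∀ n : ℕ, (Fin n → Obs d) → ℝ≥0∞, (∀ n, Measurable (ζ n)) ∧
    Tendsto (fun n : ℕ => (((n + 2 : ℕ) : ℝ≥0∞) / (M (n + 2) : ℝ≥0∞)) ^ 2 *
      ∫⁻ s, ζ n s ∂(sampleLaw Q n)) atTop (𝓝 0) ∧
    ∀ᶠ n in atTop, ∀ (s : Fin n → Obs d) (δ : ℝ), 0 < δ →
      ζ n s ≤ ENNReal.ofReal δ ^ (2 * m) → IsStableAt Q φ φhat ω ε δ s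

theorem exists_measurable_lintegral_le_outerExp {α : Type*} [MeasurableSpace α] (μ : Measure α)
    (f : α → ℝ≥0∞) {ε : ℝ≥0∞} (hε : ε ≠ 0) :
    ∃ g : α → ℝ≥0∞, Measurable g ∧ (∀ a, f a ≤ g a) ∧ ∫⁻ a, g a ∂μ ≤ outerExp μ f + ε := by
  rcases eq_or_ne (outerExp μ f) ∞ with h | h
  · exact ⟨fun _ => ∞, measurable_const, fun _ => le_top, by rw [h, top_add]; exact le_top⟩
  · have hlt : outerExp μ f < outerExp μ f + ε := ENNReal.lt_add_right h hε
    conv_lhs at hlt => unfold outerExp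
    simp only [iInf_lt_iff] at hlt
    obtain ⟨g, hg, hfg, hlt⟩ := hlt
    exact ⟨g, hg, hfg, hlt.le⟩

theorem MomentRate.hasStableScale {Q : Measure (Obs d)}
    {φ : Bool → EuclideanSpace ℝ (Fin d) → EuclideanSpace ℝ (Fin m)}
    {φhat : Estimator d m} {M : ℕ → ℕ} (h : MomentRate Q φ φhat M) (hm : 1 ≤ m)
    (hM : Tendsto M atTop atTop) (ω : Bool) {ε : ℝ} (hε : 0 < ε) :
    HasStableScale Q φ φhat M ω ε := by
  set X : ℕ → ℝ≥0∞ := fun n => ((n + 2 : ℕ) : ℝ≥0∞) / (M (n + 2) : ℝ≥0∞) with hX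
  have hX0 : ∀ n, X n ≠ 0 := fun n => by
    simp only [hX, ne_eq, ENNReal.div_eq_zero_iff, not_or]
    exact ⟨by positivity, by finiteness⟩
  choose g hgm hgle hgint using fun n : ℕ => exists_measurable_lintegral_le_outerExp
    (sampleLaw Q n) (fun s => X n ^ 2 * insertedError Q φ φhat ω s ^ (2 * m))
    (ε := ((n : ℝ≥0∞) + 1)⁻¹) (by simp)
  set K := ENNReal.ofReal (2 / ε) ^ (2 * m) with hK
  have hKt : K ≠ ∞ := by finiteness
  refine ⟨fun n s => (X n)⁻¹ ^ 2 * (g n s * K), fun n => by have := hgm n; fun_prop, ?_, ?_⟩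
  · have hlim : Tendsto (fun n : ℕ => (outerExp (sampleLaw Q n) (fun s =>
        X n ^ 2 * insertedError Q φ φhat ω s ^ (2 * m)) + ((n : ℝ≥0∞) + 1)⁻¹) * K) atTop
          (𝓝 0) := by
      have h1 : Tendsto (fun n : ℕ => ((n : ℝ≥0∞) + 1)⁻¹) atTop (𝓝 0) := by
        have := ENNReal.tendsto_inv_nat_nhds_zero.comp (tendsto_add_atTop_nat 1)
        refine this.congr fun n => ?_
        simp
      have h2 := ENNReal.Tendsto.mul_const ((h ω).add h1) (b := K) (Or.inr hKt)
      rwa [add_zero, zero_mul] at h2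
    refine tendsto_of_tendsto_of_tendsto_of_le_of_le tendsto_const_nhds hlim
      (fun n => zero_le) fun n => ?_
    have h3 : X n ^ 2 * (X n)⁻¹ ^ 2 ≤ 1 := by
      rw [← mul_pow]
      exact pow_le_one₀ zero_le (ENNReal.mul_inv_le_one _)
    calc X n ^ 2 * ∫⁻ s, (X n)⁻¹ ^ 2 * (g n s * K) ∂(sampleLaw Q n)
        = (X n ^ 2 * (X n)⁻¹ ^ 2) * ((∫⁻ s, g n s ∂(sampleLaw Q n)) * K) := by
          rw [lintegral_const_mul' _ _ (by have := hX0 n; finiteness), lintegral_mul_const' _ _ hKt,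
            mul_assoc]
      _ ≤ 1 * ((outerExp (sampleLaw Q n) (fun s =>
        X n ^ 2 * insertedError Q φ φhat ω s ^ (2 * m)) + ((n : ℝ≥0∞) + 1)⁻¹) * K) := by
          gcongr
          exact hgint n
      _ = _ := one_mul _
  · have hMpos : ∀ᶠ n in atTop, 1 ≤ M (n + 2) :=
      (hM.comp (tendsto_add_atTop_nat 2)).eventually_ge_atTop 1
    filter_upwards [hMpos] with n hn s δ hδ hle
    have hXt : X n ≠ ∞ := by
      refine ENNReal.div_ne_top (by finiteness) ?_
      have : M (n + 2) ≠ 0 := by omega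
      exact_mod_cast this
    refine isStableAt_of_insertedError_le hε hδ ?_
    have h1 : (insertedError Q φ φhat ω s * ENNReal.ofReal (2 / ε)) ^ (2 * m)
        ≤ ENNReal.ofReal δ ^ (2 * m) := by
      refine le_trans ?_ hle
      calc _ = (X n)⁻¹ ^ 2 * (X n ^ 2 * insertedError Q φ φhat ω s ^ (2 * m) * K) := by
            rw [mul_pow, ← mul_assoc, ← mul_assoc, ← mul_pow _ _ 2,
              ENNReal.inv_mul_cancel (hX0 n) hXt, one_pow, one_mul]
        _ ≤ _ := by gcongr; exact hgle n s
    exact (ENNReal.pow_le_pow_left_iff (by omega)).1 h1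

/-- The modulus condition bounds the `2m`-th moment of the smallest stable scale, along a geometric
sequence of scales. -/
theorem ModulusRate.hasStableScale {Q : Measure (Obs d)} [IsProbabilityMeasure Q]
    {φ : Bool → EuclideanSpace ℝ (Fin d) → EuclideanSpace ℝ (Fin m)}
    {φhat : Estimator d m} {M : ℕ → ℕ} (h : ModulusRate Q φ φhat M) (hm : 1 ≤ m)
    (hM : Tendsto M atTop atTop)
    (hMn : Tendsto (fun n : ℕ => (M n : ℝ) / n) atTop (𝓝 0)) (ω : Bool) {ε : ℝ} (hε : 0 < ε) :
    HasStableScale Q φ φhat M ω ε := by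
  obtain ⟨⟨T, hT, hTlim⟩, -⟩ := h ω ε hε
  have hTlim := hTlim 2 (by simp)
  set X : ℕ → ℝ≥0∞ := fun n => ((n + 2 : ℕ) : ℝ≥0∞) / (M (n + 2) : ℝ≥0∞) with hX
  set κ : ℕ → ℝ := fun n => (M (n + 2) : ℝ) / ((n + 2 : ℕ) : ℝ) with hκ
  have hκ0 : Tendsto κ atTop (𝓝 0) := hMn.comp (tendsto_add_atTop_nat 2)
  set v : ℕ → ℕ → ℝ := fun n k => 2 ^ k * (κ n ^ 2) with hv
  set w : ℕ → ℕ → ℝ := fun n k => v n (k + 1) with hw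
  set E : ∀ n : ℕ, ℕ → Set (Fin n → Obs d) := fun n k =>
    {s | ENNReal.ofReal ε < insertedModulus Q φ φhat ω (w n k ^ (1 / (m : ℝ))) s} with hE
  -- The scales `w n k` double from `2 κ²` on, which is of smaller order than `κ`. The event `E n k`
  -- holds if the estimator is not stable at some distance whose `m`-th power is at least `w n k`, and
  -- `ζ` dominates the square of every scale at which this happens.
  set ζ : ∀ n : ℕ, (Fin n → Obs d) → ℝ≥0∞ := fun n s => ENNReal.ofReal (w n 0) ^ 2 +
    ∑' k : ℕ, ENNReal.ofReal (2 * w n k) ^ 2 *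
      (toMeasurable (sampleLaw Q n) (E n k)).indicator 1 s with hζ
  have hMpos : ∀ᶠ n in atTop, 1 ≤ M (n + 2) :=
    (hM.comp (tendsto_add_atTop_nat 2)).eventually_ge_atTop 1
  have hκpos : ∀ᶠ n in atTop, 0 < κ n := by
    filter_upwards [hMpos] with n hn
    have : (0 : ℝ) < M (n + 2) := by exact_mod_cast hn
    positivity
  have hmR : (m : ℝ) ≠ 0 := by positivity
  refine ⟨ζ, fun n => ?_, ?_, ?_⟩
  · have hk : ∀ k, Measurable fun s => ENNReal.ofReal (2 * w n k) ^ 2 *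
        (toMeasurable (sampleLaw Q n) (E n k)).indicator (1 : (Fin n → Obs d) → ℝ≥0∞) s := fun k =>
      (measurable_one.indicator (measurableSet_toMeasurable _ _)).const_mul _
    exact measurable_const.add (Measurable.tsum hk)
  · set I : ℕ → ℝ≥0∞ := fun n => ∫⁻ u in Ioi (0 : ℝ),
      ENNReal.ofReal (u ^ (2 - 1)) * T n (u ^ (1 / (m : ℝ))) with hI
    have hbound : ∀ᶠ n in atTop, X n ^ 2 * ∫⁻ s, ζ n s ∂(sampleLaw Q n) ≤
        X n ^ 2 * ENNReal.ofReal (w n 0) ^ 2 * sampleLaw Q n univ + 16 * (X n ^ 2 * I n) := by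
      filter_upwards [hκpos] with n hn
      have hvpos : ∀ k, 0 < v n k := fun k => by simp only [hv]; positivity
      have hvsucc : ∀ k, v n (k + 1) = 2 * v n k := fun k => by simp only [hv]; ring
      have hterm : ∀ k, ENNReal.ofReal (2 * w n k) ^ 2 * sampleLaw Q n (E n k) ≤
          16 * ∫⁻ u in Ioc (v n k) (v n (k + 1)),
            ENNReal.ofReal (u ^ (2 - 1)) * T n (u ^ (1 / (m : ℝ))) := by
        intro k
        calc ENNReal.ofReal (2 * w n k) ^ 2 * sampleLaw Q n (E n k)
            = 16 * ∫⁻ _u in Ioc (v n k) (v n (k + 1)),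
                ENNReal.ofReal (v n k) * sampleLaw Q n (E n k) := by
              rw [setLIntegral_const, Real.volume_Ioc, hvsucc]
              have : 2 * v n k - v n k = v n k := by ring
              rw [this, hw]
              simp only
              rw [hvsucc, ← mul_assoc, ENNReal.ofReal_mul (by norm_num)]
              have h4 : ENNReal.ofReal (2 * 2) = 4 := by norm_num
              rw [h4]
              ring
          _ ≤ _ := by
              gcongr 16 * ?_
              refine setLIntegral_mono' measurableSet_Ioc fun u hu => ?_
              have hu0 : 0 < u := (hvpos k).trans hu.1
              refine mul_le_mul' (ENNReal.ofReal_le_ofReal ?_) ?_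
              · simpa using hu.1.le
              · refine (measure_mono ?_).trans (hT n (u ^ (1 / (m : ℝ))) (by positivity))
                intro s hs
                refine lt_of_lt_of_le hs (insertedModulus_antitone Q φ φhat ω s ?_)
                exact Real.rpow_le_rpow hu0.le hu.2 (by positivity)
      have hsum : ∑' k : ℕ, ENNReal.ofReal (2 * w n k) ^ 2 * sampleLaw Q n (E n k)
          ≤ 16 * I n := by
        have hmono : Monotone (v n) := monotone_nat_of_le_succ fun k => by
          rw [hvsucc]; linarith [hvpos k]
        calc _ ≤ ∑' k : ℕ, 16 * ∫⁻ u in Ioc (v n k) (v n (k + 1)),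
              ENNReal.ofReal (u ^ (2 - 1)) * T n (u ^ (1 / (m : ℝ))) :=
              ENNReal.tsum_le_tsum hterm
          _ = 16 * ∫⁻ u in ⋃ k : ℕ, Ioc (v n k) (v n (k + 1)),
              ENNReal.ofReal (u ^ (2 - 1)) * T n (u ^ (1 / (m : ℝ))) := by
              rw [ENNReal.tsum_mul_left, lintegral_iUnion (fun _ => measurableSet_Ioc)
                (by simpa using hmono.pairwise_disjoint_on_Ioc_succ)]
          _ ≤ 16 * I n := by
              gcongr 16 * ?_
              refine lintegral_mono_set ?_
              refine iUnion_subset fun k u hu => ?_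
              exact (hvpos k).trans hu.1
      have hint : ∫⁻ s, ζ n s ∂(sampleLaw Q n) = ENNReal.ofReal (w n 0) ^ 2 * sampleLaw Q n univ +
          ∑' k : ℕ, ENNReal.ofReal (2 * w n k) ^ 2 * sampleLaw Q n (E n k) := by
        simp only [hζ]
        rw [lintegral_add_left measurable_const, lintegral_const, lintegral_tsum fun k =>
          ((measurable_one.indicator (measurableSet_toMeasurable _ _)).const_mul _).aemeasurable]
        congr 1
        refine tsum_congr fun k => ?_
        rw [lintegral_const_mul' _ _ (by finiteness),
          lintegral_indicator_one (measurableSet_toMeasurable _ _), measure_toMeasurable]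
      rw [hint]
      calc _ ≤ X n ^ 2 * (ENNReal.ofReal (w n 0) ^ 2 * sampleLaw Q n univ + 16 * I n) := by
            gcongr
        _ = _ := by ring
    have hXw : ∀ᶠ n in atTop, X n * ENNReal.ofReal (w n 0) = ENNReal.ofReal (2 * κ n) := by
      filter_upwards [hκpos, hMpos] with n hn hMn
      have hXκ : X n = (ENNReal.ofReal (κ n))⁻¹ := by
        simp only [hX, hκ]
        rw [ENNReal.ofReal_div_of_pos (by positivity), ENNReal.inv_div (by simp) (by simp; omega),
          ENNReal.ofReal_natCast, ENNReal.ofReal_natCast]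
      have hw0 : w n 0 = κ n * (2 * κ n) := by simp only [hw, hv]; ring
      rw [hXκ, hw0, ENNReal.ofReal_mul hn.le, ← mul_assoc,
        ENNReal.inv_mul_cancel (by simpa using hn) ENNReal.ofReal_ne_top, one_mul]
    have hlim : Tendsto (fun n => ENNReal.ofReal (2 * κ n) ^ 2 + 16 * (X n ^ 2 * I n)) atTop
        (𝓝 0) := by
      have h1 : Tendsto (fun n => ENNReal.ofReal (2 * κ n) ^ 2) atTop (𝓝 0) := by
        have h2 := ENNReal.tendsto_ofReal (hκ0.const_mul 2)
        have h3 := ((ENNReal.continuous_pow 2).tendsto _).comp h2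
        rw [mul_zero, ENNReal.ofReal_zero, zero_pow two_ne_zero] at h3
        exact h3
      have h4 := ENNReal.Tendsto.const_mul (a := 16) hTlim (Or.inr (by norm_num))
      have h5 := h1.add h4
      rwa [mul_zero, add_zero] at h5
    refine tendsto_of_tendsto_of_tendsto_of_le_of_le' tendsto_const_nhds hlim
      (Eventually.of_forall fun n => zero_le) ?_
    filter_upwards [hbound, hXw] with n hn hn'
    refine hn.trans (le_of_eq ?_)
    have : sampleLaw Q n univ = 1 := by
      unfold sampleLaw
      exact measure_univ
    rw [this, mul_one, ← mul_pow, hn']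
  · filter_upwards [hκpos] with n hn s δ hδ hle
    have hvpos : ∀ k, 0 < v n k := fun k => by simp only [hv]; positivity
    have hwpos : ∀ k, 0 < w n k := fun k => hvpos _
    have hδm : ENNReal.ofReal δ ^ (2 * m) = ENNReal.ofReal (δ ^ m) ^ 2 := by
      rw [ENNReal.ofReal_pow hδ.le, ← pow_mul, mul_comm]
    rw [hδm] at hle
    have h0 : w n 0 ≤ δ ^ m := by
      have : ENNReal.ofReal (w n 0) ^ 2 ≤ ENNReal.ofReal (δ ^ m) ^ 2 :=
        le_trans (by simp only [hζ]; exact le_self_add) hle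
      rw [ENNReal.pow_le_pow_left_iff (by norm_num), ENNReal.ofReal_le_ofReal_iff (by positivity)]
        at this
      exact this
    obtain ⟨k, hk1, hk2⟩ := exists_nat_pow_near (x := δ ^ m / w n 0) (y := (2 : ℝ))
      ((one_le_div (hwpos 0)).2 h0) one_lt_two
    have hwk : w n k = 2 ^ k * w n 0 := by simp only [hw, hv]; ring
    rw [le_div_iff₀ (hwpos 0), ← hwk] at hk1
    rw [div_lt_iff₀ (hwpos 0), pow_succ, mul_comm (2 ^ k), mul_assoc, ← hwk] at hk2
    refine isStableAt_of_insertedModulus_le (u := w n k ^ (1 / (m : ℝ))) hε hδ ?_ ?_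
    · calc w n k ^ (1 / (m : ℝ)) ≤ (δ ^ m) ^ (1 / (m : ℝ)) :=
            Real.rpow_le_rpow (hwpos k).le hk1 (by positivity)
        _ = δ := by rw [one_div, Real.pow_rpow_inv_natCast hδ.le (by omega)]
    · by_contra hcon
      rw [not_le] at hcon
      have hmem : s ∈ toMeasurable (sampleLaw Q n) (E n k) := subset_toMeasurable _ _ hcon
      have h2 : ENNReal.ofReal (2 * w n k) ^ 2 ≤ ENNReal.ofReal (δ ^ m) ^ 2 := by
        refine le_trans ?_ hle
        simp only [hζ]
        refine le_add_left (le_trans ?_ (ENNReal.le_tsum k))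
        rw [Set.indicator_of_mem hmem, Pi.one_apply, mul_one]
      rw [ENNReal.pow_le_pow_left_iff (by norm_num), ENNReal.ofReal_le_ofReal_iff (by positivity)]
        at h2
      linarith

end Rate

/-! ### Matched sets of a stable estimator -/

section Matches

open Metric Set

variable {d m : ℕ}

theorem sampleOf_eq_cons {n : ℕ} (s : Fin (n + 2) → Obs d) (e : Equiv.Perm (Fin (n + 2))) :
    sampleOf s = s (e 0) ::ₘ s (e 1) ::ₘ sampleOf fun i : Fin n => s (e i.succ.succ) := by
  have h1 : sampleOf s = sampleOf (s ∘ e) := by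
    unfold sampleOf
    rw [← Multiset.map_map, Multiset.map_univ_val_equiv]
  rw [h1]
  unfold sampleOf
  simp [Fin.univ_val_map, List.ofFn_succ]

/-- Displacements of two points that differ by at most `ε δ` lengthen their distance by at most
`ε δ`. -/
theorem dist_le_of_stable {F : Type*} [NormedAddCommGroup F] {x x' y y' : F} {ε δ : ℝ}
    (h : ‖(y - x) - (y' - x')‖ ≤ ε * δ) : dist y y' ≤ dist x x' + ε * δ := by
  rw [dist_eq_norm, dist_eq_norm]
  calc ‖y - y'‖ = ‖(x - x') + ((y - x) - (y' - x'))‖ := by congr 1; abel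
    _ ≤ ‖x - x'‖ + ‖(y - x) - (y' - x')‖ := norm_add_le _ _
    _ ≤ _ := by gcongr

theorem dist_ge_of_stable {F : Type*} [NormedAddCommGroup F] {x x' y y' : F} {ε δ : ℝ}
    (h : ‖(y - x) - (y' - x')‖ ≤ ε * δ) : dist x x' - ε * δ ≤ dist y y' := by
  have h' : ‖(x - y) - (x' - y')‖ ≤ ε * δ := by
    rw [← norm_neg]
    refine le_trans (le_of_eq ?_) h
    congr 1; abel
  linarith [dist_le_of_stable h']

/-- A sample whose values lie in the supports. -/
def InSupport (Q : Measure (Obs d)) {n : ℕ} (s : Fin n → Obs d) : Prop :=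
  ∀ k, (s k).X ∈ covSupport Q ∧ (s k).Y ∈ outSupport Q

variable {Q : Measure (Obs d)} {φ : Bool → EuclideanSpace ℝ (Fin d) → EuclideanSpace ℝ (Fin m)}
  {φhat : Estimator d m} {ω : Bool} {ε ρ : ℝ}

/-- The estimator of a full sample, as the estimator with two inserted units. -/
theorem IsStableAt.norm_sub_le {n : ℕ} {s : Fin (n + 2) → Obs d} (hs : InSupport Q s)
    {e : Equiv.Perm (Fin (n + 2))} (h0 : (s (e 0)).D = !ω) (h1 : (s (e 1)).D = !ω) {δ : ℝ}
    (h : IsStableAt Q φ φhat ω ε δ fun i : Fin n => s (e i.succ.succ)) (a b : Fin (n + 2))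
    (hab : dist (φ ω (s a).X) (φ ω (s b).X) ≤ δ) :
    ‖(φhat ω (sampleOf s) (s a).X - φ ω (s a).X) -
      (φhat ω (sampleOf s) (s b).X - φ ω (s b).X)‖ ≤ ε * δ := by
  have heq : φhat ω (sampleOf s) = inserted φhat ω (fun i : Fin n => s (e i.succ.succ))
      ((s (e 0)).X, (s (e 0)).Y) ((s (e 1)).X, (s (e 1)).Y) := by
    have hobs : ∀ o : Obs d, o.D = (!ω) → (o.X, (!ω), o.Y) = o := fun o ho => by
      rw [← ho]; rfl
    unfold inserted
    rw [sampleOf_eq_cons s e, hobs _ h0, hobs _ h1]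
  rw [heq]
  exact h _ (hs _) _ (hs _) _ (hs a).1 _ (hs b).1 (by rwa [← dist_eq_norm])

/-- If a unit is matched to `j`, then fewer than `M` units of its group are much closer to `j`. -/
theorem closerCount_lt_of_mem {k M : ℕ} (hε : 0 < ε) (hρ : 0 < ρ)
    (hρε : (1 + ε) * ρ ≤ 1 - ε) {s : Fin (k + 3) → Obs d} (hs : InSupport Q s)
    {e : Equiv.Perm (Fin (k + 3))} (h0 : (s (e 0)).D = !ω) (h1 : (s (e 1)).D = !ω)
    {i j : Fin (k + 3)} (hj : (s j).D = !ω) {A : Finset (Fin (k + 3))}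
    (hA : IsMatchSet M s (fun ω => φhat ω (sampleOf s)) j A) (hi : i ∈ A)
    (hst : ∀ δ, ρ * dist (φ ω (s j).X) (φ ω (s i).X) ≤ δ → 0 < δ →
      IsStableAt Q φ φhat ω ε δ fun t : Fin (k + 1) => s (e t.succ.succ)) :
    closerCount {o : Obs d | o.D = ω} (fun o => φ ω o.X) ρ
      (fun t : Fin k => s (e t.succ.succ.succ)) (φ ω (s i).X) (φ ω (s j).X) < M := by
  classical
  rw [closerCount_eq]
  set D := dist (φ ω (s j).X) (φ ω (s i).X) with hD
  have hinj : Function.Injective fun t : Fin k => e t.succ.succ.succ := fun a b h => by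
    simpa using h
  rw [← Finset.card_image_of_injective _ hinj]
  have hsub : (Finset.univ.filter fun t : Fin k => s (e t.succ.succ.succ) ∈
      {o : Obs d | o.D = ω} ∩ (fun o => φ ω o.X) ⁻¹' ball (φ ω (s j).X) (ρ * D)).image
        (fun t : Fin k => e t.succ.succ.succ) ⊆ A.erase i := by
    intro a ha
    obtain ⟨t, ht, rfl⟩ := Finset.mem_image.1 ha
    obtain ⟨-, htD, htb⟩ := Finset.mem_filter.1 ht
    set a := e t.succ.succ.succ
    have htD : (s a).D = ω := htD
    have htb : dist (φ ω (s a).X) (φ ω (s j).X) < ρ * D := htb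
    have hρD : 0 < ρ * D := dist_nonneg.trans_lt htb
    have hD0 : 0 < D := pos_of_mul_pos_right hρD hρ.le
    have hρ1 : ρ ≤ 1 := by nlinarith
    have e1 := dist_le_of_stable ((hst _ le_rfl hρD).norm_sub_le hs h0 h1 a j htb.le)
    have e2 := dist_ge_of_stable ((hst D (by nlinarith) hD0).norm_sub_le hs h0 h1 i j
      (by rw [dist_comm]))
    rw [dist_comm (φ ω (s i).X), ← hD] at e2
    have hlt : dist (φhat ω (sampleOf s) (s a).X) (φhat ω (sampleOf s) (s j).X) <
        dist (φhat ω (sampleOf s) (s i).X) (φhat ω (sampleOf s) (s j).X) := by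
      have : (1 + ε) * ρ * D ≤ (1 - ε) * D := by gcongr
      linarith
    refine Finset.mem_erase.2 ⟨fun hai => ?_, ?_⟩
    · rw [hai] at hlt
      exact lt_irrefl _ hlt
    · by_contra haA
      have := hA.2.2 i hi a haA (by rw [hj, htD, Bool.not_not])
      simp only [hj, Bool.not_not] at this
      exact absurd this (not_le.2 hlt)
  calc _ ≤ (A.erase i).card := Finset.card_le_card hsub
    _ < A.card := Finset.card_erase_lt_of_mem hi
    _ ≤ M := by rw [hA.2.1]; exact min_le_left _ _

/-- If a unit near `j` is not matched to `j`, then `M` other units of its group are near `j`. -/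
theorem le_card_of_notMem {k M : ℕ} (hε : 0 < ε) (hρ : 0 < ρ)
    (hρε : (1 + ε) * ρ ≤ 1 - ε) {s : Fin (k + 3) → Obs d} (hs : InSupport Q s)
    {e : Equiv.Perm (Fin (k + 3))} (h0 : (s (e 0)).D = !ω) (h1 : (s (e 1)).D = !ω)
    (h2 : (s (e 2)).D = ω) {j : Fin (k + 3)} (hj : (s j).D = !ω) {A : Finset (Fin (k + 3))}
    (hA : IsMatchSet M s (fun ω => φhat ω (sampleOf s)) j A) (hi : e 2 ∉ A) {r : ℝ} (hr : 0 < r)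
    (hdist : dist (φ ω (s j).X) (φ ω (s (e 2)).X) ≤ r)
    (hst : ∀ δ, r ≤ δ → IsStableAt Q φ φhat ω ε δ fun t : Fin (k + 1) => s (e t.succ.succ))
    [DecidablePred (· ∈ {o : Obs d | o.D = ω} ∩
      (fun o => φ ω o.X) ⁻¹' closedBall (φ ω (s j).X) (r / ρ))] :
    M ≤ (Finset.univ.filter fun t : Fin k => s (e t.succ.succ.succ) ∈ {o : Obs d | o.D = ω} ∩
      (fun o => φ ω o.X) ⁻¹' closedBall (φ ω (s j).X) (r / ρ)).card := by
  have hcard : A.card = M := by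
    rw [hA.2.1]
    refine min_eq_left (le_of_not_gt fun hlt => hi ?_)
    have hsub : A ⊆ Finset.univ.filter fun t => (s t).D = !(s j).D := fun a ha =>
      Finset.mem_filter.2 ⟨Finset.mem_univ _, hA.1 a ha⟩
    have heq : A = Finset.univ.filter fun t => (s t).D = !(s j).D := by
      refine Finset.eq_of_subset_of_card_le hsub ?_
      rw [hA.2.1, min_eq_right hlt.le]
    rw [heq]
    exact Finset.mem_filter.2 ⟨Finset.mem_univ _, by rw [hj, h2, Bool.not_not]⟩
  have hinj : Function.Injective fun t : Fin k => e t.succ.succ.succ := fun a b h => by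
    simpa using h
  rw [← hcard, ← Finset.card_image_of_injective _ hinj]
  refine Finset.card_le_card fun a ha => ?_
  have haD : (s a).D = ω := by
    have := hA.1 a ha
    rwa [hj, Bool.not_not] at this
  have hne : ω ≠ !ω := by cases ω <;> decide
  obtain ⟨t, ht⟩ := e.surjective a
  have ht0 : t ≠ 0 := by
    rintro rfl; rw [ht, haD] at h0; exact hne h0
  obtain ⟨t, rfl⟩ := Fin.exists_succ_eq.2 ht0
  have ht1 : t ≠ 0 := by
    rintro rfl
    rw [Fin.succ_zero_eq_one] at ht
    rw [ht, haD] at h1; exact hne h1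
  obtain ⟨t, rfl⟩ := Fin.exists_succ_eq.2 ht1
  have ht2 : t ≠ 0 := by
    rintro rfl
    have : (Fin.succ (Fin.succ 0) : Fin (k + 3)) = 2 := rfl
    rw [this] at ht
    exact hi (ht ▸ ha)
  obtain ⟨t, rfl⟩ := Fin.exists_succ_eq.2 ht2
  refine Finset.mem_image.2 ⟨t, Finset.mem_filter.2 ⟨Finset.mem_univ _, ?_⟩, ht⟩
  rw [ht]
  refine ⟨haD, ?_⟩
  change dist (φ ω (s a).X) (φ ω (s j).X) ≤ r / ρ
  by_contra hcon
  rw [not_le] at hcon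
  have hρ1 : ρ ≤ 1 := by nlinarith
  have hrr : r ≤ r / ρ := le_div_self hr.le hρ hρ1
  set D := dist (φ ω (s a).X) (φ ω (s j).X) with hD
  have e1 := dist_le_of_stable ((hst r le_rfl).norm_sub_le hs h0 h1 (e 2) j
    (by rw [dist_comm]; exact hdist))
  have e2 := dist_ge_of_stable ((hst D (hrr.trans hcon.le)).norm_sub_le hs h0 h1 a j le_rfl)
  have e3 := hA.2.2 a ha (e 2) hi (by rw [hj, h2, Bool.not_not])
  simp only [hj, Bool.not_not] at e3
  rw [dist_comm (φ ω (s (e 2)).X)] at e1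
  rw [div_lt_iff₀ hρ] at hcon
  have hε1 : ε < 1 := by nlinarith
  have e4 : (1 + ε) * ρ * D ≤ (1 - ε) * D := by gcongr
  have : (1 + ε) * r < (1 + ε) * (D * ρ) := by gcongr
  nlinarith

end Matches

/-! ### Laws of the two groups and relabelling of the units -/

section Laws

open Metric Set

variable {d m : ℕ}

theorem measurable_obs_X : Measurable (Obs.X : Obs d → _) := measurable_fst

theorem measurable_obs_D : Measurable (Obs.D : Obs d → _) := measurable_fst.comp measurable_snd

theorem measurable_obs_Y : Measurable (Obs.Y : Obs d → _) := measurable_snd.comp measurable_snd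

theorem measurableSet_obs_D_eq (ω : Bool) : MeasurableSet {o : Obs d | o.D = ω} :=
  measurable_obs_D (measurableSet_singleton ω)

/-- The probability of the group `ω` given the value of the covariate map. -/
def groupProb (Q : Measure (Obs d)) [IsFiniteMeasure Q]
    (g : EuclideanSpace ℝ (Fin d) → EuclideanSpace ℝ (Fin m)) (ω : Bool)
    (u : EuclideanSpace ℝ (Fin m)) : ℝ :=
  (condDistrib (Obs.D (d := d)) (fun o : Obs d => g o.X) Q u).real {ω}

theorem groupProb_not (Q : Measure (Obs d)) [IsFiniteMeasure Q]
    (g : EuclideanSpace ℝ (Fin d) → EuclideanSpace ℝ (Fin m)) (ω : Bool)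
    (u : EuclideanSpace ℝ (Fin m)) : groupProb Q g (!ω) u = 1 - groupProb Q g ω u := by
  unfold groupProb
  rw [← probReal_compl_eq_one_sub (measurableSet_singleton ω)]
  congr 1
  ext b
  cases b <;> cases ω <;> simp

theorem map_restrict_group (Q : Measure (Obs d)) [IsProbabilityMeasure Q]
    {g : EuclideanSpace ℝ (Fin d) → EuclideanSpace ℝ (Fin m)} (hg : Measurable g) (ω : Bool) :
    (Q.restrict {o | o.D = ω}).map (fun o => g o.X) =
      (Q.map fun o => g o.X).withDensity fun u => ENNReal.ofReal (groupProb Q g ω u) := by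
  have hU : Measurable fun o : Obs d => g o.X := hg.comp measurable_obs_X
  ext A hA
  rw [Measure.map_apply hU hA, Measure.restrict_apply (hU hA), withDensity_apply _ hA]
  have h0 : (Q.map fun o => g o.X) ⊗ₘ condDistrib (Obs.D (d := d)) (fun o : Obs d => g o.X) Q =
      Q.map fun o => (g o.X, o.D) :=
    compProd_map_condDistrib (measurable_obs_D (d := d)).aemeasurable
  have h1 := congrArg (fun ν : Measure (EuclideanSpace ℝ (Fin m) × Bool) => ν (A ×ˢ {ω})) h0
  simp only at h1
  rw [Measure.compProd_apply_prod hA (measurableSet_singleton ω),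
    Measure.map_apply (hU.prodMk measurable_obs_D) (hA.prod (measurableSet_singleton ω))] at h1
  have h2 : (fun o : Obs d => (g o.X, o.D)) ⁻¹' (A ×ˢ {ω}) =
      (fun o : Obs d => g o.X) ⁻¹' A ∩ {o | o.D = ω} := by
    ext o; simp
  rw [h2] at h1
  rw [← h1]
  refine lintegral_congr fun u => ?_
  unfold groupProb
  rw [ofReal_measureReal]

/-- In either group the transformed covariates have a bounded density with bounded support, and the
odds are the ratio of the densities of the groups. -/
theorem exists_isDominatedPair {Q : Measure (Obs d)} [IsProbabilityMeasure Q] (hover : Overlap Q)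
    {φ : Bool → EuclideanSpace ℝ (Fin d) → EuclideanSpace ℝ (Fin m)} (hφ : ∀ ω, Measurable (φ ω))
    {Xφ : Set (EuclideanSpace ℝ (Fin m))} (hreg : Regular Q φ Xφ) (ω : Bool) :
    ∃ (f₀ f₁ : EuclideanSpace ℝ (Fin m) → ℝ) (c : ℝ) (B : Set (EuclideanSpace ℝ (Fin m))),
      0 < c ∧ IsDominatedPair f₀ f₁ c B ∧
      (Q.restrict {o | o.D = ω}).map (fun o => φ ω o.X) = densityMeasure volume f₁ ∧
      (Q.restrict {o | o.D = !ω}).map (fun o => φ ω o.X) = densityMeasure volume f₀ ∧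
      ∀ᵐ o ∂Q, o.D = ω → oddsTarget Q o = f₀ (φ ω o.X) / f₁ (φ ω o.X) := by
  obtain ⟨f, hfm, hf0, hfQ, hfc⟩ := hreg.density ω
  obtain ⟨a, ha, hae⟩ := hover
  have hU : Measurable fun o : Obs d => φ ω o.X := (hφ ω).comp measurable_obs_X
  set U : Obs d → EuclideanSpace ℝ (Fin m) := fun o => φ ω o.X with hUdef
  set μU := Q.map U with hμU
  have : IsProbabilityMeasure μU := Measure.isProbabilityMeasure_map hU.aemeasurable
  set S := μU.support with hS
  -- The support is compact, so that the density is bounded there.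
  have hSX : S ⊆ closure Xφ := by
    refine Measure.support_subset_of_isClosed isClosed_closure ?_
    rw [hμU]
    refine (ae_map_iff hU.aemeasurable isClosed_closure.measurableSet).2 ?_
    have h1 : ∀ᵐ x ∂(Q.map Obs.X), x ∈ covSupport Q := Measure.support_mem_ae
    filter_upwards [ae_of_ae_map measurable_obs_X.aemeasurable h1] with o ho
    exact subset_closure (hreg.mapsTo ω ho)
  have hSb : Bornology.IsBounded S := hreg.diam_bounded.closure.subset hSX
  have hSclosed : IsClosed S := Measure.isClosed_support
  have hSm : MeasurableSet S := hSclosed.measurableSet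
  have hScompact : IsCompact S := Metric.isCompact_of_isClosed_isBounded hSclosed hSb
  obtain ⟨C, hC⟩ := (hScompact.image_of_continuousOn hfc).bddAbove
  have hSae : ∀ᵐ u ∂μU, u ∈ S := Measure.support_mem_ae
  set ft := S.indicator f with hft
  have hft0 : ∀ u, 0 ≤ ft u := fun u => Set.indicator_nonneg (fun u _ => hf0 u) u
  have hftm : Measurable ft := hfm.indicator hSm
  have hμft : μU = densityMeasure volume ft := by
    have h1 : (fun u => ENNReal.ofReal (ft u)) = S.indicator fun u => ENNReal.ofReal (f u) := by
      ext u
      by_cases hu : u ∈ S <;> simp [hft, hu]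
    rw [densityMeasure, h1, withDensity_indicator hSm, ← restrict_withDensity hSm, ← hfQ,
      Measure.restrict_eq_self_of_ae_mem hSae]
  -- The conditional probability of the group, and its clipping to the interval given by overlap.
  set g := groupProb Q (φ ω) ω with hg
  have hgm : Measurable g := (Kernel.measurable_coe _ (measurableSet_singleton ω)).ennreal_toReal
  have hprop : ∀ᵐ o ∂Q, g (U o) = (if ω then propensity Q o.X else 1 - propensity Q o.X) ∧
      a < propensity Q o.X ∧ propensity Q o.X < 1 - a := by
    filter_upwards [ae_of_ae_map measurable_obs_X.aemeasurable (hreg.preserved ω),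
      ae_of_ae_map measurable_obs_X.aemeasurable hae] with o h1 h2
    refine ⟨?_, h2⟩
    have h3 : condTreat Q (φ ω) (φ ω o.X) = groupProb Q (φ ω) true (φ ω o.X) := rfl
    cases ω
    · rw [← h1, h3, ← groupProb_not]
      rfl
    · rw [← h1, h3]
      rfl
  have ha2 : a < 1 - a := by
    obtain ⟨o, ho⟩ := hprop.exists
    exact ho.2.1.trans ho.2.2
  set gt : EuclideanSpace ℝ (Fin m) → ℝ := fun u => max a (min (1 - a) (g u)) with hgt
  have hgtm : Measurable gt := by fun_prop
  have hgta : ∀ u, a ≤ gt u := fun u => le_max_left _ _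
  have hgtb : ∀ u, gt u ≤ 1 - a := fun u => max_le ha2.le (min_le_left _ _)
  have hgg : ∀ᵐ o ∂Q, gt (U o) = g (U o) := by
    filter_upwards [hprop] with o ho
    simp only [hgt]
    cases ω
    · simp only [Bool.false_eq_true, if_false] at ho
      rw [min_eq_right (by linarith), max_eq_right (by linarith)]
    · simp only [if_true] at ho
      rw [min_eq_right (by linarith), max_eq_right (by linarith)]
  have hgg' : ∀ᵐ u ∂μU, gt u = g u :=
    (ae_map_iff hU.aemeasurable (measurableSet_eq_fun hgtm hgm)).2 hgg
  refine ⟨fun u => (1 - gt u) * ft u, fun u => gt u * ft u, max (max C 1) ((1 - a) / a), S,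
    lt_of_lt_of_le one_pos ((le_max_right _ _).trans (le_max_left _ _)), ?_, ?_, ?_, ?_⟩
  · have hftC : ∀ u, ft u ≤ max C 1 := by
      intro u
      by_cases hu : u ∈ S
      · rw [hft, Set.indicator_of_mem hu]
        exact (hC (mem_image_of_mem f hu)).trans (le_max_left _ _)
      · rw [hft, Set.indicator_of_notMem hu]
        exact zero_le_one.trans (le_max_right _ _)
    refine ⟨by fun_prop, by fun_prop, fun u => ?_, fun u => ?_, fun u => ?_, fun u => ?_,
      fun u => ?_, hSb, fun u hu => ?_⟩
    · exact mul_nonneg (by linarith [hgtb u]) (hft0 u)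
    · exact mul_nonneg (by linarith [hgta u]) (hft0 u)
    · refine le_trans (mul_le_of_le_one_left (hft0 u) (by linarith [hgta u])) ?_
      exact (hftC u).trans (le_max_left _ _)
    · refine le_trans (mul_le_of_le_one_left (hft0 u) (by linarith [hgtb u])) ?_
      exact (hftC u).trans (le_max_left _ _)
    · rw [← mul_assoc]
      refine mul_le_mul_of_nonneg_right ?_ (hft0 u)
      calc 1 - gt u ≤ 1 - a := by linarith [hgta u]
        _ = (1 - a) / a * a := by field_simp
        _ ≤ max (max C 1) ((1 - a) / a) * gt u :=
            mul_le_mul (le_max_right _ _) (hgta u) ha.le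
              (le_trans (div_nonneg (by linarith) ha.le) (le_max_right _ _))
    · rw [hft, Set.indicator_of_notMem hu, mul_zero]
  · rw [map_restrict_group Q (hφ ω) ω]
    have h1 : (fun u => ENNReal.ofReal (groupProb Q (φ ω) ω u)) =ᵐ[μU]
        fun u => ENNReal.ofReal (gt u) := by
      filter_upwards [hgg'] with u hu
      rw [hu]
    rw [withDensity_congr_ae h1, hμft, densityMeasure, ← withDensity_mul _ (by fun_prop)
      (by fun_prop)]
    congr 1
    ext u
    rw [Pi.mul_apply, mul_comm, ← ENNReal.ofReal_mul (by linarith [hgta u])]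
  · rw [map_restrict_group Q (hφ ω) (!ω)]
    have h1 : (fun u => ENNReal.ofReal (groupProb Q (φ ω) (!ω) u)) =ᵐ[μU]
        fun u => ENNReal.ofReal (1 - gt u) := by
      filter_upwards [hgg'] with u hu
      rw [hu, groupProb_not]
    rw [withDensity_congr_ae h1, hμft, densityMeasure, ← withDensity_mul _ (by fun_prop)
      (by fun_prop)]
    congr 1
    ext u
    rw [Pi.mul_apply, mul_comm, ← ENNReal.ofReal_mul (by linarith [hgtb u])]
  · have hftpos : ∀ᵐ u ∂μU, 0 < ft u := by
      rw [hμft, ae_withDensity_iff (by fun_prop)]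
      exact ae_of_all _ fun u hu => ENNReal.ofReal_pos.1 (pos_iff_ne_zero.2 hu)
    filter_upwards [hprop, hgg, ae_of_ae_map hU.aemeasurable hftpos] with o h1 h2 h3 hD
    have hga := hgta (U o)
    have hft3 : ft (φ ω o.X) ≠ 0 := h3.ne'
    rw [mul_div_mul_right _ _ hft3]
    have h4 : gt (φ ω o.X) = g (φ ω o.X) := h2
    have h5 : g (φ ω o.X) = (if ω then propensity Q o.X else 1 - propensity Q o.X) := h1.1
    rw [h4, h5]
    unfold oddsTarget
    rw [hD]
    cases ω
    · simp
    · simp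

instance (Q : Measure (Obs d)) [IsProbabilityMeasure Q] (n : ℕ) :
    IsProbabilityMeasure (sampleLaw Q n) := by
  unfold sampleLaw
  infer_instance

end Laws

section Relabel

open Set

variable {d : ℕ} {Ω : Type*} [MeasurableSpace Ω] {P : Measure Ω} [IsProbabilityMeasure P]
  {Q : Measure (Obs d)} [IsProbabilityMeasure Q] {O : ℕ → Ω → Obs d}

/-- Two units and the remaining sample are independent, in any order of the units. -/
theorem map_relabel_eq (hO : ∀ i, Measurable (O i)) (hlaw : ∀ i, P.map (O i) = Q)
    (hindep : iIndepFun O P) {n : ℕ} (e : Equiv.Perm (Fin (n + 2))) :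
    P.map (fun w => ((O (e 0) w, O (e 1) w), fun i : Fin n => O (e i.succ.succ) w)) =
      (Q.prod Q).prod (sampleLaw Q n) := by
  have hinj : Function.Injective fun k : Fin (n + 2) => ((e k : Fin (n + 2)) : ℕ) := fun a b h =>
    e.injective (Fin.ext h)
  have h1 : P.map (fun w (k : Fin (n + 2)) => O (e k) w) = Measure.pi fun _ => Q := by
    have := (hindep.precomp hinj).map_fun_eq_pi_map fun k => (hO _).aemeasurable
    simpa only [hlaw] using this
  have h2 := measurePreserving_piFinSuccAbove (fun _ : Fin (n + 2) => Q) 0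
  have h3 := measurePreserving_piFinSuccAbove (fun _ : Fin (n + 1) => Q) 0
  have h4 := ((measurePreserving_prodAssoc Q Q (Measure.pi fun _ : Fin n => Q)).symm).comp
    (((MeasurePreserving.id Q).prod h3).comp h2)
  have h5 := h4.map_eq
  rw [← h1, Measure.map_map h4.measurable (measurable_pi_lambda _ fun k => hO _)] at h5
  exact h5

theorem exists_perm_three {k : ℕ} {i j j' : Fin (k + 3)} (hij : i ≠ j) (hij' : i ≠ j')
    (hjj' : j ≠ j') : ∃ e : Equiv.Perm (Fin (k + 3)), e 0 = j ∧ e 1 = j' ∧ e 2 = i := by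
  have h01 : (0 : Fin (k + 3)) ≠ 1 := by simp
  have h02 : (0 : Fin (k + 3)) ≠ 2 := (Fin.succ_ne_zero (Fin.succ (0 : Fin (k + 1)))).symm
  have h12 : (1 : Fin (k + 3)) ≠ 2 :=
    (Fin.succ_injective (k + 2)).ne (Fin.succ_ne_zero (0 : Fin (k + 1))).symm
  have inj1 : Function.Injective ![(0 : Fin (k + 3)), 1, 2] := by
    intro a b h
    fin_cases a <;> fin_cases b <;> simp_all
  have inj2 : Function.Injective ![j, j', i] := by
    intro a b h
    fin_cases a <;> fin_cases b <;> simp_all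
  have := Equiv.Perm.isMultiplyPretransitive (Fin (k + 3)) 3
  obtain ⟨e, he⟩ := this.exists_smul_eq ⟨_, inj1⟩ ⟨_, inj2⟩
  refine ⟨e, ?_, ?_, ?_⟩
  · simpa using DFunLike.congr_fun he 0
  · simpa using DFunLike.congr_fun he 1
  · simpa using DFunLike.congr_fun he 2

end Relabel

/-! ### Second moment of the number of matched times -/

section Upper

open Metric Set

variable {d m : ℕ} {Ω : Type*} [MeasurableSpace Ω]

/-- An i.i.d. sequence of observations together with measurable matched sets for the samples of
every size. -/
structure IsMatchedSample (P : Measure Ω) (Q : Measure (Obs d)) (O : ℕ → Ω → Obs d)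
    (φhat : Estimator d m) (M : ℕ → ℕ) (J : ∀ n : ℕ, Ω → Fin n → Finset (Fin n)) : Prop where
  meas : ∀ i, Measurable (O i)
  law : ∀ i, P.map (O i) = Q
  indep : iIndepFun O P
  measSet : ∀ n (i j : Fin n), MeasurableSet {w | j ∈ J n w i}
  isMatchSet : ∀ n w (i : Fin n), IsMatchSet (M n) (fun k : Fin n => O k w)
    (fun ω => φhat ω (sampleOf fun k : Fin n => O k w)) i (J n w i)

variable {P : Measure Ω} [IsProbabilityMeasure P] {Q : Measure (Obs d)} [IsProbabilityMeasure Q]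
  {O : ℕ → Ω → Obs d} {φhat : Estimator d m} {M : ℕ → ℕ}
  {J : ∀ n : ℕ, Ω → Fin n → Finset (Fin n)}
  {φ : Bool → EuclideanSpace ℝ (Fin d) → EuclideanSpace ℝ (Fin m)} {ω : Bool}
  {f₀ f₁ : EuclideanSpace ℝ (Fin m) → ℝ} {c : ℝ} {B : Set (EuclideanSpace ℝ (Fin m))}

/-- The values `v` of a query that may be matched to the first unit of the sample `r`: either the
estimator is not stable at the distance of `v`, or few units are much closer to `v`. -/
def mayMatch (φ : Bool → EuclideanSpace ℝ (Fin d) → EuclideanSpace ℝ (Fin m)) (ω : Bool) (ρ : ℝ)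
    {k : ℕ} (ζ : (Fin (k + 1) → Obs d) → ℝ≥0∞) (M : ℕ) (r : Fin (k + 1) → Obs d) :
    Set (EuclideanSpace ℝ (Fin m)) :=
  {v | ENNReal.ofReal (ρ * dist v (φ ω (r 0).X)) ^ (2 * m) < ζ r} ∪
    {v | closerCount {o : Obs d | o.D = ω} (fun o => φ ω o.X) ρ (fun t => r t.succ)
      (φ ω (r 0).X) v < M}

theorem measurableSet_mayMatch (hφ : Measurable (φ ω)) (ρ : ℝ) {k : ℕ}
    {ζ : (Fin (k + 1) → Obs d) → ℝ≥0∞} (hζ : Measurable ζ) (M : ℕ) :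
    MeasurableSet {p : EuclideanSpace ℝ (Fin m) × (Fin (k + 1) → Obs d) |
      p.1 ∈ mayMatch φ ω ρ ζ M p.2} := by
  have hU : Measurable fun o : Obs d => φ ω o.X := hφ.comp measurable_obs_X
  have h0 : Measurable fun p : EuclideanSpace ℝ (Fin m) × (Fin (k + 1) → Obs d) =>
      φ ω (p.2 0).X := hU.comp ((measurable_pi_apply 0).comp measurable_snd)
  have h1 : MeasurableSet {p : EuclideanSpace ℝ (Fin m) × (Fin (k + 1) → Obs d) |
      ENNReal.ofReal (ρ * dist p.1 (φ ω (p.2 0).X)) ^ (2 * m) < ζ p.2} :=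
    measurableSet_lt (((measurable_fst.dist h0).const_mul ρ).ennreal_ofReal.pow_const _)
      (hζ.comp measurable_snd)
  have h2 : Measurable fun p : EuclideanSpace ℝ (Fin m) × (Fin (k + 1) → Obs d) =>
      closerCount {o : Obs d | o.D = ω} (fun o => φ ω o.X) ρ (fun t => p.2 t.succ)
        (φ ω (p.2 0).X) p.1 := by
    refine (measurable_closerCount (measurableSet_obs_D_eq ω) hU ρ k).comp
      (Measurable.prodMk ?_ (h0.prodMk measurable_fst))
    exact measurable_pi_lambda _ fun t => (measurable_pi_apply _).comp measurable_snd
  exact h1.union (measurableSet_lt h2 measurable_const)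

theorem IsMatchedSample.ae_inSupport (hS : IsMatchedSample P Q O φhat M J) (n : ℕ) :
    ∀ᵐ w ∂P, InSupport Q fun k : Fin n => O k w := by
  refine ae_all_iff.2 fun k => ?_
  have h1 : ∀ᵐ x ∂(Q.map Obs.X), x ∈ covSupport Q := Measure.support_mem_ae
  have h2 : ∀ᵐ x ∂(Q.map Obs.Y), x ∈ outSupport Q := Measure.support_mem_ae
  have h3 : ∀ᵐ o ∂Q, o.X ∈ covSupport Q ∧ o.Y ∈ outSupport Q := by
    filter_upwards [ae_of_ae_map measurable_obs_X.aemeasurable h1,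
      ae_of_ae_map measurable_obs_Y.aemeasurable h2] with o ho1 ho2 using ⟨ho1, ho2⟩
  rw [← hS.law k] at h3
  simpa only [hS.law k] using ae_of_ae_map (hS.meas k).aemeasurable h3

/-- The probability that two given units are both matched to the first unit. -/
theorem IsMatchedSample.measure_both_matched_le (hS : IsMatchedSample P Q O φhat M J)
    (hφ : Measurable (φ ω))
    (hν₀ : (Q.restrict {o | o.D = !ω}).map (fun o => φ ω o.X) = densityMeasure volume f₀)
    {ε ρ : ℝ} (hε : 0 < ε) (hρ : 0 < ρ) (hρε : (1 + ε) * ρ ≤ 1 - ε) {k : ℕ}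
    {ζ : (Fin (k + 1) → Obs d) → ℝ≥0∞} (hζ : Measurable ζ)
    (hst : ∀ (s : Fin (k + 1) → Obs d) (δ : ℝ), 0 < δ →
      ζ s ≤ ENNReal.ofReal δ ^ (2 * m) → IsStableAt Q φ φhat ω ε δ s)
    {j j' : Fin (k + 3)} (hj : 0 ≠ j) (hj' : 0 ≠ j') (hjj' : j ≠ j') :
    P {w | (O 0 w).D = ω ∧ ((O j w).D = (!ω) ∧ 0 ∈ J (k + 3) w j) ∧
        ((O j' w).D = (!ω) ∧ 0 ∈ J (k + 3) w j')} ≤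
      ∫⁻ r in {r : Fin (k + 1) → Obs d | (r 0).D = ω},
        densityMeasure volume f₀ (mayMatch φ ω ρ ζ (M (k + 3)) r) ^ 2 ∂(sampleLaw Q (k + 1)) := by
  obtain ⟨e, he0, he1, he2⟩ := exists_perm_three hj hj' hjj'
  have hU : Measurable fun o : Obs d => φ ω o.X := hφ.comp measurable_obs_X
  set A : Set (Obs d × (Fin (k + 1) → Obs d)) :=
    {p | p.1.D = (!ω) ∧ φ ω p.1.X ∈ mayMatch φ ω ρ ζ (M (k + 3)) p.2} with hA
  have hAm : MeasurableSet A := by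
    have h1 : MeasurableSet {p : Obs d × (Fin (k + 1) → Obs d) | p.1.D = !ω} :=
      measurable_fst (measurableSet_obs_D_eq _)
    have h2 : Measurable fun p : Obs d × (Fin (k + 1) → Obs d) => (φ ω p.1.X, p.2) :=
      (hU.comp measurable_fst).prodMk measurable_snd
    exact h1.inter (h2 (measurableSet_mayMatch hφ ρ hζ _))
  have hAr : ∀ r, Q ((fun o => (o, r)) ⁻¹' A) =
      densityMeasure volume f₀ (mayMatch φ ω ρ ζ (M (k + 3)) r) := by
    intro r
    have hm : MeasurableSet (mayMatch φ ω ρ ζ (M (k + 3)) r) :=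
      measurable_prodMk_right (measurableSet_mayMatch hφ ρ hζ _)
    rw [← hν₀, Measure.map_apply hU hm, Measure.restrict_apply (hU hm)]
    congr 1
    ext o
    exact and_comm
  set D0 : Set (Fin (k + 1) → Obs d) := {r | (r 0).D = ω} with hD0
  have hD0m : MeasurableSet D0 :=
    (measurable_pi_apply 0 : Measurable fun r : Fin (k + 1) → Obs d => r 0)
      (measurableSet_obs_D_eq ω)
  set T : Set ((Obs d × Obs d) × (Fin (k + 1) → Obs d)) :=
    {q | q.2 ∈ D0 ∧ (q.1.1, q.2) ∈ A ∧ (q.1.2, q.2) ∈ A} with hT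
  have hTm : MeasurableSet T :=
    (measurable_snd hD0m).inter
      (((measurable_fst.comp measurable_fst).prodMk measurable_snd hAm).inter
        ((measurable_snd.comp measurable_fst).prodMk measurable_snd hAm))
  have hrel : Measurable fun w =>
      ((O (e 0) w, O (e 1) w), fun i : Fin (k + 1) => O (e i.succ.succ) w) :=
    ((hS.meas _).prodMk (hS.meas _)).prodMk (measurable_pi_lambda _ fun i => hS.meas _)
  have hsub : ∀ᵐ w ∂P, w ∈ {w | (O 0 w).D = ω ∧ ((O j w).D = (!ω) ∧ 0 ∈ J (k + 3) w j) ∧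
        ((O j' w).D = (!ω) ∧ 0 ∈ J (k + 3) w j')} →
      w ∈ (fun w => ((O (e 0) w, O (e 1) w),
        fun i : Fin (k + 1) => O (e i.succ.succ) w)) ⁻¹' T := by
    filter_upwards [hS.ae_inSupport (k + 3)] with w hw
    rintro ⟨hw0, ⟨hwj, hij⟩, hwj', hij'⟩
    have h20 : e (Fin.succ (Fin.succ (0 : Fin (k + 1)))) = 0 := he2
    have hmem : ∀ i : Fin (k + 3), (O i w).D = (!ω) → 0 ∈ J (k + 3) w i →
        φ ω (O i w).X ∈ mayMatch φ ω ρ ζ (M (k + 3))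
          (fun i : Fin (k + 1) => O (e i.succ.succ) w) := by
      intro i hiD hiJ
      rw [mayMatch, mem_union, or_iff_not_imp_left]
      intro hnot
      simp only [mem_ofPred_eq, not_lt] at hnot ⊢
      rw [h20] at hnot ⊢
      refine closerCount_lt_of_mem (s := fun k : Fin (k + 3) => O k w) (e := e) hε hρ hρε hw ?_ ?_
        hiD (hS.isMatchSet (k + 3) w i) hiJ fun δ hδ hδ0 => hst _ _ hδ0 (hnot.trans ?_)
      · rw [he0]; exact hwj
      · rw [he1]; exact hwj'
      · gcongr
    refine ⟨?_, ⟨?_, ?_⟩, ?_, ?_⟩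
    · change (O (e (Fin.succ (Fin.succ (0 : Fin (k + 1))))) w).D = ω
      rw [h20]; exact hw0
    · change (O (e 0) w).D = _
      rw [he0]; exact hwj
    · change φ ω (O (e 0) w).X ∈ _
      rw [he0]; exact hmem j hwj hij
    · change (O (e 1) w).D = _
      rw [he1]; exact hwj'
    · change φ ω (O (e 1) w).X ∈ _
      rw [he1]; exact hmem j' hwj' hij'
  refine (measure_mono_ae (t := (fun w => ((O (e 0) w, O (e 1) w),
    fun i : Fin (k + 1) => O (e i.succ.succ) w)) ⁻¹' T) hsub).trans (le_of_eq ?_)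
  rw [← Measure.map_apply hrel hTm, map_relabel_eq hS.meas hS.law hS.indep,
    Measure.prod_apply_symm hTm, ← lintegral_indicator hD0m]
  refine lintegral_congr fun r => ?_
  by_cases hr : r ∈ D0
  · rw [Set.indicator_of_mem hr, ← hAr, sq, ← Measure.prod_prod]
    congr 1
    ext q
    exact ⟨fun h => h.2, fun h => ⟨hr, h⟩⟩
  · rw [Set.indicator_of_notMem hr]
    convert measure_empty (μ := Q.prod Q)
    exact Set.eq_empty_of_forall_notMem fun q hq => hr hq.1

theorem ENNReal_natCast_sq_le (K : ℕ) {δ : ℝ} (hδ : 0 < δ) :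
    (K : ℝ≥0∞) ^ 2 ≤
      ENNReal.ofReal (1 + δ) * ((K * K - K : ℕ) : ℝ≥0∞) + ENNReal.ofReal (1 + 1 / δ) := by
  have h1 : (K : ℝ) ^ 2 ≤ (1 + δ) * ((K * K - K : ℕ) : ℝ) + (1 + 1 / δ) := by
    rw [Nat.cast_sub (Nat.le_mul_self K), Nat.cast_mul]
    set x : ℝ := (K : ℝ)
    rcases Nat.eq_zero_or_pos K with h0 | h0
    · have : x = 0 := by simp [x, h0]
      rw [this]
      have : 0 < 1 / δ := by positivity
      simp; positivity
    · have hx : 1 ≤ x := Nat.one_le_cast.2 h0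
      rcases le_total (1 + 1 / δ) x with h | h
      · have h2 : 1 ≤ δ * (x - 1) := by
          have : δ * (1 / δ) ≤ δ * (x - 1) := by gcongr; linarith
          rwa [mul_one_div_cancel hδ.ne'] at this
        have : 0 < 1 / δ := by positivity
        nlinarith
      · nlinarith [mul_nonneg hδ.le (mul_nonneg (by linarith : (0 : ℝ) ≤ x) (sub_nonneg.2 hx))]
  have h2 := ENNReal.ofReal_le_ofReal h1
  rwa [ENNReal.ofReal_pow (by positivity), ENNReal.ofReal_natCast,
    ENNReal.ofReal_add (by positivity) (by positivity), ENNReal.ofReal_mul (by positivity),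
    ENNReal.ofReal_natCast] at h2

/-- The second moment of the number of matched times, up to a bounded term. -/
theorem IsMatchedSample.lintegral_matchedTimes_sq_le (hS : IsMatchedSample P Q O φhat M J)
    (hφ : Measurable (φ ω))
    (hν₀ : (Q.restrict {o | o.D = !ω}).map (fun o => φ ω o.X) = densityMeasure volume f₀)
    {ε ρ : ℝ} (hε : 0 < ε) (hρ : 0 < ρ) (hρε : (1 + ε) * ρ ≤ 1 - ε) {k : ℕ}
    {ζ : (Fin (k + 1) → Obs d) → ℝ≥0∞} (hζ : Measurable ζ)
    (hst : ∀ (s : Fin (k + 1) → Obs d) (δ : ℝ), 0 < δ →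
      ζ s ≤ ENNReal.ofReal δ ^ (2 * m) → IsStableAt Q φ φhat ω ε δ s) {δ : ℝ} (hδ : 0 < δ) :
    ∫⁻ w in {w | (O 0 w).D = ω},
        (matchedTimes (fun i : Fin (k + 3) => O i w) (J (k + 3) w) 0 : ℝ≥0∞) ^ 2 ∂P ≤
      ENNReal.ofReal (1 + δ) * (((k + 3 : ℕ) : ℝ≥0∞) ^ 2 *
        ∫⁻ r in {r : Fin (k + 1) → Obs d | (r 0).D = ω},
          densityMeasure volume f₀ (mayMatch φ ω ρ ζ (M (k + 3)) r) ^ 2 ∂(sampleLaw Q (k + 1))) +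
        ENNReal.ofReal (1 + 1 / δ) := by
  classical
  set I := ∫⁻ r in {r : Fin (k + 1) → Obs d | (r 0).D = ω},
    densityMeasure volume f₀ (mayMatch φ ω ρ ζ (M (k + 3)) r) ^ 2 ∂(sampleLaw Q (k + 1)) with hI
  set G : Set Ω := {w | (O 0 w).D = ω} with hG
  have hGm : MeasurableSet G := hS.meas 0 (measurableSet_obs_D_eq ω)
  set a : Fin (k + 3) → Set Ω := fun j => {w | (O j w).D = (!ω) ∧ 0 ∈ J (k + 3) w j} with ha
  have ham : ∀ j, MeasurableSet (a j) := fun j =>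
    (hS.meas j (measurableSet_obs_D_eq _)).inter (hS.measSet _ j 0)
  have hpt : ∀ w ∈ G, (matchedTimes (fun i : Fin (k + 3) => O i w) (J (k + 3) w) 0 : ℝ≥0∞) ^ 2 ≤
      ENNReal.ofReal (1 + δ) * (∑ p ∈ Finset.univ.offDiag, (a p.1 ∩ a p.2).indicator 1 w) +
        ENNReal.ofReal (1 + 1 / δ) := by
    intro w hw
    refine (ENNReal_natCast_sq_le _ hδ).trans ?_
    gcongr
    unfold matchedTimes
    rw [← Finset.offDiag_card, Finset.card_eq_sum_ones, Nat.cast_sum]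
    have h0 : (O 0 w).D = ω := hw
    refine le_trans (le_of_eq ?_) (Finset.sum_le_sum_of_subset
      (Finset.offDiag_mono (Finset.filter_subset (fun j => w ∈ a j) Finset.univ)))
    refine Finset.sum_congr ?_ fun p hp => ?_
    · congr 1
      ext j
      simp [ha, h0]
    · rw [Finset.mem_offDiag] at hp
      have hp1 := (Finset.mem_filter.1 hp.1).2
      have hp2 := (Finset.mem_filter.1 hp.2.1).2
      have hmem : w ∈ a p.1 ∩ a p.2 := by
        exact ⟨hp1, hp2⟩
      rw [Set.indicator_of_mem hmem]
      simp
  calc _ ≤ ∫⁻ w in G, (ENNReal.ofReal (1 + δ) *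
          (∑ p ∈ Finset.univ.offDiag, (a p.1 ∩ a p.2).indicator 1 w) +
            ENNReal.ofReal (1 + 1 / δ)) ∂P := setLIntegral_mono' hGm hpt
    _ = ENNReal.ofReal (1 + δ) * (∑ p ∈ Finset.univ.offDiag, P (G ∩ (a p.1 ∩ a p.2))) +
          ENNReal.ofReal (1 + 1 / δ) * P G := by
        rw [lintegral_add_right _ measurable_const, lintegral_const_mul' _ _ (by finiteness),
          lintegral_finsetSum _ fun p _ => measurable_one.indicator ((ham _).inter (ham _)),
          lintegral_const, Measure.restrict_apply_univ]
        congr 3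
        ext p
        rw [lintegral_indicator_one ((ham _).inter (ham _)),
          Measure.restrict_apply ((ham _).inter (ham _)), Set.inter_comm]
    _ ≤ ENNReal.ofReal (1 + δ) * (∑ p ∈ (Finset.univ : Finset (Fin (k + 3))).offDiag, I) +
          ENNReal.ofReal (1 + 1 / δ) * 1 := by
        gcongr with p hp
        · have hne : ω ≠ !ω := by cases ω <;> decide
          rw [Finset.mem_offDiag] at hp
          rcases eq_or_ne 0 p.1 with h | h
          · refine le_trans (le_of_eq ?_) zero_le
            convert measure_empty (μ := P)
            refine Set.eq_empty_of_forall_notMem fun w hw => hne ?_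
            have h1 : (O 0 w).D = ω := hw.1
            have h2 : (O p.1 w).D = !ω := hw.2.1.1
            rw [← h2, ← h, ← h1]
            rfl
          rcases eq_or_ne 0 p.2 with h' | h'
          · refine le_trans (le_of_eq ?_) zero_le
            convert measure_empty (μ := P)
            refine Set.eq_empty_of_forall_notMem fun w hw => hne ?_
            have h1 : (O 0 w).D = ω := hw.1
            have h2 : (O p.2 w).D = !ω := hw.2.2.1
            rw [← h2, ← h', ← h1]
            rfl
          exact hS.measure_both_matched_le hφ hν₀ hε hρ hρε hζ hst h h' hp.2.2
        · exact prob_le_one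
    _ ≤ _ := by
        rw [Finset.sum_const, nsmul_eq_mul, mul_one]
        gcongr
        rw [← Nat.cast_pow]
        refine Nat.cast_le.2 ?_
        rw [Finset.offDiag_card, Finset.card_univ, Fintype.card_fin, sq]
        exact Nat.sub_le _ _

/-- Unstable distances fill a ball whose squared volume is the stable scale. -/
theorem IsDominatedPair.measure_unstable_sq_le (h : IsDominatedPair f₀ f₁ c B) (hm : 1 ≤ m)
    {ρ : ℝ} (hρ : 0 < ρ) : ∃ C : ℝ≥0∞, C ≠ ∞ ∧ ∀ (z : ℝ≥0∞) (u : EuclideanSpace ℝ (Fin m)),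
      densityMeasure volume f₀ {v | ENNReal.ofReal (ρ * dist v u) ^ (2 * m) < z} ^ 2 ≤ C * z := by
  set V := volume (ball (0 : EuclideanSpace ℝ (Fin m)) 1) with hV
  have hVt : V ≠ ∞ := measure_ball_lt_top.ne
  refine ⟨(ENNReal.ofReal c * ENNReal.ofReal (1 / ρ ^ m) * V) ^ 2 + 1, by finiteness,
    fun z u => ?_⟩
  rcases eq_or_ne z ∞ with rfl | hz
  · rw [ENNReal.mul_top (by simp)]
    exact le_top
  have : Nonempty (Fin m) := ⟨⟨0, hm⟩⟩
  have hmR : (m : ℝ) ≠ 0 := by positivity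
  set R : ℝ := z.toReal ^ (1 / ((2 * m : ℕ) : ℝ)) with hR
  have hR0 : 0 ≤ R := by positivity
  have hRp : R ^ (2 * m) = z.toReal := by
    rw [hR, one_div, Real.rpow_inv_natCast_pow ENNReal.toReal_nonneg (by omega)]
  have hsub : {v | ENNReal.ofReal (ρ * dist v u) ^ (2 * m) < z} ⊆ closedBall u (R / ρ) := by
    intro v hv
    have hv : ENNReal.ofReal (ρ * dist v u) ^ (2 * m) < z := hv
    rw [← ENNReal.ofReal_toReal hz, ← hRp, ENNReal.ofReal_pow hR0] at hv
    have h1 := lt_of_not_ge fun h => absurd hv (not_lt.2 (pow_le_pow_left' h (2 * m)))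
    rw [ENNReal.ofReal_lt_ofReal_iff_of_nonneg (by positivity)] at h1
    rw [mem_closedBall, le_div_iff₀ hρ]
    linarith
  have hball : densityMeasure volume f₀ (closedBall u (R / ρ)) ≤
      ENNReal.ofReal c * ENNReal.ofReal (1 / ρ ^ m) * V * ENNReal.ofReal (R ^ m) := by
    refine (h.measure₀_le volume _).trans (le_of_eq ?_)
    rw [Measure.smul_apply, smul_eq_mul, Measure.addHaar_closedBall _ _ (by positivity),
      finrank_euclideanSpace_fin, div_pow, div_eq_mul_one_div, ENNReal.ofReal_mul (by positivity)]
    ring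
  calc _ ≤ (ENNReal.ofReal c * ENNReal.ofReal (1 / ρ ^ m) * V * ENNReal.ofReal (R ^ m)) ^ 2 := by
        gcongr
        exact (measure_mono hsub).trans hball
    _ = (ENNReal.ofReal c * ENNReal.ofReal (1 / ρ ^ m) * V) ^ 2 * z := by
        rw [mul_pow, ← ENNReal.ofReal_pow (by positivity), ← pow_mul, mul_comm m, hRp,
          ENNReal.ofReal_toReal hz]
    _ ≤ _ := by gcongr; exact le_self_add

end Upper

/-! ### Upper limit of the second moment -/

section UpperLimit

open Metric Set

variable {d m : ℕ} {Ω : Type*} [MeasurableSpace Ω]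
  {P : Measure Ω} [IsProbabilityMeasure P] {Q : Measure (Obs d)} [IsProbabilityMeasure Q]
  {O : ℕ → Ω → Obs d} {φhat : Estimator d m} {M : ℕ → ℕ}
  {J : ∀ n : ℕ, Ω → Fin n → Finset (Fin n)}
  {φ : Bool → EuclideanSpace ℝ (Fin d) → EuclideanSpace ℝ (Fin m)} {ω : Bool}
  {f₀ f₁ : EuclideanSpace ℝ (Fin m) → ℝ} {c : ℝ} {B : Set (EuclideanSpace ℝ (Fin m))}

/-- Integration over a sample whose first unit lies in the group `ω`. -/
theorem setLIntegral_sampleLaw_succ (hφ : Measurable (φ ω))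
    (hν₁ : (Q.restrict {o | o.D = ω}).map (fun o => φ ω o.X) = densityMeasure volume f₁) {k : ℕ}
    {g : EuclideanSpace ℝ (Fin m) × (Fin k → Obs d) → ℝ≥0∞} (hg : Measurable g) :
    ∫⁻ r in {r : Fin (k + 1) → Obs d | (r 0).D = ω}, g (φ ω (r 0).X, fun t => r t.succ)
        ∂(sampleLaw Q (k + 1)) =
      ∫⁻ u, ∫⁻ r, g (u, r) ∂(sampleLaw Q k) ∂(densityMeasure volume f₁) := by
  have hU : Measurable fun o : Obs d => φ ω o.X := hφ.comp measurable_obs_X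
  have hG := measurableSet_obs_D_eq (d := d) ω
  have hp : MeasurePreserving (fun r : Fin (k + 1) → Obs d => (r 0, fun t : Fin k => r t.succ))
      (sampleLaw Q (k + 1)) (Q.prod (sampleLaw Q k)) :=
    measurePreserving_piFinSuccAbove (fun _ : Fin (k + 1) => Q) 0
  have hgU : Measurable fun p : Obs d × (Fin k → Obs d) => g (φ ω p.1.X, p.2) :=
    hg.comp ((hU.comp measurable_fst).prodMk measurable_snd)
  have hGs : MeasurableSet {p : Obs d × (Fin k → Obs d) | p.1.D = ω} := measurable_fst hG
  rw [← hν₁, lintegral_map hg.lintegral_prod_right' hU]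
  have h1 := hp.setLIntegral_comp_preimage hGs hgU
  refine Eq.trans h1 ?_
  have h2 : {p : Obs d × (Fin k → Obs d) | p.1.D = ω} = {o : Obs d | o.D = ω} ×ˢ univ := by
    ext p; simp
  rw [h2, ← Measure.prod_restrict, Measure.restrict_univ, lintegral_prod _ hgU.aemeasurable]

theorem IsDominatedPair.exists_setLIntegral_mayMatch_sq_le (h : IsDominatedPair f₀ f₁ c B)
    (hm : 1 ≤ m) (hφ : Measurable (φ ω))
    (hν₁ : (Q.restrict {o | o.D = ω}).map (fun o => φ ω o.X) = densityMeasure volume f₁)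
    {ρ : ℝ} (hρ : 0 < ρ) {δ : ℝ} (hδ : 0 < δ) : ∃ C : ℝ≥0∞, C ≠ ∞ ∧
      ∀ (k N : ℕ) (ζ : (Fin (k + 1) → Obs d) → ℝ≥0∞),
    ∫⁻ r in {r : Fin (k + 1) → Obs d | (r 0).D = ω},
        densityMeasure volume f₀ (mayMatch φ ω ρ ζ N r) ^ 2 ∂(sampleLaw Q (k + 1)) ≤
      ENNReal.ofReal (1 + δ) * ∫⁻ u, ∫⁻ r, densityMeasure volume f₀
          {v | closerCount {o : Obs d | o.D = ω} (fun o => φ ω o.X) ρ r u v < N} ^ 2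
          ∂(sampleLaw Q k) ∂(densityMeasure volume f₁) +
        C * ∫⁻ s, ζ s ∂(sampleLaw Q (k + 1)) := by
  obtain ⟨C, hC, H⟩ := h.measure_unstable_sq_le hm hρ
  have := h.isFiniteMeasure₀ volume
  have hU : Measurable fun o : Obs d => φ ω o.X := hφ.comp measurable_obs_X
  refine ⟨ENNReal.ofReal (1 + 1 / δ) * C, by finiteness, fun k N ζ => ?_⟩
  have hg : Measurable fun p : EuclideanSpace ℝ (Fin m) × (Fin k → Obs d) =>
      densityMeasure volume f₀ {v | closerCount {o : Obs d | o.D = ω} (fun o => φ ω o.X) ρ p.2 p.1 v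
        < N} ^ 2 := by
    refine (measurable_measure_prodMk_left (ν := densityMeasure volume f₀)
      (s := {q : (EuclideanSpace ℝ (Fin m) × (Fin k → Obs d)) × EuclideanSpace ℝ (Fin m) |
        closerCount {o : Obs d | o.D = ω} (fun o => φ ω o.X) ρ q.1.2 q.1.1 q.2 < N})
        ?_).pow_const 2
    have hq : Measurable fun q : (EuclideanSpace ℝ (Fin m) × (Fin k → Obs d)) ×
        EuclideanSpace ℝ (Fin m) => (q.1.2, q.1.1, q.2) := by fun_prop
    exact measurableSet_lt ((measurable_closerCount (measurableSet_obs_D_eq ω) hU ρ k).comp hq)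
      measurable_const
  rw [← setLIntegral_sampleLaw_succ hφ hν₁ hg, ← lintegral_const_mul' _ _ (by finiteness),
    ← lintegral_const_mul' _ _ (by finiteness)]
  have hgr : Measurable fun r : Fin (k + 1) → Obs d => ENNReal.ofReal (1 + δ) *
      densityMeasure volume f₀ {v | closerCount {o : Obs d | o.D = ω} (fun o => φ ω o.X) ρ
        (fun t => r t.succ) (φ ω (r 0).X) v < N} ^ 2 := by
    have h0 : Measurable fun r : Fin (k + 1) → Obs d => r 0 := measurable_pi_apply 0
    have hs : Measurable fun r : Fin (k + 1) → Obs d => fun t : Fin k => r t.succ :=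
      measurable_pi_lambda _ fun t => measurable_pi_apply _
    exact (hg.comp ((hU.comp h0).prodMk hs)).const_mul _
  refine le_trans ?_ (add_le_add le_rfl (setLIntegral_le_lintegral
    {r : Fin (k + 1) → Obs d | (r 0).D = ω} _))
  rw [← lintegral_add_left hgr]
  refine lintegral_mono fun r => ?_
  calc _ ≤ (densityMeasure volume f₀ {v | closerCount {o : Obs d | o.D = ω} (fun o => φ ω o.X) ρ
        (fun t => r t.succ) (φ ω (r 0).X) v < N} +
        densityMeasure volume f₀ {v | ENNReal.ofReal (ρ * dist v (φ ω (r 0).X)) ^ (2 * m) < ζ r})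
          ^ 2 := by
        gcongr
        rw [add_comm]
        exact measure_union_le _ _
    _ ≤ _ := by
        refine (ENNReal_add_sq_le _ _ hδ).trans ?_
        rw [mul_assoc]
        gcongr
        exact H _ _

theorem exists_parameter_lt (m : ℕ) {S ε : ℝ≥0∞} (hS : S ≠ ∞) (hε : ε ≠ 0) :
    ∃ t : ℝ, 0 < t ∧ t < 1 / 4 ∧ ENNReal.ofReal (1 + t) ^ 2 * (ENNReal.ofReal (1 + t) ^ 3 *
      (ENNReal.ofReal (1 / (1 - 2 * t) ^ m) ^ 2 * S + ENNReal.ofReal t) + ENNReal.ofReal t)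
        < S + ε := by
  have hlim : Tendsto (fun t : ℝ => ENNReal.ofReal ((1 + t) ^ 2 * ((1 + t) ^ 3 *
      ((1 / (1 - 2 * t) ^ m) ^ 2 * S.toReal + t) + t))) (𝓝 0) (𝓝 S) := by
    have h1 : ContinuousAt (fun t : ℝ => (1 + t) ^ 2 * ((1 + t) ^ 3 *
      ((1 / (1 - 2 * t) ^ m) ^ 2 * S.toReal + t) + t)) 0 := by
      have : ContinuousAt (fun t : ℝ => 1 / (1 - 2 * t) ^ m) 0 :=
        ContinuousAt.div (by fun_prop) (by fun_prop) (by simp)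
      fun_prop
    have h2 := ENNReal.tendsto_ofReal h1.tendsto
    simpa [hS] using h2
  have hlt := (hlim.eventually (gt_mem_nhds (ENNReal.lt_add_right hS hε))).filter_mono
    (nhdsWithin_le_nhds (s := Ioi 0))
  obtain ⟨t, ht, ht0, ht1⟩ := (hlt.and (Ioo_mem_nhdsGT (by norm_num : (0 : ℝ) < 1 / 4))).exists
  refine ⟨t, ht0, ht1, lt_of_le_of_lt (le_of_eq ?_) ht⟩
  have hq : 0 < 1 - 2 * t := by linarith
  obtain ⟨y, hy0, hy⟩ : ∃ y, 0 ≤ y ∧ y = 1 + t := ⟨1 + t, by positivity, rfl⟩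
  rw [← hy]
  rw [ENNReal.ofReal_mul (by positivity), ENNReal.ofReal_add (by positivity) ht0.le,
    ENNReal.ofReal_mul (by positivity), ENNReal.ofReal_add (by positivity) ht0.le,
    ENNReal.ofReal_mul (by positivity), ENNReal.ofReal_toReal hS,
    ENNReal.ofReal_pow (by positivity), ENNReal.ofReal_pow (by positivity),
    ENNReal.ofReal_pow (by positivity)]

/-- The second moment of the number of matched times is asymptotically at most that of the odds. -/
theorem IsMatchedSample.eventually_lintegral_sq_le (hS : IsMatchedSample P Q O φhat M J)
    (hm : 1 ≤ m) (hφ : Measurable (φ ω)) (h : IsDominatedPair f₀ f₁ c B)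
    (hν₁ : (Q.restrict {o | o.D = ω}).map (fun o => φ ω o.X) = densityMeasure volume f₁)
    (hν₀ : (Q.restrict {o | o.D = !ω}).map (fun o => φ ω o.X) = densityMeasure volume f₀)
    (hM : Tendsto M atTop atTop) (hMn : Tendsto (fun n : ℕ => (M n : ℝ) / n) atTop (𝓝 0))
    (hsc : ∀ ε : ℝ, 0 < ε → HasStableScale Q φ φhat M ω ε) {ε : ℝ≥0∞} (hε : ε ≠ 0) :
    ∀ᶠ k : ℕ in atTop, ∫⁻ w in {w | (O 0 w).D = ω},
        ((matchedTimes (fun i : Fin (k + 3) => O i w) (J (k + 3) w) 0 : ℝ≥0∞) / M (k + 3)) ^ 2 ∂P ≤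
      ∫⁻ u, ENNReal.ofReal (f₀ u / f₁ u) ^ 2 ∂(densityMeasure volume f₁) + ε := by
  have : Nonempty (Fin m) := ⟨⟨0, hm⟩⟩
  have hU : Measurable fun o : Obs d => φ ω o.X := hφ.comp measurable_obs_X
  set S := ∫⁻ u, ENNReal.ofReal (f₀ u / f₁ u) ^ 2 ∂(densityMeasure volume f₁) with hSdef
  have hSt : S ≠ ∞ := by
    have := h.lintegral_ratio_sq_ne_top volume (ρ := 1) one_pos
    simpa [hSdef] using this
  obtain ⟨t, ht0, ht1, ht⟩ := exists_parameter_lt m hSt hε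
  set ρ : ℝ := 1 - 2 * t with hρ
  have hρ0 : 0 < ρ := by linarith
  have hρ1 : ρ ≤ 1 := by linarith
  have hρε : (1 + t) * ρ ≤ 1 - t := by rw [hρ]; nlinarith
  obtain ⟨ζ, hζm, hζlim, hζst⟩ := hsc t ht0
  obtain ⟨C, hC, HC⟩ := h.exists_setLIntegral_mayMatch_sq_le hm hφ hν₁ hρ0 ht0
  have hratio : ∫⁻ u, ENNReal.ofReal (f₀ u / (f₁ u * ρ ^ Module.finrank ℝ
      (EuclideanSpace ℝ (Fin m)))) ^ 2 ∂(densityMeasure volume f₁) =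
        ENNReal.ofReal (1 / ρ ^ m) ^ 2 * S := by
    rw [hSdef, ← lintegral_const_mul' _ _ (by finiteness)]
    refine lintegral_congr fun u => ?_
    rw [← mul_pow, ← ENNReal.ofReal_mul (by positivity), finrank_euclideanSpace_fin]
    congr 2
    rw [div_mul_eq_div_div, div_eq_mul_one_div, mul_comm]
  set R := ENNReal.ofReal (1 + t) ^ 3 *
      (ENNReal.ofReal (1 / ρ ^ m) ^ 2 * S + ENNReal.ofReal t) + ENNReal.ofReal t with hR
  have hRt : R ≠ ∞ := by finiteness
  have h3 : Tendsto (fun k : ℕ => k + 3) atTop atTop := tendsto_add_atTop_nat 3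
  -- The ratio of the number of matches to the number of the other units.
  have hMk : Tendsto (fun k : ℕ => (M (k + 3) : ℝ) / k) atTop (𝓝 0) := by
    have h1 := (hMn.comp h3).mul ((tendsto_const_div_atTop_nhds_zero_nat 3).const_add 1)
    rw [zero_mul] at h1
    refine h1.congr' ?_
    filter_upwards [eventually_gt_atTop 0] with k hk
    have : (k : ℝ) ≠ 0 := by positivity
    simp only [Function.comp_apply, Nat.cast_add, Nat.cast_ofNat]
    field_simp
  have hcount := h.eventually_lintegral_closerCount_sq_le Q volume (measurableSet_obs_D_eq ω) hU
    hν₁ hρ0 hρ1 ht0 (M := fun k => M (k + 3)) (k := fun k => k) (hM.comp h3) tendsto_id hMk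
    (ε := ENNReal.ofReal t) (by simpa using ht0)
  set X : ℕ → ℝ≥0∞ := fun k => ((k + 3 : ℕ) : ℝ≥0∞) / (M (k + 3) : ℝ≥0∞) with hX
  set Z : ℕ → ℝ≥0∞ := fun k => ∫⁻ s, ζ (k + 1) s ∂(sampleLaw Q (k + 1)) with hZ
  have hXZ : Tendsto (fun k => X k ^ 2 * Z k) atTop (𝓝 0) := hζlim.comp (tendsto_add_atTop_nat 1)
  set D := ENNReal.ofReal (1 + 1 / t) with hD
  have hDt : D ≠ ∞ := ENNReal.ofReal_ne_top
  have hMinv : Tendsto (fun k => ((M (k + 3) : ℝ≥0∞)⁻¹) ^ 2) atTop (𝓝 0) := by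
    have h1 := (ENNReal.tendsto_inv_nat_nhds_zero.comp (hM.comp h3))
    have h2 := ((ENNReal.continuous_pow 2).tendsto 0).comp h1
    rwa [zero_pow two_ne_zero] at h2
  have hquot : Tendsto (fun k : ℕ => ENNReal.ofReal (1 + 3 / k) ^ 2) atTop (𝓝 1) := by
    have h1 := ENNReal.tendsto_ofReal
      ((tendsto_const_div_atTop_nhds_zero_nat (3 : ℝ)).const_add 1)
    rw [add_zero, ENNReal.ofReal_one] at h1
    have h2 := ((ENNReal.continuous_pow 2).tendsto 1).comp h1
    rwa [one_pow] at h2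
  have hlim : Tendsto (fun k : ℕ => ENNReal.ofReal (1 + t) *
      (ENNReal.ofReal (1 + t) * (ENNReal.ofReal (1 + 3 / k) ^ 2 * R) + C * (X k ^ 2 * Z k)) +
        D * ((M (k + 3) : ℝ≥0∞)⁻¹) ^ 2) atTop
      (𝓝 (ENNReal.ofReal (1 + t) * (ENNReal.ofReal (1 + t) * (1 * R) + C * 0) + D * 0)) := by
    refine Tendsto.add (ENNReal.Tendsto.const_mul (Tendsto.add (ENNReal.Tendsto.const_mul
      (ENNReal.Tendsto.mul_const hquot (Or.inr hRt)) (Or.inr ENNReal.ofReal_ne_top))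
      (ENNReal.Tendsto.const_mul hXZ (Or.inr hC))) (Or.inr ENNReal.ofReal_ne_top))
      (ENNReal.Tendsto.const_mul hMinv (Or.inr hDt))
  have hlt : ENNReal.ofReal (1 + t) * (ENNReal.ofReal (1 + t) * (1 * R) + C * 0) + D * 0 < S + ε := by
    refine lt_of_le_of_lt (le_of_eq ?_) ht
    rw [mul_zero, mul_zero, add_zero, add_zero, one_mul, ← mul_assoc, ← sq]
  filter_upwards [hcount, hlim.eventually (gt_mem_nhds hlt), (tendsto_add_atTop_nat 1).eventually
    hζst, (hM.comp h3).eventually_ge_atTop 1, eventually_gt_atTop 0] with k hk hkl hks hkM hk0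
  refine le_trans ?_ hkl.le
  have hMk0 : (M (k + 3) : ℝ≥0∞) ≠ 0 := by
    have : M (k + 3) ≠ 0 := Nat.one_le_iff_ne_zero.1 hkM
    exact_mod_cast this
  have hN := hS.lintegral_matchedTimes_sq_le hφ hν₀ ht0 hρ0 hρε (hζm (k + 1)) hks ht0
  rw [hratio] at hk
  have hI := HC k (M (k + 3)) (ζ (k + 1))
  have hXM : X k ^ 2 * ENNReal.ofReal ((M (k + 3) : ℝ) / k) ^ 2 =
      ENNReal.ofReal (1 + 3 / k) ^ 2 := by
    rw [← mul_pow]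
    congr 1
    have hk0' : (0 : ℝ) < k := by positivity
    have hMk0' : (0 : ℝ) < M (k + 3) := by exact_mod_cast hkM
    have : X k = ENNReal.ofReal (((k + 3 : ℕ) : ℝ) / (M (k + 3) : ℝ)) := by
      rw [ENNReal.ofReal_div_of_pos hMk0', ENNReal.ofReal_natCast, ENNReal.ofReal_natCast]
    rw [this, ← ENNReal.ofReal_mul (by positivity)]
    congr 1
    push_cast
    field_simp
  calc _ = ((M (k + 3) : ℝ≥0∞)⁻¹) ^ 2 * ∫⁻ w in {w | (O 0 w).D = ω},
        (matchedTimes (fun i : Fin (k + 3) => O i w) (J (k + 3) w) 0 : ℝ≥0∞) ^ 2 ∂P := by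
        rw [← lintegral_const_mul' _ _ (by finiteness)]
        refine lintegral_congr fun w => ?_
        rw [div_eq_mul_inv, mul_pow, mul_comm]
    _ ≤ ((M (k + 3) : ℝ≥0∞)⁻¹) ^ 2 * (ENNReal.ofReal (1 + t) * (((k + 3 : ℕ) : ℝ≥0∞) ^ 2 *
          (ENNReal.ofReal (1 + t) * (ENNReal.ofReal ((M (k + 3) : ℝ) / k) ^ 2 * R) + C * Z k))
          + D) := by
        refine mul_le_mul_right (hN.trans ?_) _
        gcongr
        refine hI.trans ?_
        gcongr
        exact hk
    _ = ENNReal.ofReal (1 + t) * (ENNReal.ofReal (1 + t) *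
          ((X k ^ 2 * ENNReal.ofReal ((M (k + 3) : ℝ) / k) ^ 2) * R) + C * (X k ^ 2 * Z k)) +
          D * ((M (k + 3) : ℝ≥0∞)⁻¹) ^ 2 := by
        simp only [hX, div_eq_mul_inv]
        ring
    _ = _ := by rw [hXM]

end UpperLimit

/-! ### Near queries that are not matched -/

section Lower

open Metric Set

variable {d m : ℕ} {Ω : Type*} [MeasurableSpace Ω]
  {P : Measure Ω} [IsProbabilityMeasure P] {Q : Measure (Obs d)} [IsProbabilityMeasure Q]
  {O : ℕ → Ω → Obs d} {φhat : Estimator d m} {M : ℕ → ℕ}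
  {J : ∀ n : ℕ, Ω → Fin n → Finset (Fin n)}
  {φ : Bool → EuclideanSpace ℝ (Fin d) → EuclideanSpace ℝ (Fin m)} {ω : Bool}
  {f₀ f₁ : EuclideanSpace ℝ (Fin m) → ℝ} {c : ℝ} {B : Set (EuclideanSpace ℝ (Fin m))}

/-- Unit `j` is a query (a unit outside the group `ω`) whose value is near that of the first
unit. -/
def nearQuery (O : ℕ → Ω → Obs d)
    (φ : Bool → EuclideanSpace ℝ (Fin d) → EuclideanSpace ℝ (Fin m)) (ω : Bool)
    (f : EuclideanSpace ℝ (Fin m) → ℝ) (l ρ x y : ℝ) (j : ℕ) : Set Ω :=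
  {w | (O j w).D = (!ω) ∧
    (φ ω (O 0 w).X, φ ω (O j w).X) ∈ nearPairs volume f l ρ x y}

theorem IsMatchedSample.measurableSet_nearQuery (hS : IsMatchedSample P Q O φhat M J)
    (hφ : Measurable (φ ω)) (h : IsDominatedPair f₀ f₁ c B) (l ρ x y : ℝ) (j : ℕ) :
    MeasurableSet (nearQuery O φ ω f₁ l ρ x y j) := by
  have := h.isFiniteMeasure₁ volume
  have hU : Measurable fun o : Obs d => φ ω o.X := hφ.comp measurable_obs_X
  exact (hS.meas j (measurableSet_obs_D_eq _)).inter
    (((hU.comp (hS.meas 0)).prodMk (hU.comp (hS.meas j)))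
      (measurableSet_nearPairs volume h.meas₁ l ρ x y))

/-- The part of the mean of the number of near queries that a given unit contributes. -/
theorem IsMatchedSample.setLIntegral_nearQuery (hS : IsMatchedSample P Q O φhat M J)
    (hφ : Measurable (φ ω)) (h : IsDominatedPair f₀ f₁ c B)
    (hν₁ : (Q.restrict {o | o.D = ω}).map (fun o => φ ω o.X) = densityMeasure volume f₁)
    (hν₀ : (Q.restrict {o | o.D = !ω}).map (fun o => φ ω o.X) = densityMeasure volume f₀)
    (l ρ x y : ℝ) {j : ℕ} (hj : 0 ≠ j) {g : EuclideanSpace ℝ (Fin m) → ℝ≥0∞} (hg : Measurable g) :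
    ∫⁻ w in {w | (O 0 w).D = ω} ∩ nearQuery O φ ω f₁ l ρ x y j, g (φ ω (O 0 w).X) ∂P =
      ∫⁻ u, g u * densityMeasure volume f₀ (Prod.mk u ⁻¹' nearPairs volume f₁ l ρ x y)
        ∂(densityMeasure volume f₁) := by
  have i1 := h.isFiniteMeasure₁ volume
  have i0 := h.isFiniteMeasure₀ volume
  have hU : Measurable fun o : Obs d => φ ω o.X := hφ.comp measurable_obs_X
  have hnear := measurableSet_nearPairs volume h.meas₁ l ρ x y
  have hlaw : P.map (fun w => (O 0 w, O j w)) = Q.prod Q := by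
    rw [(hS.indep.indepFun hj).map_prod_eq_prod_map_map (hS.meas 0).aemeasurable
      (hS.meas j).aemeasurable, hS.law, hS.law]
  have hpair : MeasurePreserving (fun w => (O 0 w, O j w)) P (Q.prod Q) :=
    ⟨(hS.meas 0).prodMk (hS.meas j), hlaw⟩
  set F : EuclideanSpace ℝ (Fin m) × EuclideanSpace ℝ (Fin m) → ℝ≥0∞ := fun p =>
    (nearPairs volume f₁ l ρ x y).indicator (fun p => g p.1) p with hF
  have hFm : Measurable F := (hg.comp measurable_fst).indicator hnear
  have hGm : MeasurableSet ({o : Obs d | o.D = ω} ×ˢ {o : Obs d | o.D = !ω}) :=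
    (measurableSet_obs_D_eq ω).prod (measurableSet_obs_D_eq _)
  have hF2 : Measurable fun p : Obs d × Obs d => F (φ ω p.1.X, φ ω p.2.X) :=
    hFm.comp ((hU.comp measurable_fst).prodMk (hU.comp measurable_snd))
  calc _ = ∫⁻ w in (fun w => (O 0 w, O j w)) ⁻¹' ({o : Obs d | o.D = ω} ×ˢ {o : Obs d | o.D = !ω}),
        F (φ ω (O 0 w).X, φ ω (O j w).X) ∂P := by
        have hm1 : MeasurableSet ({w | (O 0 w).D = ω} ∩ nearQuery O φ ω f₁ l ρ x y j) :=
          (hS.meas 0 (measurableSet_obs_D_eq ω)).inter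
            (hS.measurableSet_nearQuery hφ h l ρ x y j)
        rw [← lintegral_indicator hm1, ← lintegral_indicator (hpair.measurable hGm)]
        refine lintegral_congr fun w => ?_
        by_cases h1 : (O 0 w).D = ω <;> by_cases h2 : (O j w).D = (!ω) <;>
          by_cases h3 : (φ ω (O 0 w).X, φ ω (O j w).X) ∈ nearPairs volume f₁ l ρ x y <;>
          simp [Set.indicator, nearQuery, hF, h1, h2, h3]
    _ = ∫⁻ p in {o : Obs d | o.D = ω} ×ˢ {o : Obs d | o.D = !ω}, F (φ ω p.1.X, φ ω p.2.X)
          ∂(Q.prod Q) := hpair.setLIntegral_comp_preimage hGm hF2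
    _ = ∫⁻ u, ∫⁻ v, F (u, v) ∂(densityMeasure volume f₀) ∂(densityMeasure volume f₁) := by
        rw [← Measure.prod_restrict, lintegral_prod _ hF2.aemeasurable, ← hν₁, ← hν₀,
          lintegral_map (f := fun u => ∫⁻ v, F (u, v) ∂((Q.restrict {o | o.D = !ω}).map
            fun o => φ ω o.X)) hFm.lintegral_prod_right' hU]
        refine lintegral_congr fun o => ?_
        rw [lintegral_map (f := fun v => F (φ ω o.X, v)) (hFm.comp measurable_prodMk_left) hU]
    _ = _ := by
        refine lintegral_congr fun u => ?_
        have : (fun v => F (u, v)) = (Prod.mk u ⁻¹' nearPairs volume f₁ l ρ x y).indicator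
            fun _ => g u := rfl
        rw [this, lintegral_indicator (measurable_prodMk_left hnear), lintegral_const,
          Measure.restrict_apply_univ]

/-- The squared volume of a ball of the mass radius is bounded below. -/
theorem IsDominatedPair.le_massRadius_pow (h : IsDominatedPair f₀ f₁ c B) (hm : 1 ≤ m)
    {x : ℝ} (hx : 0 < x) {u : EuclideanSpace ℝ (Fin m)} (hu : 0 < f₁ u) :
    ENNReal.ofReal (x / (c * volume.real (ball (0 : EuclideanSpace ℝ (Fin m)) 1))) ^ 2 ≤
      ENNReal.ofReal (massRadius volume f₁ x u) ^ (2 * m) := by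
  have : Nonempty (Fin m) := ⟨⟨0, hm⟩⟩
  have hV0 : 0 < volume.real (ball (0 : EuclideanSpace ℝ (Fin m)) 1) :=
    ENNReal.toReal_pos (measure_ball_pos _ _ one_pos).ne' measure_ball_lt_top.ne
  have h1 := massRadius_pow volume hx.le hu.le
  rw [finrank_euclideanSpace_fin] at h1
  rw [mul_comm 2 m, pow_mul, ← ENNReal.ofReal_pow (massRadius_nonneg volume hx.le hu.le), h1]
  gcongr
  exact h.le₁ u

/-- A near query that is not matched to the first unit, in the presence of another query: either
the estimator is not stable at the mass radius, or there are many units near the query. -/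
theorem IsMatchedSample.measure_near_notMem_le (hS : IsMatchedSample P Q O φhat M J) (hm : 1 ≤ m)
    (hφ : Measurable (φ ω)) (h : IsDominatedPair f₀ f₁ c B)
    (hν₁ : (Q.restrict {o | o.D = ω}).map (fun o => φ ω o.X) = densityMeasure volume f₁)
    (hν₀ : (Q.restrict {o | o.D = !ω}).map (fun o => φ ω o.X) = densityMeasure volume f₀)
    {ε ρ : ℝ} (hε : 0 < ε) (hρ : 0 < ρ) (hρε : (1 + ε) * ρ ≤ 1 - ε) {k : ℕ}
    {ζ : (Fin (k + 1) → Obs d) → ℝ≥0∞} (hζ : Measurable ζ)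
    (hst : ∀ (s : Fin (k + 1) → Obs d) (δ : ℝ), 0 < δ →
      ζ s ≤ ENNReal.ofReal δ ^ (2 * m) → IsStableAt Q φ φhat ω ε δ s)
    (hc : 0 < c) {l x y : ℝ} (hl : 0 < l) (hx : 0 < x) {β : ℝ≥0∞}
    (hβ : ∀ (A : Set (Obs d)) [DecidablePred (· ∈ A)], MeasurableSet A → Q A ≤ ENNReal.ofReal y →
      sampleLaw Q (k + 1) {s | M (k + 3) ≤ (Finset.univ.filter fun i => s i ∈ A).card} ≤ β)
    {j j' : Fin (k + 3)} (hj : 0 ≠ j) (hj' : 0 ≠ j') (hjj' : j ≠ j') :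
    P (({w | (O 0 w).D = ω} ∩ nearQuery O φ ω f₁ l ρ x y j ∩ {w | 0 ∉ J (k + 3) w j}) ∩
        {w | (O j' w).D = !ω}) ≤
      ENNReal.ofReal (c / l * x) * ((∫⁻ s, ζ s ∂(sampleLaw Q (k + 1))) /
        ENNReal.ofReal (x / (c * volume.real (ball (0 : EuclideanSpace ℝ (Fin m)) 1))) ^ 2 + β) := by
  classical
  have : Nonempty (Fin m) := ⟨⟨0, hm⟩⟩
  have i1 := h.isFiniteMeasure₁ volume
  have hU : Measurable fun o : Obs d => φ ω o.X := hφ.comp measurable_obs_X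
  have hnear := measurableSet_nearPairs volume h.meas₁ l ρ x y
  have hV0 : 0 < volume.real (ball (0 : EuclideanSpace ℝ (Fin m)) 1) :=
    ENNReal.toReal_pos (measure_ball_pos _ _ one_pos).ne' measure_ball_lt_top.ne
  set A0 := ENNReal.ofReal (x / (c * volume.real (ball (0 : EuclideanSpace ℝ (Fin m)) 1))) ^ 2
    with hA0
  have hA00 : A0 ≠ 0 := by
    have : 0 < x / (c * volume.real (ball (0 : EuclideanSpace ℝ (Fin m)) 1)) := by positivity
    simpa [hA0] using this
  have hA0t : A0 ≠ ∞ := by finiteness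
  have hnearQ : ∀ u, Q {o | o.D = (!ω) ∧ (u, φ ω o.X) ∈ nearPairs volume f₁ l ρ x y} ≤
      ENNReal.ofReal (c / l * x) := by
    intro u
    refine le_trans (le_of_eq ?_) (h.measure_nearPairs_le volume hl (ρ := ρ) (y := y) hx.le u)
    rw [← hν₀, Measure.map_apply hU (measurable_prodMk_left hnear),
      Measure.restrict_apply (hU (measurable_prodMk_left hnear))]
    congr 1
    ext o
    exact and_comm
  have hnearm : MeasurableSet {p : Obs d × Obs d | p.1.D = (!ω) ∧ p.2.D = ω ∧
      (φ ω p.2.X, φ ω p.1.X) ∈ nearPairs volume f₁ l ρ x y} :=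
    (measurable_fst (measurableSet_obs_D_eq _)).inter
      ((measurable_snd (measurableSet_obs_D_eq _)).inter
        (((hU.comp measurable_snd).prodMk (hU.comp measurable_fst)) hnear))
  obtain ⟨e, he0, he1, he2⟩ := exists_perm_three hj hj' hjj'
  have h20 : e (Fin.succ (Fin.succ (0 : Fin (k + 1)))) = 0 := he2
  -- The order `e'` puts the query and the first unit in front, and the second query into the sample,
  -- which is then independent of the ball about the near query.
  set e' : Equiv.Perm (Fin (k + 3)) := e * Equiv.swap 1 2 with he'
  have he'0 : e' 0 = j := by
    rw [he', Equiv.Perm.mul_apply, Equiv.swap_apply_of_ne_of_ne, he0]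
    · simp
    · exact (Fin.succ_ne_zero (Fin.succ (0 : Fin (k + 1)))).symm
  have he'1 : e' 1 = 0 := by
    rw [he', Equiv.Perm.mul_apply, Equiv.swap_apply_left, he2]
  have he's : ∀ t : Fin k, e' t.succ.succ.succ = e t.succ.succ.succ := by
    intro t
    rw [he', Equiv.Perm.mul_apply, Equiv.swap_apply_of_ne_of_ne]
    · exact (Fin.succ_injective (k + 2)).ne (Fin.succ_ne_zero t.succ)
    · exact (Fin.succ_injective (k + 2)).ne ((Fin.succ_injective (k + 1)).ne (Fin.succ_ne_zero t))
  have hrel : ∀ e : Equiv.Perm (Fin (k + 3)), MeasurePreserving (fun w =>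
      ((O (e 0) w, O (e 1) w), fun i : Fin (k + 1) => O (e i.succ.succ) w)) P
        ((Q.prod Q).prod (sampleLaw Q (k + 1))) := fun e =>
    ⟨((hS.meas _).prodMk (hS.meas _)).prodMk (measurable_pi_lambda _ fun i => hS.meas _),
      map_relabel_eq hS.meas hS.law hS.indep e⟩
  -- The estimator is not stable at the mass radius.
  set T1 : Set ((Obs d × Obs d) × (Fin (k + 1) → Obs d)) :=
    {q | (q.1.1.D = (!ω) ∧ (φ ω (q.2 0).X, φ ω q.1.1.X) ∈ nearPairs volume f₁ l ρ x y) ∧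
      A0 ≤ ζ q.2} with hT1
  have hr0 : Measurable fun r : Fin (k + 1) → Obs d => r 0 := measurable_pi_apply 0
  have hT1m : MeasurableSet T1 :=
    ((measurable_fst.comp measurable_fst (measurableSet_obs_D_eq _)).inter
      (((hU.comp (hr0.comp measurable_snd)).prodMk
        (hU.comp (measurable_fst.comp measurable_fst))) hnear)).inter
      (measurableSet_le measurable_const (hζ.comp measurable_snd))
  -- There are many units near the query.
  set T2 : Set ((Obs d × Obs d) × (Fin (k + 1) → Obs d)) :=
    {q | (q.1.1.D = (!ω) ∧ q.1.2.D = ω ∧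
      (φ ω q.1.2.X, φ ω q.1.1.X) ∈ nearPairs volume f₁ l ρ x y) ∧
      M (k + 3) ≤ (Finset.univ.filter fun i => q.2 i ∈ {o : Obs d | o.D = ω} ∩
        (fun o => φ ω o.X) ⁻¹' closedBall (φ ω q.1.1.X)
          (massRadius volume f₁ x (φ ω q.1.2.X) / ρ)).card} with hT2
  have hT2m : MeasurableSet T2 := by
    have hcount : Measurable fun q : (Obs d × Obs d) × (Fin (k + 1) → Obs d) =>
        (Finset.univ.filter fun i => q.2 i ∈ {o : Obs d | o.D = ω} ∩
          (fun o => φ ω o.X) ⁻¹' closedBall (φ ω q.1.1.X)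
            (massRadius volume f₁ x (φ ω q.1.2.X) / ρ)).card := by
      simp_rw [Finset.card_filter]
      refine Finset.measurable_sum _ fun i _ => Measurable.ite ?_ measurable_const measurable_const
      have h1 : Measurable fun q : (Obs d × Obs d) × (Fin (k + 1) → Obs d) => q.2 i :=
        (measurable_pi_apply i).comp measurable_snd
      refine (h1 (measurableSet_obs_D_eq ω)).inter ?_
      exact measurableSet_le ((hU.comp h1).dist (hU.comp (measurable_fst.comp measurable_fst)))
        (((measurable_massRadius volume h.meas₁ x).comp
          (hU.comp (measurable_snd.comp measurable_fst))).div_const ρ)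
    exact (measurable_fst hnearm).inter (measurableSet_le measurable_const hcount)
  have hsub : ∀ᵐ w ∂P, w ∈ ({w | (O 0 w).D = ω} ∩ nearQuery O φ ω f₁ l ρ x y j ∩
      {w | 0 ∉ J (k + 3) w j}) ∩ {w | (O j' w).D = !ω} →
      w ∈ (fun w => ((O (e 0) w, O (e 1) w), fun i : Fin (k + 1) => O (e i.succ.succ) w)) ⁻¹' T1 ∪
        (fun w => ((O (e' 0) w, O (e' 1) w), fun i : Fin (k + 1) => O (e' i.succ.succ) w)) ⁻¹' T2
      := by
    filter_upwards [hS.ae_inSupport (k + 3)] with w hw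
    rintro ⟨⟨⟨hw0, hwj, hwnear⟩, hwJ⟩, hwj'⟩
    have hw0 : (O 0 w).D = ω := hw0
    have hwj' : (O j' w).D = !ω := hwj'
    have hwJ : (0 : Fin (k + 3)) ∉ J (k + 3) w j := hwJ
    have hf1 : 0 < f₁ (φ ω (O 0 w).X) := hl.trans_le hwnear.1
    by_cases hz : A0 ≤ ζ fun i : Fin (k + 1) => O (e i.succ.succ) w
    · left
      refine ⟨⟨?_, ?_⟩, hz⟩
      · change (O (e 0) w).D = _
        rw [he0]; exact hwj
      · change (φ ω (O (e (Fin.succ (Fin.succ (0 : Fin (k + 1))))) w).X, φ ω (O (e 0) w).X) ∈ _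
        rw [h20, he0]; exact hwnear
    · right
      rw [not_le] at hz
      refine ⟨⟨?_, ?_, ?_⟩, ?_⟩
      · change (O (e' 0) w).D = _
        rw [he'0]; exact hwj
      · change (O (e' 1) w).D = _
        rw [he'1]; exact hw0
      · change (φ ω (O (e' 1) w).X, φ ω (O (e' 0) w).X) ∈ _
        rw [he'0, he'1]; exact hwnear
      · have hr := massRadius_pos volume hx hf1
        have key := le_card_of_notMem (s := fun k : Fin (k + 3) => O k w) (e := e) hε hρ hρε hw
          (by rw [he0]; exact hwj) (by rw [he1]; exact hwj') (by rw [he2]; exact hw0) hwj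
          (hS.isMatchSet (k + 3) w j) (by rw [he2]; exact hwJ) hr
          (by rw [he2]; exact hwnear.2.1) fun δ hδ => hst _ _ (hr.trans_le hδ) <|
            hz.le.trans ((h.le_massRadius_pow hm hx hf1).trans (by gcongr))
        refine key.trans ?_
        simp only [he'0, he'1]
        rw [← Finset.card_image_of_injective _ (Fin.succ_injective k)]
        refine Finset.card_le_card fun i hi => ?_
        obtain ⟨t, ht, rfl⟩ := Finset.mem_image.1 hi
        refine Finset.mem_filter.2 ⟨Finset.mem_univ _, ?_⟩
        have ht2 := (Finset.mem_filter.1 ht).2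
        rw [he's]
        exact ht2
  refine (measure_mono_ae (t := (fun w => ((O (e 0) w, O (e 1) w),
      fun i : Fin (k + 1) => O (e i.succ.succ) w)) ⁻¹' T1 ∪ (fun w => ((O (e' 0) w, O (e' 1) w),
        fun i : Fin (k + 1) => O (e' i.succ.succ) w)) ⁻¹' T2) hsub).trans ?_
  refine (measure_union_le _ _).trans ?_
  rw [mul_add, (hrel e).measure_preimage hT1m.nullMeasurableSet,
    (hrel e').measure_preimage hT2m.nullMeasurableSet]
  refine add_le_add ?_ ?_
  · rw [Measure.prod_apply_symm hT1m]
    calc _ ≤ ∫⁻ r, {r | A0 ≤ ζ r}.indicator (fun _ => ENNReal.ofReal (c / l * x)) r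
          ∂(sampleLaw Q (k + 1)) := by
          refine lintegral_mono fun r => ?_
          by_cases hr : A0 ≤ ζ r
          · rw [Set.indicator_of_mem (s := {r | A0 ≤ ζ r}) hr]
            calc _ ≤ (Q.prod Q) ({o | o.D = (!ω) ∧ (φ ω (r 0).X, φ ω o.X) ∈
                  nearPairs volume f₁ l ρ x y} ×ˢ univ) :=
                  measure_mono fun p hp => ⟨hp.1, mem_univ _⟩
              _ ≤ _ := by
                  rw [Measure.prod_prod, measure_univ, mul_one]
                  exact hnearQ _
          · refine le_trans (le_of_eq ?_) zero_le
            convert measure_empty (μ := Q.prod Q)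
            exact Set.eq_empty_of_forall_notMem fun p hp => hr hp.2
      _ = ENNReal.ofReal (c / l * x) * sampleLaw Q (k + 1) {r | A0 ≤ ζ r} := by
          rw [lintegral_indicator (measurableSet_le measurable_const hζ), lintegral_const,
            Measure.restrict_apply_univ]
      _ ≤ _ := by
          gcongr
          exact meas_ge_le_lintegral_div hζ.aemeasurable hA00 hA0t
  · rw [Measure.prod_apply hT2m]
    calc _ ≤ ∫⁻ p, {p : Obs d × Obs d | p.1.D = (!ω) ∧ p.2.D = ω ∧
          (φ ω p.2.X, φ ω p.1.X) ∈ nearPairs volume f₁ l ρ x y}.indicator (fun _ => β) p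
            ∂(Q.prod Q) := by
          refine lintegral_mono fun p => ?_
          by_cases hp : p ∈ {p : Obs d × Obs d | p.1.D = (!ω) ∧ p.2.D = ω ∧
            (φ ω p.2.X, φ ω p.1.X) ∈ nearPairs volume f₁ l ρ x y}
          · rw [Set.indicator_of_mem hp]
            set A : Set (Obs d) := {o : Obs d | o.D = ω} ∩ (fun o => φ ω o.X) ⁻¹'
              closedBall (φ ω p.1.X) (massRadius volume f₁ x (φ ω p.2.X) / ρ) with hA
            refine (measure_mono fun r hr => hr.2).trans (hβ A ?_ ?_)
            · exact (measurableSet_obs_D_eq ω).inter (hU isClosed_closedBall.measurableSet)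
            · refine le_trans (le_of_eq ?_) hp.2.2.2.2
              rw [← hν₁, Measure.map_apply hU isClosed_closedBall.measurableSet,
                Measure.restrict_apply (hU isClosed_closedBall.measurableSet), hA, Set.inter_comm]
          · refine le_trans (le_of_eq ?_) zero_le
            convert measure_empty (μ := sampleLaw Q (k + 1))
            exact Set.eq_empty_of_forall_notMem fun r hr => hp hr.1
      _ = β * (Q.prod Q) {p : Obs d × Obs d | p.1.D = (!ω) ∧ p.2.D = ω ∧
          (φ ω p.2.X, φ ω p.1.X) ∈ nearPairs volume f₁ l ρ x y} := by
          rw [lintegral_indicator hnearm, lintegral_const, Measure.restrict_apply_univ]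
      _ ≤ β * ENNReal.ofReal (c / l * x) := by
          gcongr
          rw [Measure.prod_apply_symm hnearm]
          calc _ ≤ ∫⁻ _o : Obs d, ENNReal.ofReal (c / l * x) ∂Q := by
                refine lintegral_mono fun o => ?_
                refine le_trans (measure_mono ?_) (hnearQ (φ ω o.X))
                exact fun p hp => ⟨hp.1, hp.2.2⟩
            _ = _ := by simp
      _ = _ := mul_comm _ _

end Lower

/-! ### Counting the near queries -/

section LowerLimit

open Metric Set

/-- Events that rarely occur together with one of many others are rare. -/
theorem sum_measure_le_of_inter_le {Ω ι : Type*} [MeasurableSpace Ω] {P : Measure Ω} [Fintype ι]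
    [DecidableEq ι] {b q : ι → Set Ω} (hb : ∀ j, MeasurableSet (b j))
    (hq : ∀ j, MeasurableSet (q j)) (hbq : ∀ j, b j ⊆ q j) {R : ℕ} (hR : 1 ≤ R) {β : ℝ≥0∞}
    (hβ : ∀ j j', j ≠ j' → P (b j ∩ q j') ≤ β) [∀ w, DecidablePred fun j => w ∈ q j] :
    ∑ j, P (b j) ≤ Fintype.card ι * P {w | (Finset.univ.filter fun j => w ∈ q j).card < R + 1} +
      (R : ℝ≥0∞)⁻¹ * ((Fintype.card ι : ℝ≥0∞) ^ 2 * β) := by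
  set E := {w | (Finset.univ.filter fun j => w ∈ q j).card < R + 1} with hE
  have hR0 : (R : ℝ≥0∞) ≠ 0 := by
    have : R ≠ 0 := by omega
    exact_mod_cast this
  have key : ∀ j, P (b j) ≤ P E + (R : ℝ≥0∞)⁻¹ * (Fintype.card ι * β) := by
    intro j
    refine (measure_le_inter_add_sdiff P (b j) E).trans
      (add_le_add (measure_mono inter_subset_right) ?_)
    rw [← ENNReal.mul_le_iff_le_inv hR0 (by simp)]
    calc (R : ℝ≥0∞) * P (b j \ E)
        ≤ R * P {w | (R : ℝ≥0∞) ≤ ∑ j' ∈ Finset.univ.erase j, (b j ∩ q j').indicator 1 w} := by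
          gcongr
          rintro w ⟨hwb, hwE⟩
          simp only [hE, mem_ofPred_eq, not_lt] at hwE ⊢
          have hmem : j ∈ Finset.univ.filter fun j => w ∈ q j :=
            Finset.mem_filter.2 ⟨Finset.mem_univ _, hbq j hwb⟩
          have hcard := Finset.card_erase_of_mem hmem
          have h1 : R ≤ ((Finset.univ.filter fun j => w ∈ q j).erase j).card := by omega
          calc (R : ℝ≥0∞) ≤ ((Finset.univ.filter fun j => w ∈ q j).erase j).card := by
                exact_mod_cast h1
            _ = ∑ j' ∈ (Finset.univ.filter fun j => w ∈ q j).erase j,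
                  (b j ∩ q j').indicator 1 w := by
                rw [Finset.card_eq_sum_ones, Nat.cast_sum]
                refine Finset.sum_congr rfl fun j' hj' => ?_
                have : w ∈ b j ∩ q j' :=
                  ⟨hwb, (Finset.mem_filter.1 (Finset.mem_of_mem_erase hj')).2⟩
                rw [Set.indicator_of_mem this]
                simp
            _ ≤ _ := Finset.sum_le_sum_of_subset
                (Finset.erase_subset_erase j (Finset.filter_subset _ _))
      _ ≤ ∫⁻ w, ∑ j' ∈ Finset.univ.erase j, (b j ∩ q j').indicator 1 w ∂P :=
          mul_meas_ge_le_lintegral (Finset.measurable_sum _ fun j' _ =>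
            measurable_one.indicator ((hb j).inter (hq j'))) _
      _ = ∑ j' ∈ Finset.univ.erase j, P (b j ∩ q j') := by
          rw [lintegral_finsetSum _ fun j' _ => measurable_one.indicator ((hb j).inter (hq j'))]
          exact Finset.sum_congr rfl fun j' _ => lintegral_indicator_one ((hb j).inter (hq j'))
      _ ≤ ∑ _j' ∈ Finset.univ.erase j, β :=
          Finset.sum_le_sum fun j' hj' => hβ j j' (Finset.ne_of_mem_erase hj').symm
      _ ≤ ∑ _j' : ι, β := Finset.sum_le_sum_of_subset (Finset.erase_subset _ _)
      _ = _ := by rw [Finset.sum_const, Finset.card_univ, nsmul_eq_mul]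
  calc _ ≤ ∑ _j : ι, (P E + (R : ℝ≥0∞)⁻¹ * (Fintype.card ι * β)) :=
        Finset.sum_le_sum fun j _ => key j
    _ = _ := by
        rw [Finset.sum_const, Finset.card_univ, nsmul_eq_mul]
        ring

variable {d m : ℕ} {Ω : Type*} [MeasurableSpace Ω]
  {P : Measure Ω} [IsProbabilityMeasure P] {Q : Measure (Obs d)} [IsProbabilityMeasure Q]
  {O : ℕ → Ω → Obs d} {φhat : Estimator d m} {M : ℕ → ℕ}
  {J : ∀ n : ℕ, Ω → Fin n → Finset (Fin n)}
  {φ : Bool → EuclideanSpace ℝ (Fin d) → EuclideanSpace ℝ (Fin m)} {ω : Bool}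
  {f₀ f₁ : EuclideanSpace ℝ (Fin m) → ℝ} {c : ℝ} {B : Set (EuclideanSpace ℝ (Fin m))}

theorem IsDominatedPair.ratio_le (h : IsDominatedPair f₀ f₁ c B) (u : EuclideanSpace ℝ (Fin m)) :
    f₀ u / f₁ u ≤ c := by
  rcases (h.nonneg₁ u).eq_or_lt with h0 | h0
  · rw [← h0, div_zero]
    exact h.const_nonneg
  · rw [div_le_iff₀ h0]
    exact h.le_mul u

/-- Every near query is matched to the first unit or fails to be. -/
theorem IsMatchedSample.mul_lintegral_nearPairs_le (hS : IsMatchedSample P Q O φhat M J)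
    (hφ : Measurable (φ ω)) (h : IsDominatedPair f₀ f₁ c B)
    (hν₁ : (Q.restrict {o | o.D = ω}).map (fun o => φ ω o.X) = densityMeasure volume f₁)
    (hν₀ : (Q.restrict {o | o.D = !ω}).map (fun o => φ ω o.X) = densityMeasure volume f₀)
    (l ρ x y : ℝ) (k : ℕ) :
    ((k + 2 : ℕ) : ℝ≥0∞) * ∫⁻ u, ENNReal.ofReal (f₀ u / f₁ u) *
        densityMeasure volume f₀ (Prod.mk u ⁻¹' nearPairs volume f₁ l ρ x y)
          ∂(densityMeasure volume f₁) ≤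
      ∫⁻ w in {w | (O 0 w).D = ω},
        (matchedTimes (fun i : Fin (k + 3) => O i w) (J (k + 3) w) 0 : ℝ≥0∞) *
          ENNReal.ofReal (f₀ (φ ω (O 0 w).X) / f₁ (φ ω (O 0 w).X)) ∂P +
        ENNReal.ofReal c * ∑ j : Fin (k + 3), P ({w | (O 0 w).D = ω} ∩
          nearQuery O φ ω f₁ l ρ x y j ∩ {w | 0 ∉ J (k + 3) w j}) := by
  classical
  have hU : Measurable fun o : Obs d => φ ω o.X := hφ.comp measurable_obs_X
  have hm0 := h.meas₀
  have hm1 := h.meas₁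
  set t : EuclideanSpace ℝ (Fin m) → ℝ≥0∞ := fun u => ENNReal.ofReal (f₀ u / f₁ u) with ht
  have htm : Measurable t := by fun_prop
  have htc : ∀ u, t u ≤ ENNReal.ofReal c := fun u => ENNReal.ofReal_le_ofReal (h.ratio_le u)
  set G : Set Ω := {w | (O 0 w).D = ω} with hG
  have hGm : MeasurableSet G := hS.meas 0 (measurableSet_obs_D_eq ω)
  set W : ℕ → Set Ω := nearQuery O φ ω f₁ l ρ x y with hW
  have hWm : ∀ j, MeasurableSet (W j) := hS.measurableSet_nearQuery hφ h l ρ x y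
  set F : Fin (k + 3) → Set Ω := fun j => G ∩ W j ∩ {w | 0 ∉ J (k + 3) w j} with hF
  have hFm : ∀ j, MeasurableSet (F j) := fun j =>
    (hGm.inter (hWm j)).inter (hS.measSet _ j 0).compl
  have htU : Measurable fun w => t (φ ω (O 0 w).X) := htm.comp (hU.comp (hS.meas 0))
  calc _ = ∑ j ∈ (Finset.univ : Finset (Fin (k + 3))).erase 0,
        ∫⁻ w in G ∩ W j, t (φ ω (O 0 w).X) ∂P := by
        have hj : ∀ j ∈ (Finset.univ : Finset (Fin (k + 3))).erase 0,
            ∫⁻ w in G ∩ W j, t (φ ω (O 0 w).X) ∂P = ∫⁻ u, t u * densityMeasure volume f₀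
              (Prod.mk u ⁻¹' nearPairs volume f₁ l ρ x y) ∂(densityMeasure volume f₁) :=
          fun j hj => hS.setLIntegral_nearQuery hφ h hν₁ hν₀ l ρ x y
            (fun h0 => Finset.ne_of_mem_erase hj (Fin.ext h0.symm)) htm
        rw [Finset.sum_congr rfl hj, Finset.sum_const, Finset.card_erase_of_mem (Finset.mem_univ _), Finset.card_univ,
          Fintype.card_fin, nsmul_eq_mul]
        rfl
    _ ≤ ∑ j : Fin (k + 3), ∫⁻ w in G ∩ W j, t (φ ω (O 0 w).X) ∂P :=
        Finset.sum_le_sum_of_subset (Finset.erase_subset _ _)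
    _ = ∫⁻ w in G, ∑ j : Fin (k + 3), (W j).indicator (fun w => t (φ ω (O 0 w).X)) w ∂P := by
        rw [lintegral_finsetSum _ fun (j : Fin (k + 3)) _ => htU.indicator (hWm j)]
        refine Finset.sum_congr rfl fun j _ => ?_
        rw [lintegral_indicator (hWm j), Measure.restrict_restrict (hWm j), Set.inter_comm]
    _ ≤ ∫⁻ w in G, ((matchedTimes (fun i : Fin (k + 3) => O i w) (J (k + 3) w) 0 : ℝ≥0∞) *
          t (φ ω (O 0 w).X) + ∑ j, (F j).indicator (fun _ => ENNReal.ofReal c) w) ∂P := by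
        refine setLIntegral_mono' hGm fun w hw => ?_
        have h0 : (O 0 w).D = ω := hw
        have hK : (matchedTimes (fun i : Fin (k + 3) => O i w) (J (k + 3) w) 0 : ℝ≥0∞) =
            ∑ j : Fin (k + 3), if (O j w).D = (!ω) ∧ 0 ∈ J (k + 3) w j then 1 else 0 := by
          unfold matchedTimes
          rw [Finset.card_filter, Nat.cast_sum]
          refine Finset.sum_congr rfl fun j _ => ?_
          rw [← h0]
          push_cast
          rfl
        rw [hK, Finset.sum_mul, ← Finset.sum_add_distrib]
        refine Finset.sum_le_sum fun j _ => ?_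
        by_cases hWj : w ∈ W j
        · rw [Set.indicator_of_mem hWj]
          by_cases hJ : 0 ∈ J (k + 3) w j
          · rw [if_pos ⟨hWj.1, hJ⟩, one_mul]
            exact le_self_add
          · have : w ∈ F j := ⟨⟨hw, hWj⟩, hJ⟩
            rw [Set.indicator_of_mem this]
            exact (htc _).trans le_add_self
        · rw [Set.indicator_of_notMem hWj]
          exact zero_le
    _ = _ := by
        rw [lintegral_add_right _ (Finset.measurable_sum _ fun j _ =>
          measurable_const.indicator (hFm j)), lintegral_finsetSum _ fun j _ =>
          measurable_const.indicator (hFm j), Finset.mul_sum]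
        congr 1
        refine Finset.sum_congr rfl fun j _ => ?_
        rw [lintegral_indicator (hFm j), lintegral_const, Measure.restrict_apply_univ,
          Measure.restrict_apply (hFm j)]
        congr 2
        exact Set.inter_eq_left.2 fun w hw => hw.1.1

/-- With overwhelming probability more than `R n` of `n` units are queries, where `R n` is at least a
positive fraction of `n`. -/
theorem IsMatchedSample.exists_measure_card_lt_le (hS : IsMatchedSample P Q O φhat M J) (ω : Bool)
    (hq : 0 < Q.real {o | o.D = !ω}) : ∃ (R : ℕ → ℕ) (p : ℝ), 0 < p ∧
      (∀ᶠ n : ℕ in atTop, 1 ≤ R n ∧ (n : ℝ) ≤ p * R n) ∧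
      Tendsto (fun n : ℕ => (n : ℝ≥0∞) *
        P {w | (Finset.univ.filter fun j : Fin n => w ∈ {w | (O j w).D = !ω}).card < R n + 1})
          atTop (𝓝 0) := by
  set q := Q.real {o : Obs d | o.D = !ω} with hqdef
  obtain ⟨b, hb, H⟩ := measure_pi_card_lt_le Q one_pos
  have hA : MeasurableSet {o : Obs d | o.D = !ω} := measurableSet_obs_D_eq _
  refine ⟨fun n => ⌊q / 8 * n⌋₊, 16 / q, by positivity, ?_, ?_⟩
  · have hlarge : ∀ᶠ n : ℕ in atTop, 16 / q ≤ (n : ℝ) :=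
      tendsto_natCast_atTop_atTop.eventually_ge_atTop _
    filter_upwards [hlarge] with n hn
    rw [div_le_iff₀ hq] at hn
    have h1 := Nat.lt_floor_add_one (q / 8 * n)
    refine ⟨Nat.le_floor (by push_cast; linarith), ?_⟩
    rw [div_mul_eq_mul_div, le_div_iff₀ hq]
    nlinarith
  · have hlim : Tendsto (fun n : ℕ => ENNReal.ofReal (n * Real.exp (1 - b * q / 4 * n))) atTop
        (𝓝 0) := by
      have h1 : Tendsto (fun n : ℕ => b * q / 4 * (n : ℝ)) atTop atTop :=
        tendsto_natCast_atTop_atTop.const_mul_atTop (by positivity)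
      have h2 := ((Real.tendsto_pow_mul_exp_neg_atTop_nhds_zero 1).comp h1).const_mul
        (Real.exp 1 * (4 / (b * q)))
      rw [mul_zero] at h2
      have h3 := ENNReal.tendsto_ofReal h2
      rw [ENNReal.ofReal_zero] at h3
      refine h3.congr fun n => ?_
      congr 1
      rw [sub_eq_add_neg, Real.exp_add, Function.comp_apply]
      field_simp
    refine tendsto_of_tendsto_of_tendsto_of_le_of_le' tendsto_const_nhds hlim
      (Eventually.of_forall fun n => zero_le) ?_
    have hlarge : ∀ᶠ n : ℕ in atTop, 16 / q ≤ (n : ℝ) :=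
      tendsto_natCast_atTop_atTop.eventually_ge_atTop _
    filter_upwards [hlarge] with n hn
    rw [div_le_iff₀ hq] at hn
    set R := ⌊q / 8 * n⌋₊ with hR
    have hR1 : (R : ℝ) ≤ q / 8 * n := Nat.floor_le (by positivity)
    have hR2 : q / 8 * n < R + 1 := Nat.lt_floor_add_one _
    have hpi : MeasurePreserving (fun w (i : Fin n) => O i w) P (sampleLaw Q n) := by
      refine ⟨measurable_pi_lambda _ fun i => hS.meas _, ?_⟩
      have := (hS.indep.precomp Fin.val_injective).map_fun_eq_pi_map
        fun k : Fin n => (hS.meas _).aemeasurable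
      simp only [hS.law] at this
      exact this
    have hmE : MeasurableSet {s : Fin n → Obs d |
        (Finset.univ.filter fun i => s i ∈ {o : Obs d | o.D = !ω}).card < R + 1} := by
      have : Measurable fun s : Fin n → Obs d =>
          (Finset.univ.filter fun i => s i ∈ {o : Obs d | o.D = !ω}).card := by
        simp_rw [Finset.card_filter]
        exact Finset.measurable_sum _ fun i _ => Measurable.ite (measurable_pi_apply i hA)
          measurable_const measurable_const
      exact measurableSet_lt this measurable_const
    have h1 := H {o : Obs d | o.D = !ω} hA n (R + 1) (by omega) (by
      rw [← hqdef]; push_cast; nlinarith)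
    have h2 := hpi.measure_preimage hmE.nullMeasurableSet
    calc _ = (n : ℝ≥0∞) * sampleLaw Q n {s : Fin n → Obs d |
          (Finset.univ.filter fun i => s i ∈ {o : Obs d | o.D = !ω}).card < R + 1} := by
          rw [← h2]; rfl
      _ ≤ ENNReal.ofReal n * ENNReal.ofReal (Real.exp (1 - b * q / 4 * n)) := by
          rw [ENNReal.ofReal_natCast]
          gcongr
          refine h1.trans ?_
          rw [← ENNReal.ofReal_pow (by positivity), ← Real.exp_add, ← Real.exp_nat_mul]
          refine ENNReal.ofReal_le_ofReal (Real.exp_le_exp.2 ?_)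
          rw [← hqdef]
          have h3 : 0 ≤ 1 / (1 + 1) / 2 * ((n : ℝ) * q / ((R + 1 : ℕ) : ℝ)) := by positivity
          push_cast at h3 ⊢
          nlinarith
      _ = _ := by rw [← ENNReal.ofReal_mul (by positivity)]

end LowerLimit

/-! ### Lower limit of the mixed moment -/

section LowerLimitSecond

open Metric Set

variable {d m : ℕ} {Ω : Type*} [MeasurableSpace Ω]
  {P : Measure Ω} [IsProbabilityMeasure P] {Q : Measure (Obs d)} [IsProbabilityMeasure Q]
  {O : ℕ → Ω → Obs d} {φhat : Estimator d m} {M : ℕ → ℕ}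
  {J : ∀ n : ℕ, Ω → Fin n → Finset (Fin n)}
  {φ : Bool → EuclideanSpace ℝ (Fin d) → EuclideanSpace ℝ (Fin m)} {ω : Bool}
  {f₀ f₁ : EuclideanSpace ℝ (Fin m) → ℝ} {c : ℝ} {B : Set (EuclideanSpace ℝ (Fin m))}

theorem exists_parameter_le (m : ℕ) {S ε : ℝ≥0∞} (hS : S ≠ ∞) (hε : ε ≠ 0) :
    ∃ t : ℝ, 0 < t ∧ t < 1 / 4 ∧
      ENNReal.ofReal (1 - (1 - t) ^ 2 * (1 - 2 * t) ^ m) * S ≤ ε := by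
  have hlim : Tendsto (fun t : ℝ => ENNReal.ofReal (1 - (1 - t) ^ 2 * (1 - 2 * t) ^ m) * S)
      (𝓝 0) (𝓝 0) := by
    have h1 : ContinuousAt (fun t : ℝ => 1 - (1 - t) ^ 2 * (1 - 2 * t) ^ m) 0 := by fun_prop
    have h2 := ENNReal.Tendsto.mul_const (b := S) (ENNReal.tendsto_ofReal h1.tendsto) (Or.inr hS)
    simpa using h2
  have hle := (hlim.eventually (ge_mem_nhds (pos_iff_ne_zero.2 hε))).filter_mono
    (nhdsWithin_le_nhds (s := Ioi 0))
  obtain ⟨t, ht, ht0, ht1⟩ := (hle.and (Ioo_mem_nhdsGT (by norm_num : (0 : ℝ) < 1 / 4))).exists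
  exact ⟨t, ht0, ht1, ht⟩

/-- The expected number of near queries that are not matched to the first unit is of smaller order
than the number of matches. -/
theorem IsMatchedSample.tendsto_sum_measure_near_notMem (hS : IsMatchedSample P Q O φhat M J)
    (hm : 1 ≤ m) (hφ : Measurable (φ ω)) (h : IsDominatedPair f₀ f₁ c B)
    (hν₁ : (Q.restrict {o | o.D = ω}).map (fun o => φ ω o.X) = densityMeasure volume f₁)
    (hν₀ : (Q.restrict {o | o.D = !ω}).map (fun o => φ ω o.X) = densityMeasure volume f₀)
    (hM : Tendsto M atTop atTop) (hq : 0 < Q.real {o | o.D = !ω})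
    {ε ρ : ℝ} (hε : 0 < ε) (hε1 : ε < 1) (hρ : 0 < ρ) (hρε : (1 + ε) * ρ ≤ 1 - ε)
    (hsc : HasStableScale Q φ φhat M ω ε) (hc : 0 < c) {l a : ℝ} (hl : 0 < l) (ha : 0 < a) :
    Tendsto (fun k : ℕ => (M (k + 3) : ℝ≥0∞)⁻¹ * ∑ j : Fin (k + 3), P ({w | (O 0 w).D = ω} ∩
      nearQuery O φ ω f₁ l ρ (a * (M (k + 3) / (k + 3 : ℕ))) ((1 - ε) * (M (k + 3) / (k + 3 : ℕ))) j
        ∩ {w | 0 ∉ J (k + 3) w j})) atTop (𝓝 0) := by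
  classical
  have : Nonempty (Fin m) := ⟨⟨0, hm⟩⟩
  set V := volume.real (ball (0 : EuclideanSpace ℝ (Fin m)) 1) with hV
  have hV0 : 0 < V :=
    ENNReal.toReal_pos (measure_ball_pos _ _ one_pos).ne' measure_ball_lt_top.ne
  obtain ⟨ζ, hζm, hζlim, hζst⟩ := hsc
  obtain ⟨R, p, hp, hRp, hRlim⟩ := hS.exists_measure_card_lt_le ω hq
  obtain ⟨α, hα, Hα⟩ := measure_pi_le_card_le Q hε hε1
  have h3 : Tendsto (fun k : ℕ => k + 3) atTop atTop := tendsto_add_atTop_nat 3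
  set X : ℕ → ℝ≥0∞ := fun k => ((k + 3 : ℕ) : ℝ≥0∞) / (M (k + 3) : ℝ≥0∞) with hX
  set Z : ℕ → ℝ≥0∞ := fun k => ∫⁻ s, ζ (k + 1) s ∂(sampleLaw Q (k + 1)) with hZ
  have hXZ : Tendsto (fun k => X k ^ 2 * Z k) atTop (𝓝 0) := hζlim.comp (tendsto_add_atTop_nat 1)
  set β : ℕ → ℝ≥0∞ := fun k => ENNReal.ofReal (Real.exp (-(α * M (k + 3)))) with hβ
  have hβ0 : Tendsto β atTop (𝓝 0) := by
    have h5 : Tendsto (fun k => -(α * (M (k + 3) : ℝ))) atTop atBot :=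
      tendsto_neg_atTop_atBot.comp
        ((tendsto_natCast_atTop_atTop.comp (hM.comp h3)).const_mul_atTop hα)
    have h6 := ENNReal.tendsto_ofReal (Real.tendsto_exp_atBot.comp h5)
    rwa [ENNReal.ofReal_zero] at h6
  set E : ℕ → ℝ≥0∞ := fun n => (n : ℝ≥0∞) * P {w |
    (Finset.univ.filter fun j : Fin n => w ∈ {w | (O j w).D = !ω}).card < R n + 1} with hE
  set C := ENNReal.ofReal (c * V / a) ^ 2 with hC
  have hCt : C ≠ ∞ := by finiteness
  set C' := ENNReal.ofReal (p * (c / l * a)) with hC'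
  have hC't : C' ≠ ∞ := by finiteness
  have hlim : Tendsto (fun k => E (k + 3) + C' * (C * (X k ^ 2 * Z k) + β k)) atTop (𝓝 0) := by
    have h1 := (hRlim.comp h3).add (ENNReal.Tendsto.const_mul
      ((ENNReal.Tendsto.const_mul hXZ (Or.inr hCt)).add hβ0) (Or.inr hC't))
    simpa using h1
  refine tendsto_of_tendsto_of_tendsto_of_le_of_le' tendsto_const_nhds hlim
    (Eventually.of_forall fun n => zero_le) ?_
  filter_upwards [h3.eventually hRp, (tendsto_add_atTop_nat 1).eventually hζst,
    (hM.comp h3).eventually_ge_atTop 1] with k hkR hks hkM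
  obtain ⟨hR1, hRk⟩ := hkR
  have hNpos : (0 : ℝ) < (k + 3 : ℕ) := by positivity
  have hMpos : (0 : ℝ) < M (k + 3) := by exact_mod_cast hkM
  have hRpos : (0 : ℝ) < R (k + 3) := by exact_mod_cast hR1
  set κ : ℝ := M (k + 3) / (k + 3 : ℕ) with hκ
  have hκ0 : 0 < κ := by positivity
  set Bd := ENNReal.ofReal (c / l * (a * κ)) *
    (Z k / ENNReal.ofReal (a * κ / (c * V)) ^ 2 + β k) with hBd
  set b : Fin (k + 3) → Set Ω := fun j => {w | (O 0 w).D = ω} ∩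
    nearQuery O φ ω f₁ l ρ (a * κ) ((1 - ε) * κ) j ∩ {w | 0 ∉ J (k + 3) w j} with hb
  set q : Fin (k + 3) → Set Ω := fun j => {w | (O j w).D = !ω} with hqd
  have hne : ω ≠ !ω := by cases ω <;> decide
  have hpair : ∀ j j', j ≠ j' → P (b j ∩ q j') ≤ Bd := by
    intro j j' hjj'
    rcases eq_or_ne 0 j with rfl | hj
    · refine le_trans (le_of_eq ?_) zero_le
      convert measure_empty (μ := P)
      refine Set.eq_empty_of_forall_notMem fun w hw => hne ?_
      have h1 : (O 0 w).D = ω := hw.1.1.1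
      have h2 : (O 0 w).D = !ω := hw.1.1.2.1
      rw [← h2, h1]
    rcases eq_or_ne 0 j' with rfl | hj'
    · refine le_trans (le_of_eq ?_) zero_le
      convert measure_empty (μ := P)
      refine Set.eq_empty_of_forall_notMem fun w hw => hne ?_
      have h1 : (O 0 w).D = ω := hw.1.1.1
      have h2 : (O 0 w).D = !ω := hw.2
      rw [← h2, h1]
    refine hS.measure_near_notMem_le hm hφ h hν₁ hν₀ hε hρ hρε (hζm (k + 1)) hks hc hl
      (by positivity) (fun A _ hA hQA => Hα A hA (k + 1) (M (k + 3)) ?_) hj hj' hjj'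
    have hy : 0 ≤ (1 - ε) * κ := mul_nonneg (by linarith) hκ0.le
    have hQr : Q.real A ≤ (1 - ε) * κ := ENNReal.toReal_le_of_le_ofReal hy hQA
    calc ((k + 1 : ℕ) : ℝ) * Q.real A ≤ (k + 3 : ℕ) * ((1 - ε) * κ) := by
          gcongr
          omega
      _ = (1 - ε) * M (k + 3) := by
          rw [hκ]
          field_simp
  have hsum := sum_measure_le_of_inter_le (P := P) (b := b) (q := q)
    (fun j => ((hS.meas 0 (measurableSet_obs_D_eq ω)).inter
      (hS.measurableSet_nearQuery hφ h _ _ _ _ _)).inter (hS.measSet _ j 0).compl)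
    (fun j => hS.meas j (measurableSet_obs_D_eq _)) (fun j w hw => hw.1.2.1) hR1 hpair
  rw [Fintype.card_fin] at hsum
  have hM1 : (M (k + 3) : ℝ≥0∞)⁻¹ ≤ 1 := ENNReal.inv_le_one.2 (by exact_mod_cast hkM)
  have hZ2 : Z k / ENNReal.ofReal (a * κ / (c * V)) ^ 2 = C * (X k ^ 2 * Z k) := by
    have h7 : (ENNReal.ofReal (a * κ / (c * V)))⁻¹ = ENNReal.ofReal (c * V / a) * X k := by
      have : X k = ENNReal.ofReal (((k + 3 : ℕ) : ℝ) / (M (k + 3) : ℝ)) := by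
        rw [ENNReal.ofReal_div_of_pos hMpos, ENNReal.ofReal_natCast, ENNReal.ofReal_natCast]
      rw [← ENNReal.ofReal_inv_of_pos (by positivity), this, ← ENNReal.ofReal_mul (by positivity)]
      congr 1
      rw [hκ]
      field_simp
    rw [div_eq_mul_inv, ENNReal.inv_pow, h7, mul_pow, hC]
    ring
  have hconst : (M (k + 3) : ℝ≥0∞)⁻¹ * ((R (k + 3) : ℝ≥0∞)⁻¹ * (((k + 3 : ℕ) : ℝ≥0∞) ^ 2 *
      ENNReal.ofReal (c / l * (a * κ)))) ≤ C' := by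
    rw [← ENNReal.ofReal_natCast, ← ENNReal.ofReal_natCast, ← ENNReal.ofReal_natCast,
      ← ENNReal.ofReal_inv_of_pos hMpos, ← ENNReal.ofReal_inv_of_pos hRpos,
      ← ENNReal.ofReal_pow hNpos.le, ← ENNReal.ofReal_mul (by positivity),
      ← ENNReal.ofReal_mul (by positivity), ← ENNReal.ofReal_mul (by positivity)]
    refine ENNReal.ofReal_le_ofReal ?_
    calc _ = ((k + 3 : ℕ) : ℝ) / R (k + 3) * (c / l * a) := by
          rw [hκ]
          field_simp
      _ ≤ p * (c / l * a) := by
          gcongr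
          rwa [div_le_iff₀ hRpos]
  calc _ ≤ (M (k + 3) : ℝ≥0∞)⁻¹ * (E (k + 3) +
        (R (k + 3) : ℝ≥0∞)⁻¹ * (((k + 3 : ℕ) : ℝ≥0∞) ^ 2 * Bd)) := by
        gcongr
    _ = (M (k + 3) : ℝ≥0∞)⁻¹ * E (k + 3) + (M (k + 3) : ℝ≥0∞)⁻¹ * ((R (k + 3) : ℝ≥0∞)⁻¹ *
          (((k + 3 : ℕ) : ℝ≥0∞) ^ 2 * ENNReal.ofReal (c / l * (a * κ)))) *
          (Z k / ENNReal.ofReal (a * κ / (c * V)) ^ 2 + β k) := by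
        rw [hBd]
        ring
    _ ≤ 1 * E (k + 3) + C' * (C * (X k ^ 2 * Z k) + β k) := by
        rw [hZ2]
        gcongr
    _ = _ := by rw [one_mul]

/-- The mean of the product of the number of matched times and the odds is asymptotically at least
the second moment of the odds. -/
theorem IsMatchedSample.eventually_le_lintegral_mul (hS : IsMatchedSample P Q O φhat M J)
    (hm : 1 ≤ m) (hφ : Measurable (φ ω)) (h : IsDominatedPair f₀ f₁ c B) (hc : 0 < c)
    (hν₁ : (Q.restrict {o | o.D = ω}).map (fun o => φ ω o.X) = densityMeasure volume f₁)
    (hν₀ : (Q.restrict {o | o.D = !ω}).map (fun o => φ ω o.X) = densityMeasure volume f₀)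
    (hM : Tendsto M atTop atTop) (hMn : Tendsto (fun n : ℕ => (M n : ℝ) / n) atTop (𝓝 0))
    (hsc : ∀ ε : ℝ, 0 < ε → HasStableScale Q φ φhat M ω ε) {ε : ℝ≥0∞} (hε : ε ≠ 0) :
    ∀ᶠ k : ℕ in atTop,
      ∫⁻ u, ENNReal.ofReal (f₀ u / f₁ u) ^ 2 ∂(densityMeasure volume f₁) ≤
      ∫⁻ w in {w | (O 0 w).D = ω},
        (matchedTimes (fun i : Fin (k + 3) => O i w) (J (k + 3) w) 0 : ℝ≥0∞) / M (k + 3) *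
          ENNReal.ofReal (f₀ (φ ω (O 0 w).X) / f₁ (φ ω (O 0 w).X)) ∂P + ε := by
  have : Nonempty (Fin m) := ⟨⟨0, hm⟩⟩
  have hm0 := h.meas₀
  set S := ∫⁻ u, ENNReal.ofReal (f₀ u / f₁ u) ^ 2 ∂(densityMeasure volume f₁) with hSdef
  have hSt : S ≠ ∞ := by
    have := h.lintegral_ratio_sq_ne_top volume (ρ := 1) one_pos
    simpa [hSdef] using this
  have hU : Measurable fun o : Obs d => φ ω o.X := hφ.comp measurable_obs_X
  rcases (measureReal_nonneg (μ := Q) (s := {o : Obs d | o.D = !ω})).eq_or_lt with hq | hq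
  · -- Without queries the odds vanish.
    have hν0 : densityMeasure volume f₀ = 0 := by
      rw [← hν₀, ← Measure.measure_univ_eq_zero, Measure.map_apply hU MeasurableSet.univ,
        preimage_univ, Measure.restrict_apply_univ]
      exact (measureReal_eq_zero_iff).1 hq.symm
    have hf0 : ∀ᵐ u ∂(volume : Measure (EuclideanSpace ℝ (Fin m))), ENNReal.ofReal (f₀ u) = 0 :=
      (withDensity_eq_zero_iff (by fun_prop)).1 hν0
    have hS0 : S = 0 := by
      rw [hSdef, ← lintegral_zero (μ := densityMeasure volume f₁)]
      refine lintegral_congr_ae ((withDensity_absolutelyContinuous volume _).ae_le ?_)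
      filter_upwards [hf0] with u hu
      rw [ENNReal.ofReal_eq_zero] at hu
      rw [ENNReal.ofReal_eq_zero.2 (div_nonpos_of_nonpos_of_nonneg hu (h.nonneg₁ u)),
        zero_pow two_ne_zero]
    rw [hS0]
    exact Eventually.of_forall fun k => zero_le
  set e := ε / 4 with he
  have he0 : e ≠ 0 := (ENNReal.div_pos hε (by norm_num)).ne'
  have h4e : e + e + e + e = ε := by
    have : e + e + e + e = 4 * e := by ring
    rw [this, he, ENNReal.mul_div_cancel (by norm_num) (by norm_num)]
  obtain ⟨t, ht0, ht1, ht⟩ := exists_parameter_le m hSt he0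
  set ρ : ℝ := 1 - 2 * t with hρ
  have hρ0 : 0 < ρ := by linarith
  have hρ1 : ρ ≤ 1 := by linarith
  have hρε : (1 + t) * ρ ≤ 1 - t := by rw [hρ]; nlinarith
  set a := (1 - t) ^ 2 * ρ ^ m with ha
  have h1t : 0 < 1 - t := by linarith
  have ha0 : 0 < a := by positivity
  have ha1 : a ≤ 1 := mul_le_one₀ (pow_le_one₀ h1t.le (by linarith)) (by positivity)
    (pow_le_one₀ hρ0.le hρ1)
  obtain ⟨l, hl, hSl⟩ := h.exists_le_setLIntegral_add volume he0
  set Sl := ∫⁻ u in {u | l ≤ f₁ u}, ENNReal.ofReal (f₀ u / f₁ u) ^ 2 ∂(densityMeasure volume f₁)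
    with hSldef
  have hSlS : Sl ≤ S := setLIntegral_le_lintegral _ _
  have h3 : Tendsto (fun k : ℕ => k + 3) atTop atTop := tendsto_add_atTop_nat 3
  set κ : ℕ → ℝ := fun k => M (k + 3) / (k + 3 : ℕ) with hκ
  have hκ0 : Tendsto κ atTop (𝓝 0) := hMn.comp h3
  have hκpos : ∀ᶠ k in atTop, 0 < κ k := by
    filter_upwards [(hM.comp h3).eventually_ge_atTop 1] with k hk
    have : (0 : ℝ) < M (k + 3) := by exact_mod_cast hk
    positivity
  have hnear := h.eventually_le_lintegral_nearPairs volume hl ht0 (by linarith) hρ0 hκpos hκ0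
    he0
  rw [finrank_euclideanSpace_fin, ← ha, ← hSldef] at hnear
  have hfail := hS.tendsto_sum_measure_near_notMem hm hφ h hν₁ hν₀ hM hq ht0 (by linarith) hρ0 hρε
    (hsc t ht0) hc hl ha0
  have hrest : Tendsto (fun k : ℕ => ENNReal.ofReal (1 / ((k + 3 : ℕ) : ℝ)) * S) atTop (𝓝 0) := by
    have h1 := ENNReal.Tendsto.mul_const (b := S) (ENNReal.tendsto_ofReal
      ((tendsto_const_div_atTop_nhds_zero_nat (1 : ℝ)).comp h3)) (Or.inr hSt)
    simpa using h1
  have hsmall := (ENNReal.Tendsto.const_mul (a := ENNReal.ofReal c) hfail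
    (Or.inr ENNReal.ofReal_ne_top)).add hrest
  rw [mul_zero, add_zero] at hsmall
  filter_upwards [hnear, hsmall.eventually (ge_mem_nhds (pos_iff_ne_zero.2 he0)), hκpos,
    (hM.comp h3).eventually_ge_atTop 1] with k hk hks hkκ hkM
  have hbd := hS.mul_lintegral_nearPairs_le hφ h hν₁ hν₀ l ρ (a * κ k) ((1 - t) * κ k) k
  set I := ∫⁻ u, ENNReal.ofReal (f₀ u / f₁ u) * densityMeasure volume f₀
    (Prod.mk u ⁻¹' nearPairs volume f₁ l ρ (a * κ k) ((1 - t) * κ k)) ∂(densityMeasure volume f₁)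
    with hI
  set F := ∑ j : Fin (k + 3), P ({w | (O 0 w).D = ω} ∩
      nearQuery O φ ω f₁ l ρ (a * κ k) ((1 - t) * κ k) j ∩ {w | 0 ∉ J (k + 3) w j}) with hF
  set K := ∫⁻ w in {w | (O 0 w).D = ω},
    (matchedTimes (fun i : Fin (k + 3) => O i w) (J (k + 3) w) 0 : ℝ≥0∞) *
      ENNReal.ofReal (f₀ (φ ω (O 0 w).X) / f₁ (φ ω (O 0 w).X)) ∂P with hK
  have hNpos : (0 : ℝ) < (k + 3 : ℕ) := by positivity
  have hMpos : (0 : ℝ) < M (k + 3) := by exact_mod_cast hkM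
  have hM0 : (M (k + 3) : ℝ≥0∞) ≠ 0 := by
    have : M (k + 3) ≠ 0 := Nat.one_le_iff_ne_zero.1 hkM
    exact_mod_cast this
  have hKM : ∫⁻ w in {w | (O 0 w).D = ω},
      (matchedTimes (fun i : Fin (k + 3) => O i w) (J (k + 3) w) 0 : ℝ≥0∞) / M (k + 3) *
        ENNReal.ofReal (f₀ (φ ω (O 0 w).X) / f₁ (φ ω (O 0 w).X)) ∂P = (M (k + 3) : ℝ≥0∞)⁻¹ * K := by
    rw [hK, ← lintegral_const_mul' _ _ (by finiteness)]
    refine lintegral_congr fun w => ?_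
    rw [div_eq_mul_inv]
    ring
  rw [hKM]
  -- The factor `Y` turns the number of the other units into the number of matches.
  set Y : ℝ≥0∞ := (M (k + 3) : ℝ≥0∞)⁻¹ * ((k + 2 : ℕ) : ℝ≥0∞) with hY
  have hYκ : Y * ENNReal.ofReal (κ k) = ENNReal.ofReal (((k + 2 : ℕ) : ℝ) / (k + 3 : ℕ)) := by
    rw [hY, ← ENNReal.ofReal_natCast, ← ENNReal.ofReal_natCast,
      ← ENNReal.ofReal_inv_of_pos hMpos, ← ENNReal.ofReal_mul (by positivity),
      ← ENNReal.ofReal_mul (by positivity)]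
    congr 1
    simp only [hκ]
    field_simp
  have hYκ1 : Y * ENNReal.ofReal (κ k) ≤ 1 := by
    rw [hYκ, ENNReal.ofReal_le_one, div_le_one hNpos]
    push_cast
    linarith
  -- The loss in replacing `a (k + 2) / (k + 3)` by one is small, since `S` is finite.
  have hone : (1 : ℝ≥0∞) ≤ Y * ENNReal.ofReal (κ k) * ENNReal.ofReal a +
      ENNReal.ofReal (1 - a) + ENNReal.ofReal (1 / ((k + 3 : ℕ) : ℝ)) := by
    rw [hYκ, ← ENNReal.ofReal_mul (by positivity), ← ENNReal.ofReal_add (by positivity)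
      (by linarith), ← ENNReal.ofReal_add (by have : 0 ≤ 1 - a := by linarith
                                              positivity) (by positivity), ENNReal.one_le_ofReal]
    have h6 : ((k + 2 : ℕ) : ℝ) / (k + 3 : ℕ) = 1 - 1 / (k + 3 : ℕ) := by
      push_cast
      field_simp
      ring
    rw [h6]
    have : 0 < 1 / ((k + 3 : ℕ) : ℝ) := by positivity
    nlinarith
  have hmain : Y * ENNReal.ofReal (κ k) * ENNReal.ofReal a * Sl ≤
      (M (k + 3) : ℝ≥0∞)⁻¹ * K + ENNReal.ofReal c * ((M (k + 3) : ℝ≥0∞)⁻¹ * F) + e := by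
    calc _ = Y * (ENNReal.ofReal (κ k) * (ENNReal.ofReal a * Sl)) := by ring
      _ ≤ Y * (I + ENNReal.ofReal (κ k) * e) := by gcongr
      _ = (M (k + 3) : ℝ≥0∞)⁻¹ * (((k + 2 : ℕ) : ℝ≥0∞) * I) + Y * ENNReal.ofReal (κ k) * e := by
          rw [hY]; ring
      _ ≤ (M (k + 3) : ℝ≥0∞)⁻¹ * (K + ENNReal.ofReal c * F) + 1 * e := by gcongr
      _ = _ := by ring
  calc S ≤ 1 * Sl + e := by rwa [one_mul]
    _ ≤ (Y * ENNReal.ofReal (κ k) * ENNReal.ofReal a + ENNReal.ofReal (1 - a) +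
          ENNReal.ofReal (1 / ((k + 3 : ℕ) : ℝ))) * Sl + e := by gcongr
    _ ≤ ((M (k + 3) : ℝ≥0∞)⁻¹ * K + ENNReal.ofReal c * ((M (k + 3) : ℝ≥0∞)⁻¹ * F) + e) +
          ENNReal.ofReal (1 - a) * S + ENNReal.ofReal (1 / ((k + 3 : ℕ) : ℝ)) * S + e := by
        rw [add_mul, add_mul]
        gcongr
    _ = (M (k + 3) : ℝ≥0∞)⁻¹ * K + ((ENNReal.ofReal c * ((M (k + 3) : ℝ≥0∞)⁻¹ * F) +
          ENNReal.ofReal (1 / ((k + 3 : ℕ) : ℝ)) * S) + ENNReal.ofReal (1 - a) * S + e + e) := by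
        ring
    _ ≤ (M (k + 3) : ℝ≥0∞)⁻¹ * K + (e + e + e + e) := by
        gcongr
    _ = _ := by rw [h4e]

end LowerLimitSecond

/-! ### Mean-square convergence -/

section MeanSquare

open Set

variable {d m : ℕ} {Ω : Type*} [MeasurableSpace Ω]
  {P : Measure Ω} [IsProbabilityMeasure P] {Q : Measure (Obs d)} [IsProbabilityMeasure Q]
  {O : ℕ → Ω → Obs d} {φhat : Estimator d m} {M : ℕ → ℕ}
  {J : ∀ n : ℕ, Ω → Fin n → Finset (Fin n)}
  {φ : Bool → EuclideanSpace ℝ (Fin d) → EuclideanSpace ℝ (Fin m)}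

theorem IsMatchedSample.measurable_matchedTimes (hS : IsMatchedSample P Q O φhat M J) (n : ℕ)
    (i : Fin n) :
    Measurable fun w => matchedTimes (fun k : Fin n => O k w) (J n w) i := by
  unfold matchedTimes
  simp_rw [Finset.card_filter]
  refine Finset.measurable_sum _ fun j _ => Measurable.ite ?_ measurable_const measurable_const
  refine MeasurableSet.inter ?_ (hS.measSet n j i)
  exact measurableSet_eq_fun (measurable_obs_D.comp (hS.meas j))
    ((measurable_of_finite not).comp (measurable_obs_D.comp (hS.meas i)))

theorem ENNReal_ofReal_sub_sq_add {x t : ℝ} (hx : 0 ≤ x) (ht : 0 ≤ t) :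
    ENNReal.ofReal ((x - t) ^ 2) + 2 * (ENNReal.ofReal x * ENNReal.ofReal t) =
      ENNReal.ofReal x ^ 2 + ENNReal.ofReal t ^ 2 := by
  have h2 : (2 : ℝ≥0∞) = ENNReal.ofReal 2 := by simp
  rw [h2, ← ENNReal.ofReal_mul hx, ← ENNReal.ofReal_mul (by norm_num),
    ← ENNReal.ofReal_add (by positivity) (by positivity), ← ENNReal.ofReal_pow hx,
    ← ENNReal.ofReal_pow ht, ← ENNReal.ofReal_add (by positivity) (by positivity)]
  congr 1
  ring

/-- Mean-square convergence in one group, from the limits of the second moment and of the mixed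
moment. -/
theorem IsMatchedSample.eventually_setLIntegral_le (hS : IsMatchedSample P Q O φhat M J)
    (hm : 1 ≤ m) (hover : Overlap Q) (hφ : ∀ ω, Measurable (φ ω))
    {Xφ : Set (EuclideanSpace ℝ (Fin m))} (hreg : Regular Q φ Xφ)
    (hM : Tendsto M atTop atTop) (hMn : Tendsto (fun n : ℕ => (M n : ℝ) / n) atTop (𝓝 0))
    (ω : Bool) (hsc : ∀ ε : ℝ, 0 < ε → HasStableScale Q φ φhat M ω ε) {ε : ℝ≥0∞} (hε : ε ≠ 0)
    (hεt : ε ≠ ∞) :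
    ∀ᶠ k : ℕ in atTop, ∫⁻ w in {w | (O 0 w).D = ω}, ENNReal.ofReal
      (((matchedTimes (fun i : Fin (k + 3) => O i w) (J (k + 3) w) 0 : ℝ) / M (k + 3) -
        oddsTarget Q (O 0 w)) ^ 2) ∂P ≤ 3 * ε := by
  obtain ⟨f₀, f₁, c, B, hc, h, hν₁, hν₀, hodds⟩ := exists_isDominatedPair hover hφ hreg ω
  have hm0 := h.meas₀
  have hm1 := h.meas₁
  set S := ∫⁻ u, ENNReal.ofReal (f₀ u / f₁ u) ^ 2 ∂(densityMeasure volume f₁) with hSdef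
  have hSt : S ≠ ∞ := by
    have : Nonempty (Fin m) := ⟨⟨0, hm⟩⟩
    have := h.lintegral_ratio_sq_ne_top volume (ρ := 1) one_pos
    simpa [hSdef] using this
  have hU : Measurable fun o : Obs d => φ ω o.X := (hφ ω).comp measurable_obs_X
  have hGm : MeasurableSet {w | (O 0 w).D = ω} := hS.meas 0 (measurableSet_obs_D_eq ω)
  set t : Ω → ℝ := fun w => f₀ (φ ω (O 0 w).X) / f₁ (φ ω (O 0 w).X) with ht
  have ht0 : ∀ w, 0 ≤ t w := fun w => div_nonneg (h.nonneg₀ _) (h.nonneg₁ _)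
  have htm : Measurable t := by
    have hU0 := hU.comp (hS.meas 0)
    exact (hm0.comp hU0).div (hm1.comp hU0)
  have hae : ∀ᵐ w ∂P, (O 0 w).D = ω → oddsTarget Q (O 0 w) = t w := by
    have h1 : ∀ᵐ o ∂(P.map (O 0)), o.D = ω →
        oddsTarget Q o = f₀ (φ ω o.X) / f₁ (φ ω o.X) := by
      rwa [hS.law 0]
    exact ae_of_ae_map (hS.meas 0).aemeasurable h1
  have htS : ∫⁻ w in {w | (O 0 w).D = ω}, ENNReal.ofReal (t w) ^ 2 ∂P = S := by
    have hmp : MeasurePreserving (O 0) P Q := ⟨hS.meas 0, hS.law 0⟩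
    have hg : Measurable fun u => ENNReal.ofReal (f₀ u / f₁ u) ^ 2 := by fun_prop
    rw [hSdef, ← hν₁, lintegral_map hg hU]
    exact hmp.setLIntegral_comp_preimage (measurableSet_obs_D_eq ω) (hg.comp hU)
  filter_upwards [hS.eventually_lintegral_sq_le hm (hφ ω) h hν₁ hν₀ hM hMn hsc hε,
    hS.eventually_le_lintegral_mul hm (hφ ω) h hc hν₁ hν₀ hM hMn hsc hε,
    (hM.comp (tendsto_add_atTop_nat 3)).eventually_ge_atTop 1] with k hU2 hL hkM
  set x : Ω → ℝ := fun w =>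
    (matchedTimes (fun i : Fin (k + 3) => O i w) (J (k + 3) w) 0 : ℝ) / M (k + 3) with hx
  have hx0 : ∀ w, 0 ≤ x w := fun w => by positivity
  have hxm : Measurable x := by
    have hc : Measurable fun j : ℕ => (j : ℝ) := measurable_of_countable _
    exact (hc.comp (hS.measurable_matchedTimes (k + 3) 0)).div_const _
  have hMpos : (0 : ℝ) < M (k + 3) := by exact_mod_cast hkM
  have hxe : ∀ w, (matchedTimes (fun i : Fin (k + 3) => O i w) (J (k + 3) w) 0 : ℝ≥0∞) /
      M (k + 3) = ENNReal.ofReal (x w) := fun w => by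
    rw [hx, ENNReal.ofReal_div_of_pos hMpos, ENNReal.ofReal_natCast, ENNReal.ofReal_natCast]
  simp only [hxe] at hU2 hL
  have heq : ∫⁻ w in {w | (O 0 w).D = ω}, ENNReal.ofReal ((x w - oddsTarget Q (O 0 w)) ^ 2) ∂P =
      ∫⁻ w in {w | (O 0 w).D = ω}, ENNReal.ofReal ((x w - t w) ^ 2) ∂P := by
    refine setLIntegral_congr_fun_ae hGm ?_
    filter_upwards [hae] with w hw hG
    rw [hw hG]
  rw [heq]
  set A := ∫⁻ w in {w | (O 0 w).D = ω}, ENNReal.ofReal (x w) * ENNReal.ofReal (t w) ∂P with hA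
  have hsum : ∫⁻ w in {w | (O 0 w).D = ω}, ENNReal.ofReal ((x w - t w) ^ 2) ∂P + 2 * A =
      ∫⁻ w in {w | (O 0 w).D = ω}, ENNReal.ofReal (x w) ^ 2 ∂P + S := by
    rw [← htS, ← lintegral_add_left (by fun_prop), hA, ← lintegral_const_mul _ (by fun_prop),
      ← lintegral_add_left (by fun_prop)]
    exact lintegral_congr fun w => ENNReal_ofReal_sub_sq_add (hx0 w) (ht0 w)
  have hle : ∫⁻ w in {w | (O 0 w).D = ω}, ENNReal.ofReal ((x w - t w) ^ 2) ∂P + 2 * A ≤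
      S + ε + S := by
    rw [hsum]
    gcongr
  have hAt : 2 * A ≠ ∞ := ne_top_of_le_ne_top (by finiteness) (le_add_self.trans hle)
  refine (ENNReal.add_le_add_iff_right hAt).1 (hle.trans ?_)
  calc S + ε + S ≤ (A + ε) + ε + (A + ε) := by gcongr
    _ = 3 * ε + 2 * A := by ring

end MeanSquare

theorem tendsto_div_of_tendsto_mul_log_div {M : ℕ → ℕ}
    (h : Tendsto (fun n : ℕ => (M n : ℝ) * Real.log n / n) atTop (𝓝 0)) :
    Tendsto (fun n : ℕ => (M n : ℝ) / n) atTop (𝓝 0) := by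
  refine squeeze_zero' (Eventually.of_forall fun n => by positivity) ?_ h
  have hlog : ∀ᶠ n : ℕ in atTop, 1 ≤ Real.log n :=
    (Real.tendsto_log_atTop.comp tendsto_natCast_atTop_atTop).eventually_ge_atTop 1
  filter_upwards [hlog] with n hn
  gcongr
  exact le_mul_of_one_le_right (by positivity) hn

end Matching

end

theorem theorem6 {d m : ℕ} (hm : 1 ≤ m)
    {Ω : Type*} [MeasurableSpace Ω] (P : Measure Ω) [IsProbabilityMeasure P]
    -- the i.i.d. observations `(X_i, D_i, Y_i)`, with common law `Q`
    (Q : Measure (Matching.Obs d)) [IsProbabilityMeasure Q]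
    (O : ℕ → Ω → Matching.Obs d) (hO : ∀ i, Measurable (O i))
    (hlaw : ∀ i, P.map (O i) = Q) (hindep : iIndepFun O P)
    (hoverlap : Matching.Overlap Q)
    -- the maps `φ_0, φ_1`, their codomain, and the estimators
    (φ : Bool → EuclideanSpace ℝ (Fin d) → EuclideanSpace ℝ (Fin m))
    (hφ : ∀ ω, Measurable (φ ω))
    (Xφ : Set (EuclideanSpace ℝ (Fin m)))
    (hreg : Matching.Regular Q φ Xφ)
    (φhat : Matching.Estimator d m)
    -- the number of matches
    (M : ℕ → ℕ) (hM : Tendsto M atTop atTop)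
    (hMlog : Tendsto (fun n : ℕ => (M n : ℝ) * Real.log n / n) atTop (𝓝 0))
    -- the matched sets, for samples of every size
    (J : ∀ n : ℕ, Ω → Fin n → Finset (Fin n))
    (hJmeas : ∀ n (i j : Fin n), MeasurableSet {w | j ∈ J n w i})
    (hJ : ∀ n w (i : Fin n), Matching.IsMatchSet (M n) (fun k : Fin n => O k w)
      (fun ω => φhat ω (Matching.sampleOf fun k : Fin n => O k w)) i (J n w i))
    (hrate : Matching.MomentRate Q φ φhat M ∨ Matching.ModulusRate Q φ φhat M) :
    Tendsto (fun n : ℕ =>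
        ∫⁻ w, ENNReal.ofReal
          (((Matching.matchedTimes (fun k : Fin (n + 1) => O k w) (J (n + 1) w) 0 : ℝ) / M (n + 1)
            - Matching.oddsTarget Q (O 0 w)) ^ 2) ∂P)
      atTop (𝓝 0) := by
  have hMn := Matching.tendsto_div_of_tendsto_mul_log_div hMlog
  have hS : Matching.IsMatchedSample P Q O φhat M J := ⟨hO, hlaw, hindep, hJmeas, hJ⟩
  have hsc : ∀ (ω : Bool) (ε : ℝ), 0 < ε → Matching.HasStableScale Q φ φhat M ω ε :=
    fun ω ε hε => hrate.elim (fun h => h.hasStableScale hm hM ω hε)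
      fun h => h.hasStableScale hm hM hMn ω hε
  -- The sample sizes start at three: the first unit and two inserted queries.
  rw [← tendsto_add_atTop_iff_nat 2, ENNReal.tendsto_nhds_zero]
  intro ε hε
  set e := min (ε / 6) 1 with he
  have he0 : e ≠ 0 := (lt_min (ENNReal.div_pos hε.ne' (by norm_num)) one_pos).ne'
  have het : e ≠ ∞ := ne_top_of_le_ne_top ENNReal.one_ne_top (min_le_right _ _)
  -- The mean square is split according to the group of the first unit.
  filter_upwards [hS.eventually_setLIntegral_le hm hoverlap hφ hreg hM hMn true (hsc true) he0 het,
    hS.eventually_setLIntegral_le hm hoverlap hφ hreg hM hMn false (hsc false) he0 het] with k h1 h0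
  have hG : MeasurableSet {w | (O 0 w).D = true} :=
    hO 0 (Matching.measurableSet_obs_D_eq true)
  have hGc : {w | (O 0 w).D = true}ᶜ = {w | (O 0 w).D = false} := by
    ext w
    simp
  rw [← hGc] at h0
  have h10 := add_le_add h1 h0
  rw [lintegral_add_compl _ hG] at h10
  calc _ ≤ 3 * e + 3 * e := h10
    _ = 6 * e := by ring
    _ ≤ 6 * (ε / 6) := by gcongr; exact min_le_left _ _
    _ = ε := ENNReal.mul_div_cancel (by norm_num) (by norm_num)
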